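/- **Setting.** Let $dS_3$ be the unit hyperboloid with metric $h^{(0)}=-d\tau^2+\cosh^2\tau\,(d\theta^2+\sin^2\theta\,d\phi^2)$ and covariant derivative $\mathcal D_a$, covered by the patches $\mathcal N=\{\theta\le\pi/2\}$ and $\mathcal S=\{\theta\ge\pi/2\}$ (poles included). A *Ricci-flat Beig–Schmidt configuration* consists of a smooth function $\sigma$ on $dS_3$ and, on each patch, of smooth symmetric tensors $k_{ab}$, $h^{(2)}_{ab}$ (smooth up to the equator; the representatives on $\mathcal N$ and $\mathcal S$ may differ by a transition function on the equator, so that NUT charges are allowed) and a metric $$ds^2=\Big(1+\frac{\sigma}{\rho}\Big)^2d\rho^2+h_{ab}\,dx^adx^b,\qquad h_{ab}=\rho^2\Big(h^{(0)}_{ab}+\frac{-2\sigma h^{(0)}_{ab}+k_{ab}}{\rho}+\frac{h^{(2)}_{ab}}{\rho^2}+O(\rho^{-3})\Big),$$ defined, smooth and Ricci flat for large $\rho$ on every bounded $\tau$-interval, where the expansion is uniform on bounded $\tau$-intervals and may be differentiated twice (each $\partial_\rho$ gaining a factor $\rho^{-1}$ in the error), and $k_a{}^a=0$, $\mathcal D^ak_{ab}=0$.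 Write $\sigma_a=\mathcal D_a\sigma$, $\sigma_{ab}=\mathcal D_a\mathcal D_b\sigma$, with indices raised by $h^{(0)}$. Let $K_{ab}$ be the extrinsic curvature of the hypersurface $\rho=$ const, $K=h^{ab}K_{ab}$, and let $\hat K_{ab}$ be a symmetric solution, for large $\rho$ on every bounded $\tau$-interval, of $$\mathcal R_{ab}[h]=\hat K_{ab}\hat K-\hat K_a{}^c\hat K_{cb},\qquad \hat K=h^{ab}\hat K_{ab},\qquad \hat K_{ab}=\rho h^{(0)}_{ab}+o(\rho)$$ (the $o(\rho)$ uniform on bounded $\tau$-intervals). With hyperbolic cut-offs $\tau_1\le\tau\le\tau_2$ and $\rho_0\le r\le\rho$ the Mann–Marolf action is $$S_{\rho_0,\rho}=\frac1{16\pi G}\int\sqrt{-g}\,R+\frac1{8\pi G}\int_{r=\rho}\sqrt{-h}\,(K-\hat K),\qquad G>0 .$$ Integrals over (parts of) $dS_3$ are sums of the integrals over the two patches. **Theorem.** For every Ricci-flat Beig–Schmidt configuration (with $k_{ab}\neq0$ allowed): 1. A tensor $\hat K_{ab}$ as above exists. For every such $\hat K_{ab}$, uniformly on every interval $\tau_1\le\tau\le\tau_2$,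 $K=3/\rho+O(\rho^{-3})$, $\hat K=3/\rho+O(\rho^{-3})$ and $$K-\hat K=\frac1{4\rho^3}\left[3\sigma^2+\sigma_{ab}k^{ab}-\sigma_{ab}\sigma^{ab}\right]+O(\rho^{-4}).$$ 2. For all $\tau_1\le\tau_2$ the divergent terms of the boundary term cancel: $\sqrt{-h}\,(K-\hat K)$ is integrable over $\tau_1\le\tau\le\tau_2$ for large $\rho$ and, for all large $\rho_0$, $$16\pi G\,S_{\text{on-shell}}:=\lim_{\rho\to\infty}16\pi G\,S_{\rho_0,\rho}=\frac12\int_{\tau_1\le\tau\le\tau_2}d^3x\sqrt{-h^{(0)}}\left[3\sigma^2+\sigma_{ab}k^{ab}-\sigma_{ab}\sigma^{ab}\right].$$ 3. This integral is zero up to boundary contributions. On each patch $$3\sigma^2+\sigma_{ab}k^{ab}-\sigma_{ab}\sigma^{ab}=\mathcal D_aJ^a,\qquad J^a=(k^{ab}-\sigma^{ab}-\sigma h^{(0)ab})\sigma_b,$$ and the integral in 2 equals exactly $\mathcal F(\tau_2)-\mathcal F(\tau_1)+\mathcal E$, where $\mathcal F(\tau)=\int_{S^2}\sqrt{-h^{(0)}}\,J^\tau\,d\theta\,d\phi$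 is the flux through the cut of constant $\tau$ and $\mathcal E$ is the sum over the two patches of the flux of $k^{ab}\sigma_b$ out of the patch through the equator, $\tau_1\le\tau\le\tau_2$ (the flux of the jump of $k^{ab}$). In particular, if these contributions of the future and past boundaries and of the patch interface add up to zero, then $S_{\text{on-shell}}=0$. -/

import Mathlib

namespace MannMarolf

noncomputable section

open scoped ContDiff

/-! ### Coordinate tensor calculus on open pieces of `ℝⁿ` -/

/-- A matrix-valued function on coordinate space: the components of a covariant two-tensor. -/
abbrev Tensor2 (n : ℕ) := (Fin n → ℝ) → Matrix (Fin n) (Fin n) ℝ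

/-- The partial derivative `∂ᵢ f`. -/
def pd {n : ℕ} (i : Fin n) (f : (Fin n → ℝ) → ℝ) (x : Fin n → ℝ) : ℝ :=
  fderiv ℝ f x (Pi.single i 1)

/-- Christoffel symbols `Γ^c_{ab}` of the metric `g`. -/
def christoffel {n : ℕ} (g : Tensor2 n) (c a b : Fin n) (x : Fin n → ℝ) : ℝ :=
  (1 / 2) * ∑ d, (g x)⁻¹ c d *
    (pd a (fun y => g y d b) x + pd b (fun y => g y d a) x - pd d (fun y => g y a b) x)

/-- Ricci tensor
`R_{ab} = ∂_c Γ^c_{ab} - ∂_b Γ^c_{ac} + Γ^c_{cd} Γ^d_{ab} - Γ^c_{bd} Γ^d_{ac}`. -/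
def ricci {n : ℕ} (g : Tensor2 n) (a b : Fin n) (x : Fin n → ℝ) : ℝ :=
  (∑ c, (pd c (christoffel g c a b) x - pd b (christoffel g c a c) x)) +
    ∑ c, ∑ d, (christoffel g c c d x * christoffel g d a b x -
      christoffel g c b d x * christoffel g d a c x)

/-- Ricci scalar `g^{ab} R_{ab}`. -/
def ricciScalar {n : ℕ} (g : Tensor2 n) (x : Fin n → ℝ) : ℝ :=
  ∑ a, ∑ b, (g x)⁻¹ a b * ricci g a b x

/-- The covariant Hessian `D_a D_b f`. -/
def hess {n : ℕ} (g : Tensor2 n) (f : (Fin n → ℝ) → ℝ) : Tensor2 n := fun x =>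
  Matrix.of fun a b => pd a (pd b f) x - ∑ c, christoffel g c a b x * pd c f x

/-- The divergence `D^b A_{ab} = g^{bc} D_c A_{ab}` of a covariant two-tensor. -/
def divTensor {n : ℕ} (g A : Tensor2 n) (a : Fin n) (x : Fin n → ℝ) : ℝ :=
  ∑ b, ∑ c, (g x)⁻¹ b c * (pd c (fun y => A y a b) x -
    ∑ d, (christoffel g d c a x * A x d b + christoffel g d c b x * A x a d))

/-- The divergence `D_a J^a` of a vector field. -/
def divVector {n : ℕ} (g : Tensor2 n) (J : (Fin n → ℝ) → Fin n → ℝ) (x : Fin n → ℝ) : ℝ :=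
  ∑ a, (pd a (fun y => J y a) x + ∑ b, christoffel g a a b x * J x b)

/-- The trace `g^{ab} A_{ab}`. -/
def tr {n : ℕ} (g A : Matrix (Fin n) (Fin n) ℝ) : ℝ := ∑ a, ∑ b, g⁻¹ a b * A a b

/-- The full contraction `A_{ab} B^{ab} = g^{ac} g^{bd} A_{ab} B_{cd}`. -/
def contract {n : ℕ} (g A B : Matrix (Fin n) (Fin n) ℝ) : ℝ :=
  ∑ a, ∑ b, ∑ c, ∑ d, g⁻¹ a c * g⁻¹ b d * A a b * B c d

/-- The vector `A^{ab} ∂_b f`, both indices of `A` being raised with `g`. -/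
def raiseGrad {n : ℕ} (g A : Tensor2 n) (f : (Fin n → ℝ) → ℝ) (x : Fin n → ℝ) (a : Fin n) : ℝ :=
  ∑ b, ∑ c, ∑ d, (g x)⁻¹ a c * (g x)⁻¹ b d * A x c d * pd b f x

/-! ### The unit hyperboloid and its two patches

Patch `0` (north) is the part `θ ≤ π/2` of the hyperboloid and patch `1` (south) the part
`θ ≥ π/2`, the poles included. To have coordinates that are regular at the pole of the patch we use
`u = (τ, w)`, where `w = tan (θ/2) (cos φ, sin φ)` in the north and `w = cot (θ/2) (cos φ, sin φ)` in
the south (stereographic coordinates on the sphere). Both patches are then `|w| ≤ 1`, the equator is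
`|w| = 1`, the two charts are related by `w ↦ w / |w|²`, and in both of them
`-dτ² + cosh² τ (dθ² + sin² θ dφ²) = -dτ² + 4 cosh² τ |dw|² / (1 + |w|²)²`. -/

/-- The metric `h⁽⁰⁾` of the unit hyperboloid `dS₃`. -/
def dS : Tensor2 3 := fun u =>
  Matrix.diagonal ![-1,
    4 * Real.cosh (u 0) ^ 2 / (1 + u 1 ^ 2 + u 2 ^ 2) ^ 2,
    4 * Real.cosh (u 0) ^ 2 / (1 + u 1 ^ 2 + u 2 ^ 2) ^ 2]

/-- The part `τ₁ ≤ τ ≤ τ₂` of a patch. -/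
def slab (τ₁ τ₂ : ℝ) : Set (Fin 3 → ℝ) :=
  {u | τ₁ ≤ u 0 ∧ u 0 ≤ τ₂ ∧ u 1 ^ 2 + u 2 ^ 2 ≤ 1}

/-- A patch of the hyperboloid. -/
def patch : Set (Fin 3 → ℝ) := {u | u 1 ^ 2 + u 2 ^ 2 ≤ 1}

/-- The four-metric `(1 + σ/ρ)² dρ² + h_{ab} dxᵃ dxᵇ` in the coordinates `(ρ, u)`. -/
def metric4 (σ : (Fin 3 → ℝ) → ℝ) (h : ℝ → Tensor2 3) : Tensor2 4 := fun x =>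
  Matrix.of fun i j =>
    Fin.cases (motive := fun _ => ℝ)
      (Fin.cases (motive := fun _ => ℝ) ((1 + σ (Fin.tail x) / x 0) ^ 2) (fun _ => 0) j)
      (fun a => Fin.cases (motive := fun _ => ℝ) 0 (fun b => h (x 0) (Fin.tail x) a b) j) i

/-- The error term of the expansion of `ρ⁻² h_{ab}` to second order, with
`h⁽¹⁾_{ab} = -2 σ h⁽⁰⁾_{ab} + k_{ab}`, as a function of `(ρ, u)`. -/
def remainder (σ : (Fin 3 → ℝ) → ℝ) (k h₂ : Tensor2 3) (h : ℝ → Tensor2 3) (a b : Fin 3)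
    (x : Fin 4 → ℝ) : ℝ :=
  h (x 0) (Fin.tail x) a b / x 0 ^ 2 -
    (dS (Fin.tail x) a b +
      (-2 * σ (Fin.tail x) * dS (Fin.tail x) a b + k (Fin.tail x) a b) / x 0 +
      h₂ (Fin.tail x) a b / x 0 ^ 2)

/-- The extra power of `1/ρ` gained by `∂_ρ` (index `0`); derivatives along the hyperboloid gain
none. -/
def weight (i : Fin 4) : ℕ := if i = 0 then 1 else 0

/-- A Ricci-flat Beig-Schmidt configuration. The index `P : Fin 2` is the patch. The two patch
representatives of `k`, `h⁽²⁾` and `h` may differ by an arbitrary transition function on the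
equator. -/
structure Configuration where
  /-- the mass aspect -/
  σ : Fin 2 → (Fin 3 → ℝ) → ℝ
  /-- `k_{ab} = h⁽¹⁾_{ab} + 2 σ h⁽⁰⁾_{ab}` -/
  k : Fin 2 → Tensor2 3
  /-- the second-order metric `h⁽²⁾_{ab}` -/
  h₂ : Fin 2 → Tensor2 3
  /-- the metric `h_{ab}` on the hyperboloid of radius `ρ` -/
  h : Fin 2 → ℝ → Tensor2 3
  /-- `σ` is a smooth function on the whole hyperboloid -/
  σ_smooth : ∀ P, ContDiff ℝ ∞ (σ P)
  σ_glue : ∀ τ p q : ℝ, p ^ 2 + q ^ 2 ≠ 0 →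
    σ 1 ![τ, p, q] = σ 0 ![τ, p / (p ^ 2 + q ^ 2), q / (p ^ 2 + q ^ 2)]
  k_symm : ∀ P, ∀ u ∈ patch, (k P u).IsSymm
  k_smooth : ∀ P, ∀ u ∈ patch, ∀ a b, ContDiffAt ℝ ∞ (fun v => k P v a b) u
  h₂_smooth : ∀ P, ∀ u ∈ patch, ∀ a b, ContDiffAt ℝ ∞ (fun v => h₂ P v a b) u
  /-- the boundary condition `k_a{}^a = 0` -/
  k_trace : ∀ P, ∀ u ∈ patch, tr (dS u) (k P u) = 0
  /-- the boundary condition `D^b k_{ab} = 0` -/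
  k_div : ∀ P, ∀ u ∈ patch, ∀ a, divTensor dS (k P) a u = 0
  /-- on every bounded time interval `h` is a smooth symmetric tensor for large `ρ` -/
  h_smooth : ∀ τ₁ τ₂ : ℝ, ∃ R > 0, ∀ P, ∀ ρ > R, ∀ u ∈ slab τ₁ τ₂,
    (h P ρ u).IsSymm ∧ ∀ a b, ContDiffAt ℝ ∞
      (fun x : Fin 4 → ℝ => h P (x 0) (Fin.tail x) a b) (Fin.cons ρ u)
  /-- `h_{ab} = ρ² (h⁽⁰⁾_{ab} + h⁽¹⁾_{ab} / ρ + h⁽²⁾_{ab} / ρ² + O(ρ⁻³))`, the expansion being uniform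
  on bounded time intervals and valid for the derivatives up to second order -/
  expansion : ∀ τ₁ τ₂ : ℝ, ∃ C, ∃ R > 0, ∀ P, ∀ ρ > R, ∀ u ∈ slab τ₁ τ₂, ∀ a b,
    |remainder (σ P) (k P) (h₂ P) (h P) a b (Fin.cons ρ u)| ≤ C / ρ ^ 3 ∧
    (∀ i, |pd i (remainder (σ P) (k P) (h₂ P) (h P) a b) (Fin.cons ρ u)| ≤
      C / ρ ^ (3 + weight i)) ∧
    (∀ i j, |pd i (pd j (remainder (σ P) (k P) (h₂ P) (h P) a b)) (Fin.cons ρ u)| ≤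
      C / ρ ^ (3 + weight i + weight j))
  /-- the vacuum Einstein equations -/
  ricci_flat : ∀ τ₁ τ₂ : ℝ, ∃ R > 0, ∀ P, ∀ ρ > R, ∀ u ∈ slab τ₁ τ₂, ∀ i j,
    ricci (metric4 (σ P) (h P)) i j (Fin.cons ρ u) = 0

namespace Configuration

variable (X : Configuration)

/-- Extrinsic curvature `K_{ab} = ½ £_n h_{ab}` of the hyperboloid of radius `ρ`, whose outward unit
normal is `n = (1 + σ/ρ)⁻¹ ∂_ρ`. -/
def extrinsic (P : Fin 2) (ρ : ℝ) : Tensor2 3 := fun u =>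
  Matrix.of fun a b => deriv (fun r => X.h P r u a b) ρ / (2 * (1 + X.σ P u / ρ))

/-- `K = h^{ab} K_{ab}`. -/
def meanCurv (P : Fin 2) (ρ : ℝ) (u : Fin 3 → ℝ) : ℝ := tr (X.h P ρ u) (X.extrinsic P ρ u)

/-- `Khat` is a Mann-Marolf tensor of the configuration: on every bounded time interval it is a
symmetric solution of `R_{ab} = K̂_{ab} K̂ - K̂_a{}^c K̂_{cb}` for large `ρ`, where `R_{ab}` is the
Ricci tensor of `h_{ab}`, and it lies on the branch `K̂_{ab} = ρ h⁽⁰⁾_{ab} + o(ρ)`. -/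
def IsMannMarolf (Khat : Fin 2 → ℝ → Tensor2 3) : Prop :=
  ∀ τ₁ τ₂ : ℝ,
    (∃ R > 0, ∀ P, ∀ ρ > R, ∀ u ∈ slab τ₁ τ₂, (Khat P ρ u).IsSymm ∧ ∀ a b,
      ricci (X.h P ρ) a b u = Khat P ρ u a b * tr (X.h P ρ u) (Khat P ρ u) -
        (Khat P ρ u * (X.h P ρ u)⁻¹ * Khat P ρ u) a b) ∧
    (∀ ε > 0, ∃ R > 0, ∀ P, ∀ ρ > R, ∀ u ∈ slab τ₁ τ₂, ∀ a b,
      |Khat P ρ u a b - ρ * dS u a b| ≤ ε * ρ)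

/-- `K̂ = h^{ab} K̂_{ab}`. -/
def hatTrace (Khat : Fin 2 → ℝ → Tensor2 3) (P : Fin 2) (ρ : ℝ) (u : Fin 3 → ℝ) : ℝ :=
  tr (X.h P ρ u) (Khat P ρ u)

/-- The bulk integral `∫ √(-g) R` over `ρ₀ ≤ r ≤ ρ`, `τ₁ ≤ τ ≤ τ₂`. -/
def bulkTerm (τ₁ τ₂ ρ₀ ρ : ℝ) : ℝ :=
  ∑ P, ∫ r in ρ₀..ρ, ∫ u in slab τ₁ τ₂,
    Real.sqrt (-(metric4 (X.σ P) (X.h P) (Fin.cons r u)).det) *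
      ricciScalar (metric4 (X.σ P) (X.h P)) (Fin.cons r u)

/-- The boundary integral `∫ √(-h) (K - K̂)` over `τ₁ ≤ τ ≤ τ₂` on the hyperboloid of radius `ρ`. -/
def boundaryTerm (Khat : Fin 2 → ℝ → Tensor2 3) (τ₁ τ₂ ρ : ℝ) : ℝ :=
  ∑ P, ∫ u in slab τ₁ τ₂, Real.sqrt (-(X.h P ρ u).det) *
    (X.meanCurv P ρ u - X.hatTrace Khat P ρ u)

/-- The Mann-Marolf action of the region `ρ₀ ≤ r ≤ ρ`, `τ₁ ≤ τ ≤ τ₂`. -/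
def action (G : ℝ) (Khat : Fin 2 → ℝ → Tensor2 3) (τ₁ τ₂ ρ₀ ρ : ℝ) : ℝ :=
  1 / (16 * Real.pi * G) * X.bulkTerm τ₁ τ₂ ρ₀ ρ +
    1 / (8 * Real.pi * G) * X.boundaryTerm Khat τ₁ τ₂ ρ

/-- The density `3 σ² + σ_{ab} k^{ab} - σ_{ab} σ^{ab}`, with `σ_{ab} = D_a D_b σ`. -/
def density (P : Fin 2) (u : Fin 3 → ℝ) : ℝ :=
  3 * X.σ P u ^ 2 + contract (dS u) (hess dS (X.σ P) u) (X.k P u) -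
    contract (dS u) (hess dS (X.σ P) u) (hess dS (X.σ P) u)

/-- `∫ √(-h⁽⁰⁾) (3 σ² + σ_{ab} k^{ab} - σ_{ab} σ^{ab})` over the part `τ₁ ≤ τ ≤ τ₂` of `dS₃`. -/
def densityIntegral (τ₁ τ₂ : ℝ) : ℝ :=
  ∑ P, ∫ u in slab τ₁ τ₂, Real.sqrt (-(dS u).det) * X.density P u

/-- The current `J^a = (k^{ab} - σ^{ab} - σ h⁽⁰⁾^{ab}) σ_b`. -/
def current (P : Fin 2) (u : Fin 3 → ℝ) (a : Fin 3) : ℝ :=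
  raiseGrad dS (fun v => X.k P v - hess dS (X.σ P) v - X.σ P v • dS v) (X.σ P) u a

/-- The flux of the current through the cut `τ = const` of the hyperboloid. -/
def cutFlux (τ : ℝ) : ℝ :=
  ∑ P, ∫ w in {w : ℝ × ℝ | w.1 ^ 2 + w.2 ^ 2 ≤ 1},
    Real.sqrt (-(dS ![τ, w.1, w.2]).det) * X.current P ![τ, w.1, w.2] 0

/-- The contribution of the equator: the sum over the two patches of the flux of `k^{ab} σ_b` out of
the patch. As the outward directions are opposite, this is the flux of the jump of `k^{ab}`. -/
def equatorFlux (τ₁ τ₂ : ℝ) : ℝ :=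
  ∑ P, ∫ t in τ₁..τ₂, ∫ s in (0 : ℝ)..(2 * Real.pi),
    Real.sqrt (-(dS ![t, Real.cos s, Real.sin s]).det) *
      (Real.cos s * raiseGrad dS (X.k P) (X.σ P) ![t, Real.cos s, Real.sin s] 1 +
        Real.sin s * raiseGrad dS (X.k P) (X.σ P) ![t, Real.cos s, Real.sin s] 2)

/-- The boundary contributions: future boundary, past boundary, and interface of the patches. -/
def boundaryContribution (τ₁ τ₂ : ℝ) : ℝ :=
  X.cutFlux τ₂ - X.cutFlux τ₁ + X.equatorFlux τ₁ τ₂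

end Configuration

end

end MannMarolf

/-! Everything is expressed through the mixed tensors `L = ρ h⁻¹ K` (`mixedExtrinsic`), `M = ρ h⁻¹
K̂` (`mixedHat`) and `S = ρ² h⁻¹ Ric[h]` (`mixedRicci`), which have expansions in `1/ρ` uniform over
a slab. The equation for `K̂` reads `quad M = S` with `quad M = (tr M) M - M²`. Since `quad 1 = 2·1`
and the derivative `X ↦ X + (tr X) 1` of `quad` at `1` is invertible, the inverse function theorem
yields a solution near `1` and its local uniqueness. Uniqueness makes `K̂` symmetric and, through
`Jet.of_quad`, fixes the `1/ρ` term of every solution on the prescribed branch.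

The difference of the traces needs first-order data only. Ricci flatness gives the radial constraint
`tr S = (tr L)² - tr L²` (`Good.mixedRicci_trace`), and the trace of `quad M = S` is the same
relation for `M`. Let `L = 1 + A/ρ + O(ρ⁻²)` and `M = 1 + B/ρ + O(ρ⁻²)` with `A` and `B` traceless.
As `(tr L)² - tr L² = 6 + 4 (tr L - 3) + (tr L - 3)² - tr (L - 1)²`, comparison gives `4 (tr L - tr
M) = ρ⁻² (tr A² - tr B²) + O(ρ⁻³)`, so `h⁽²⁾` drops out (`trace_sub_trace_isBigO`). The expansions
give `A = -k/2` and `B = σ + DDσ - k/2`. Comparing the constraint with the tangential Einstein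
equations at order `1/ρ` gives `D_a D^a σ + 3 σ = 0`. This makes `B` traceless and identifies `tr A²
- tr B²` with `density`. Since `√(-h)` is `ρ³ √(-h⁽⁰⁾)` to leading order, the boundary term tends to
a quarter of the density integral, while the bulk term vanishes.

For the total divergence, `k` is divergence free by assumption, and `DDσ + σ h⁽⁰⁾` is so by the
Bochner identity and the equation of motion. Hence `D_a J^a` is the contraction of `k - DDσ - σ
h⁽⁰⁾` with `DDσ`, which is the density. The divergence theorem on each patch produces the fluxes
through the cuts and the equator. The part of the current without `k` is minus half the gradient of
`σ_a σ^a + σ²`, a globally defined function, so its two equatorial fluxes cancel and only the flux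
of `k^{ab} σ_b` survives. -/

open Filter Topology Asymptotics MannMarolf
open scoped ContDiff

namespace MannMarolf

/-! ### First-order expansions in `1/r` along a filter. -/

section Jets

variable {α E E' : Type*} [NormedRing E] [NormedAlgebra ℝ E] [NormedRing E'] [NormedAlgebra ℝ E']
  {l : Filter α} {r : α → ℝ}

/-- `M = M₀ + M₁ / r + O(r⁻²)` along the filter `l`, with bounded `M₀` and `M₁`. -/
structure Jet (l : Filter α) (r : α → ℝ) (M M₀ M₁ : α → E) : Prop where
  zeroth : M₀ =O[l] (fun _ => (1 : ℝ))
  first : M₁ =O[l] (fun _ => (1 : ℝ))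
  error : (fun z => M z - M₀ z - (r z)⁻¹ • M₁ z) =O[l] (fun z => (r z)⁻¹ ^ 2)

theorem inv_isBigO_one (hr : Tendsto r l atTop) : (fun z => (r z)⁻¹) =O[l] (fun _ => (1 : ℝ)) :=
  (hr.inv_tendsto_atTop).isBigO_one ℝ

theorem inv_sq_isBigO_inv (hr : Tendsto r l atTop) :
    (fun z => (r z)⁻¹ ^ 2) =O[l] (fun z => (r z)⁻¹) := by
  simpa [pow_two] using (isBigO_refl (fun z => (r z)⁻¹) l).mul (inv_isBigO_one hr)

namespace Jet

variable {M M₀ M₁ M' M₀' M₁' : α → E}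

theorem const (hM : M₀ =O[l] (fun _ => (1 : ℝ))) : Jet l r M₀ M₀ 0 :=
  ⟨hM, isBigO_zero _ _, by simpa using isBigO_zero _ _⟩

theorem inv_smul (hM : M₁ =O[l] (fun _ => (1 : ℝ))) : Jet l r (fun z => (r z)⁻¹ • M₁ z) 0 M₁ :=
  ⟨isBigO_zero _ _, hM, by simpa using isBigO_zero _ _⟩

theorem congr (h : Jet l r M M₀ M₁) (e : M =ᶠ[l] M') (e₀ : M₀ =ᶠ[l] M₀') (e₁ : M₁ =ᶠ[l] M₁') :
    Jet l r M' M₀' M₁' := by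
  refine ⟨h.zeroth.congr' e₀ .rfl, h.first.congr' e₁ .rfl, h.error.congr' ?_ .rfl⟩
  filter_upwards [e, e₀, e₁] with z a b c
  rw [a, b, c]

theorem add (h : Jet l r M M₀ M₁) (h' : Jet l r M' M₀' M₁') :
    Jet l r (fun z => M z + M' z) (fun z => M₀ z + M₀' z) (fun z => M₁ z + M₁' z) :=
  ⟨h.zeroth.add h'.zeroth, h.first.add h'.first, (h.error.add h'.error).congr_left fun z => by
    rw [smul_add]; abel⟩

theorem map (L : E →L[ℝ] E') (h : Jet l r M M₀ M₁) :
    Jet l r (fun z => L (M z)) (fun z => L (M₀ z)) (fun z => L (M₁ z)) :=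
  ⟨(L.isBigO_comp _ _).trans h.zeroth, (L.isBigO_comp _ _).trans h.first,
    ((L.isBigO_comp _ _).trans h.error).congr_left fun z => by simp⟩

theorem const_smul (c : ℝ) (h : Jet l r M M₀ M₁) :
    Jet l r (fun z => c • M z) (fun z => c • M₀ z) (fun z => c • M₁ z) := by
  simpa using h.map (c • ContinuousLinearMap.id ℝ E)

theorem neg (h : Jet l r M M₀ M₁) :
    Jet l r (fun z => -M z) (fun z => -M₀ z) (fun z => -M₁ z) := by
  simpa using h.const_smul (-1)

theorem sub (h : Jet l r M M₀ M₁) (h' : Jet l r M' M₀' M₁') :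
    Jet l r (fun z => M z - M' z) (fun z => M₀ z - M₀' z) (fun z => M₁ z - M₁' z) := by
  simpa [sub_eq_add_neg] using h.add h'.neg

theorem sub_isBigO (h : Jet l r M M₀ M₁) (hr : Tendsto r l atTop) :
    (fun z => M z - M₀ z) =O[l] (fun z => (r z)⁻¹) := by
  have h1 : (fun z => (r z)⁻¹ • M₁ z) =O[l] (fun z => (r z)⁻¹) := by
    simpa using (isBigO_refl (fun z => (r z)⁻¹) l).smul h.first
  exact ((h.error.trans (inv_sq_isBigO_inv hr)).add h1).congr_left fun z => by abel

theorem isBigO_one (h : Jet l r M M₀ M₁) (hr : Tendsto r l atTop) :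
    M =O[l] (fun _ => (1 : ℝ)) :=
  (((h.sub_isBigO hr).trans (inv_isBigO_one hr)).add h.zeroth).congr_left fun z => by abel

theorem tendsto_sub (h : Jet l r M M₀ M₁) (hr : Tendsto r l atTop) :
    Tendsto (fun z => M z - M₀ z) l (𝓝 0) :=
  (h.sub_isBigO hr).trans_tendsto hr.inv_tendsto_atTop

theorem mul (h : Jet l r M M₀ M₁) (h' : Jet l r M' M₀' M₁') (hr : Tendsto r l atTop) :
    Jet l r (fun z => M z * M' z) (fun z => M₀ z * M₀' z)
      (fun z => M₀ z * M₁' z + M₁ z * M₀' z) := by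
  have hi := isBigO_refl (fun z => (r z)⁻¹) l
  refine ⟨by simpa using h.zeroth.mul h'.zeroth,
    by simpa using (h.zeroth.mul h'.first).add (h.first.mul h'.zeroth), ?_⟩
  -- The error of the product splits as (error of `M`)·`M'` + `M₀`·(error of `M'`) + `r⁻¹ M₁ (M' -
  -- M₀')`.
  have e1 := h.error.mul (h'.isBigO_one hr)
  have e2 := h.zeroth.mul h'.error
  have e3 : (fun z => (r z)⁻¹ • (M₁ z * (M' z - M₀' z))) =O[l]
      (fun z => (r z)⁻¹ * (1 * (r z)⁻¹)) := hi.smul (h.first.mul (h'.sub_isBigO hr))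
  simp only [mul_one, one_mul, ← pow_two] at e1 e2 e3
  refine ((e1.add e2).add e3).congr_left fun z => ?_
  simp only [sub_mul, mul_sub, smul_sub, smul_mul_assoc, mul_smul_comm, smul_add]
  abel

theorem smul {c c₀ c₁ : α → ℝ} (hc : Jet l r c c₀ c₁) (h : Jet l r M M₀ M₁)
    (hr : Tendsto r l atTop) :
    Jet l r (fun z => c z • M z) (fun z => c₀ z • M₀ z)
      (fun z => c₀ z • M₁ z + c₁ z • M₀ z) := by
  have := (hc.map (Algebra.linearMap ℝ E).toContinuousLinearMap).mul h hr
  simpa [Algebra.algebraMap_eq_smul_one] using this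

/-- The resolvent identity `B - B₀ = -B (A - A₀) B₀` first gives the size of `B - B₀` and, inserted
once more, the `1/r` term. Boundedness of `B` is not assumed and has to be derived. -/
theorem inv {A A₀ A₁ B B₀ : α → E} (h : Jet l r A A₀ A₁) (hr : Tendsto r l atTop)
    (hB₀ : B₀ =O[l] (fun _ => (1 : ℝ))) (h₀ : ∀ᶠ z in l, A₀ z * B₀ z = 1)
    (hBA : ∀ᶠ z in l, B z * A z = 1) :
    Jet l r B B₀ (fun z => -(B₀ z * A₁ z * B₀ z)) := by
  -- In `B = B (A₀ - A) B₀ + B₀` the factor `(A₀ - A) B₀` eventually has norm below `1/2`, so the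
  -- first term is absorbed on the left.
  have hB : B =O[l] (fun _ => (1 : ℝ)) := by
    have t : Tendsto (fun z => (A₀ z - A z) * B₀ z) l (𝓝 0) := by
      have := ((h.sub_isBigO hr).mul hB₀).trans_tendsto
        ((hr.inv_tendsto_atTop).congr fun z => by simp)
      simpa [sub_mul] using this.neg
    have t' := (tendsto_zero_iff_norm_tendsto_zero.1 t).eventually
      (gt_mem_nhds (show (0 : ℝ) < 1 / 2 by norm_num))
    refine IsBigO.trans (IsBigO.of_bound 2 ?_) hB₀
    filter_upwards [t', h₀, hBA] with z hz h0 h1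
    have : B z = B z * ((A₀ z - A z) * B₀ z) + B₀ z := by
      rw [sub_mul, mul_sub, h0, ← mul_assoc, h1]; simp
    have h2 : ‖B z‖ ≤ ‖B z‖ * ‖(A₀ z - A z) * B₀ z‖ + ‖B₀ z‖ := by
      conv_lhs => rw [this]
      exact (norm_add_le _ _).trans (by gcongr; exact norm_mul_le _ _)
    nlinarith [norm_nonneg (B z)]
  have d : (fun z => B z - B₀ z) =O[l] (fun z => (r z)⁻¹) := by
    have := (hB.mul (h.sub_isBigO hr).neg_left).mul hB₀
    simp only [one_mul, mul_one] at this
    refine this.congr' ?_ .rfl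
    filter_upwards [h₀, hBA] with z h0 h1
    rw [neg_sub, mul_sub, sub_mul, h1, mul_assoc, h0]; simp
  refine ⟨hB₀, ?_, ?_⟩
  · simpa using ((hB₀.mul h.first).mul hB₀).neg_left
  -- The error equals `-B (A - A₀ - r⁻¹ A₁) B₀ - r⁻¹ (B - B₀) A₁ B₀`.
  · have e1 := (hB.mul h.error.neg_left).mul hB₀
    have e2 := (isBigO_refl (fun z => (r z)⁻¹) l).smul ((d.neg_left.mul h.first).mul hB₀)
    simp only [one_mul, mul_one, smul_eq_mul, ← pow_two] at e1 e2
    refine (e1.add e2).congr' ?_ .rfl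
    filter_upwards [h₀, hBA] with z h0 h1
    have h2 : B z * A₀ z * B₀ z = B z := by rw [mul_assoc, h0, mul_one]
    simp only [neg_sub, mul_sub, sub_mul, smul_mul_assoc, mul_smul_comm, h2, h1, smul_sub, one_mul,
      smul_neg, sub_neg_eq_add]
    abel

/-- Multiplying by `r` shows that a constant is `O(1/r)`. This uniqueness of the `1/r` coefficient
is what extracts the equation of motion of `σ` from two expansions of the same quantity. -/
theorem eq_zero_of_isBigO_sq [l.NeBot] {m₁ : E} (h : Jet l r M 0 (fun _ => m₁))
    (hr : Tendsto r l atTop) (hM : M =O[l] (fun z => (r z)⁻¹ ^ 2)) : m₁ = 0 := by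
  have e := hM.sub h.error
  simp only [Pi.zero_apply, sub_zero, sub_sub_cancel] at e
  have e' := (isBigO_refl r l).smul e
  have : (fun _ : α => m₁) =O[l] (fun z => (r z)⁻¹) := by
    refine e'.congr' ?_ ?_
    · filter_upwards [hr.eventually_ne_atTop 0] with z hz
      rw [smul_smul, mul_inv_cancel₀ hz, one_smul]
    · filter_upwards [hr.eventually_ne_atTop 0] with z hz
      simp only [smul_eq_mul]; field_simp
  exact tendsto_nhds_unique tendsto_const_nhds (this.trans_tendsto hr.inv_tendsto_atTop)

end Jet

end Jets

/-! ### The quadratic map `(tr M) M - M²` near the identity. -/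

section MatrixNorm

open scoped Matrix.Norms.Operator

/-- The real three-by-three matrices. -/
abbrev Mat := Matrix (Fin 3) (Fin 3) ℝ

noncomputable section

/-- The trace as a continuous linear map. -/
def traceCLM : Mat →L[ℝ] ℝ := (Matrix.traceLinearMap (Fin 3) ℝ ℝ).toContinuousLinearMap

@[simp] theorem traceCLM_apply (M : Mat) : traceCLM M = M.trace := rfl

/-- An entry as a continuous linear map. -/
def entryCLM (a b : Fin 3) : Mat →L[ℝ] ℝ := (Matrix.entryLinearMap ℝ ℝ a b).toContinuousLinearMap

@[simp] theorem entryCLM_apply (a b : Fin 3) (M : Mat) : entryCLM a b M = M a b := rfl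

/-- The transpose as a continuous linear map. -/
def transposeCLM : Mat →L[ℝ] Mat :=
  (Matrix.transposeLinearEquiv (Fin 3) (Fin 3) ℝ ℝ).toLinearMap.toContinuousLinearMap

@[simp] theorem transposeCLM_apply (M : Mat) : transposeCLM M = M.transpose := rfl

theorem isBigO_of_entries {α : Type*} {l : Filter α} {M : α → Mat} {g : α → ℝ}
    (h : ∀ a b, (fun z => M z a b) =O[l] g) : M =O[l] g := by
  have e : M = fun z => ∑ a, ∑ b, M z a b • Matrix.single a b (1 : ℝ) := by
    funext z
    conv_lhs => rw [Matrix.matrix_eq_sum_single (M z)]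
    simp
  have key : ∀ a b, (fun z => M z a b • (Matrix.single a b (1 : ℝ) : Mat)) =O[l] g := fun a b => by
    simpa using (h a b).smul (isBigO_const_const
      (Matrix.single a b (1 : ℝ) : Mat) (one_ne_zero : (1 : ℝ) ≠ 0) l)
  have key' : ∀ a, (fun z => ∑ b, M z a b • (Matrix.single a b (1 : ℝ) : Mat)) =O[l] g :=
    fun a => IsBigO.fun_sum fun b _ => key a b
  rw [e]
  exact IsBigO.fun_sum fun a _ => key' a

theorem tendsto_of_entries {α : Type*} {l : Filter α} {M : α → Mat} {m : Mat}
    (h : ∀ a b, Tendsto (fun z => M z a b) l (𝓝 (m a b))) : Tendsto M l (𝓝 m) :=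
  tendsto_pi_nhds.2 fun a => tendsto_pi_nhds.2 fun b => h a b

/-- The quadratic map `M ↦ (tr M) M - M²`. -/
def quad (M : Mat) : Mat := M.trace • M - M * M

theorem quad_one : quad 1 = (2 : ℝ) • 1 := by
  simp only [quad, Matrix.trace_one, Fintype.card_fin, mul_one]
  rw [show ((3 : ℕ) : ℝ) = 2 + 1 by norm_num, add_smul, one_smul, add_sub_cancel_right]

/-- The derivative `X ↦ X + (tr X) 1` of `quad` at the identity. -/
def quadDeriv : Mat ≃L[ℝ] Mat :=
  LinearEquiv.toContinuousLinearEquiv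
    { toFun := fun X => X + X.trace • (1 : Mat)
      map_add' := fun X Y => by simp only [Matrix.trace_add, add_smul]; abel
      map_smul' := fun c X => by simp [smul_smul]
      -- Since `tr 1 = 3`, the trace of `X + (tr X) 1` is `4 tr X`.
      invFun := fun X => X - (X.trace / 4) • (1 : Mat)
      left_inv := fun X => by
        simp only [Matrix.trace_add, Matrix.trace_smul, Matrix.trace_one, Fintype.card_fin,
          smul_eq_mul]
        rw [add_sub_assoc, ← sub_smul]; ring_nf; simp
      right_inv := fun X => by
        simp only [Matrix.trace_sub, Matrix.trace_smul, Matrix.trace_one, Fintype.card_fin,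
          smul_eq_mul]
        rw [sub_add, ← sub_smul]; ring_nf; simp }

theorem quad_hasStrictFDerivAt : HasStrictFDerivAt quad (quadDeriv : Mat →L[ℝ] Mat) 1 := by
  have h1 : HasStrictFDerivAt (fun M : Mat => M) (ContinuousLinearMap.id ℝ Mat) 1 :=
    hasStrictFDerivAt_id _
  have h2 := ((traceCLM.hasStrictFDerivAt (x := (1 : Mat))).smul h1).sub (h1.mul' h1)
  refine h2.congr_fderiv ?_
  ext1 X
  simp only [quadDeriv]
  change (traceCLM 1 • X + traceCLM X • (1 : Mat)) - (1 * X + X * 1) = X + X.trace • (1 : Mat)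
  simp only [traceCLM_apply, Matrix.trace_one, Fintype.card_fin, one_mul, mul_one]
  rw [show ((3 : ℕ) : ℝ) = 1 + 1 + 1 by norm_num, add_smul, add_smul, one_smul]
  abel

/-- The inverse function theorem at `1`. Being a right inverse on `V` gives existence of `K̂`, being
a left inverse on `U` gives local uniqueness, and continuity on the open set `V` later makes the
integrand continuous. -/
theorem exists_quad_localInverse : ∃ g : Mat → Mat, ∃ U ∈ 𝓝 (1 : Mat), ∃ V : Set Mat,
    IsOpen V ∧ (2 : ℝ) • (1 : Mat) ∈ V ∧ ContinuousOn g V ∧ (∀ S ∈ V, quad (g S) = S) ∧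
      (∀ M ∈ U, g (quad M) = M) ∧ Tendsto g (𝓝 ((2 : ℝ) • 1)) (𝓝 1) := by
  let e := quad_hasStrictFDerivAt.toOpenPartialHomeomorph quad
  have h1 : (1 : Mat) ∈ e.source := quad_hasStrictFDerivAt.mem_toOpenPartialHomeomorph_source
  have he : (e : Mat → Mat) = quad := quad_hasStrictFDerivAt.toOpenPartialHomeomorph_coe
  have h2 : (2 : ℝ) • (1 : Mat) ∈ e.target := by
    rw [← quad_one, ← he]; exact e.map_source h1
  refine ⟨e.symm, e.source, e.open_source.mem_nhds h1, e.target, e.open_target, h2,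
    e.continuousOn_symm, fun S hS => ?_, fun M hM => ?_, ?_⟩
  · rw [← he]; exact e.right_inv hS
  · rw [← he]; exact e.left_inv hM
  · have := e.tendsto_symm h1
    rwa [he, quad_one] at this

end

end MatrixNorm

end MannMarolf

namespace MannMarolf

/-! ### Expansion of a solution of `quad M = S`, and comparison of traces. -/

section QuadAsymptotics

open scoped Matrix.Norms.Operator

variable {α : Type*} {l : Filter α} {r : α → ℝ}

theorem quad_one_add (X : Mat) : quad (1 + X) = (2 : ℝ) • 1 + quadDeriv X + quad X := by
  change (1 + X).trace • (1 + X) - (1 + X) * (1 + X) =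
    (2 : ℝ) • 1 + (X + X.trace • (1 : Mat)) + (X.trace • X - X * X)
  rw [Matrix.trace_add, Matrix.trace_one, Fintype.card_fin,
    show ((3 : ℕ) : ℝ) = 2 + 1 by norm_num]
  simp only [add_smul, smul_add, one_smul, add_mul, mul_add, one_mul, mul_one]
  rw [show (2 : ℝ) • X = X + X by rw [two_smul]]
  abel

theorem quadDeriv_symm_of_trace_eq_zero {A : Mat} (hA : A.trace = 0) : quadDeriv.symm A = A := by
  rw [ContinuousLinearEquiv.symm_apply_eq]
  change A = A + A.trace • (1 : Mat)
  simp [hA]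

theorem trace_isBigO {X : α → Mat} {g : α → ℝ} (h : X =O[l] g) :
    (fun z => (X z).trace) =O[l] g :=
  (traceCLM.isBigO_comp X l).trans h

theorem quad_isBigO_sq (X : α → Mat) : (fun z => quad (X z)) =O[l] (fun z => ‖X z‖ ^ 2) := by
  have h : X =O[l] (fun z => ‖X z‖) := (isBigO_refl X l).norm_right
  exact (((trace_isBigO h).smul h).sub (h.mul h)).congr_right fun z => (pow_two _).symm

/-- With `X = M - 1`, `D = quadDeriv` and `W = D⁻¹ (S - 2)`, the exact expansion of `quad` at `1`
gives `X - W = -D⁻¹ (quad X) = O(‖X‖²)`. Hence `X` is of the order of `W`, which is `O(1/r)`, and `X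
= W + O(r⁻²)`. The map `D⁻¹` fixes the traceless `S₁`, so the first-order term passes unchanged from
`S` to `M`. -/
theorem Jet.of_quad {M S S₁ : α → Mat} (hr : Tendsto r l atTop) (hM : Tendsto M l (𝓝 1))
    (hS : Jet l r S (fun _ => (2 : ℝ) • 1) S₁) (ht : ∀ᶠ z in l, (S₁ z).trace = 0)
    (hq : ∀ᶠ z in l, quad (M z) = S z) : Jet l r M (fun _ => 1) S₁ := by
  set X : α → Mat := fun z => M z - 1 with hX
  set W : α → Mat := fun z => quadDeriv.symm (S z - (2 : ℝ) • 1) with hW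
  have X0 : Tendsto X l (𝓝 0) := by simpa using hM.sub_const 1
  have e : (fun z => X z - W z) =ᶠ[l] fun z => -quadDeriv.symm (quad (X z)) := by
    filter_upwards [hq] with z hz
    have := quad_one_add (X z)
    rw [hX, add_sub_cancel, hz, ← hX] at this
    have h2 : W z = X z + quadDeriv.symm (quad (X z)) := by
      rw [hW]; simp only
      rw [this, add_assoc, add_sub_cancel_left, map_add, ContinuousLinearEquiv.symm_apply_apply]
    rw [h2]; abel
  have qX : (fun z => -quadDeriv.symm (quad (X z))) =O[l] fun z => ‖X z‖ ^ 2 :=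
    (((quadDeriv.symm : Mat →L[ℝ] Mat).isBigO_comp _ _).trans (quad_isBigO_sq X)).neg_left
  have d : (fun z => X z - W z) =O[l] fun z => ‖X z‖ ^ 2 := qX.congr' e.symm .rfl
  -- As `X → 0`, the quadratic term is negligible against `X` itself, so `X` and `W` are comparable.
  have sq : (fun z => ‖X z‖ ^ 2) =o[l] X := by
    have h1 : (fun z => ‖X z‖) =o[l] (fun _ => (1 : ℝ)) := by
      rw [isLittleO_one_iff]; simpa using X0.norm
    have := (h1.mul_isBigO (isBigO_refl (fun z => ‖X z‖) l))
    simp only [← pow_two, one_mul] at this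
    exact this.trans_isBigO (isBigO_refl X l).norm_left
  have XW : X =O[l] W := by
    have := (d.trans_isLittleO sq).right_isBigO_sub
    exact this.congr_right fun z => by abel
  have Wr : W =O[l] fun z => (r z)⁻¹ :=
    ((quadDeriv.symm : Mat →L[ℝ] Mat).isBigO_comp _ _).trans (hS.sub_isBigO hr)
  have d2 : (fun z => X z - W z) =O[l] fun z => (r z)⁻¹ ^ 2 :=
    d.trans (((XW.trans Wr).norm_left).pow 2)
  refine ⟨isBigO_const_const _ one_ne_zero _, hS.first, ?_⟩
  have e2 := ((quadDeriv.symm : Mat →L[ℝ] Mat).isBigO_comp _ _).trans hS.error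
  refine (d2.add e2).congr' ?_ .rfl
  filter_upwards [ht] with z hz
  have h3 : quadDeriv.symm (S z - (2 : ℝ) • 1 - (r z)⁻¹ • S₁ z) = W z - (r z)⁻¹ • S₁ z := by
    rw [map_sub, map_smul, quadDeriv_symm_of_trace_eq_zero hz]
  change X z - W z + quadDeriv.symm (S z - (2 : ℝ) • 1 - (r z)⁻¹ • S₁ z) = _
  rw [h3, sub_add_sub_cancel]

theorem Jet.sq_error {M A : α → Mat} (hr : Tendsto r l atTop) (h : Jet l r M (fun _ => 1) A) :
    (fun z => ((M z - 1) * (M z - 1)).trace - (r z)⁻¹ ^ 2 * (A z * A z).trace) =O[l]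
      fun z => (r z)⁻¹ ^ 3 := by
  have h1 := h.sub_isBigO hr
  have h2 : (fun z => (r z)⁻¹ • A z) =O[l] fun z => (r z)⁻¹ := by
    simpa using (isBigO_refl (fun z => (r z)⁻¹) l).smul h.first
  have h3 := (h.error.mul h1).congr_right (g₂ := fun z => (r z)⁻¹ ^ 3) fun z => by ring
  have h4 := (h2.mul h.error).congr_right (g₂ := fun z => (r z)⁻¹ ^ 3) fun z => by ring
  have := trace_isBigO (h3.add h4)
  refine this.congr_left fun z => ?_
  rw [← smul_eq_mul ((r z)⁻¹ ^ 2), ← Matrix.trace_smul, ← Matrix.trace_sub]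
  congr 1
  simp only [sub_mul, mul_sub, smul_mul_assoc, mul_smul_comm, smul_smul, pow_two]
  abel

theorem Jet.trace_sub_isBigO {M A : α → Mat} (h : Jet l r M (fun _ => 1) A)
    (hA : ∀ᶠ z in l, (A z).trace = 0) :
    (fun z => (M z).trace - 3) =O[l] fun z => (r z)⁻¹ ^ 2 := by
  refine (trace_isBigO h.error).congr' ?_ .rfl
  filter_upwards [hA] with z hz
  simp [Matrix.trace_sub, Matrix.trace_smul, hz]

/-- Both matrices satisfy `(tr N)² - tr N² = 6 + 4 (tr N - 3) + (tr N - 3)² - tr (N - 1)²` with the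
same left side. Tracelessness of the first-order terms makes `tr N - 3 = O(r⁻²)`, so its square is
negligible, and `tr (N - 1)²` is known to order `r⁻²` from the first-order term. No second-order
coefficient is needed. -/
theorem trace_sub_trace_isBigO {M L A B : α → Mat} (hr : Tendsto r l atTop)
    (hL : Jet l r L (fun _ => 1) A) (hM : Jet l r M (fun _ => 1) B)
    (hA : ∀ᶠ z in l, (A z).trace = 0) (hB : ∀ᶠ z in l, (B z).trace = 0)
    (e : ∀ᶠ z in l, (M z).trace ^ 2 - (M z * M z).trace = (L z).trace ^ 2 - (L z * L z).trace) :
    (fun z => (L z).trace - (M z).trace -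
      1 / 4 * (r z)⁻¹ ^ 2 * ((A z * A z).trace - (B z * B z).trace)) =O[l]
      fun z => (r z)⁻¹ ^ 3 := by
  have tL := hL.trace_sub_isBigO hA
  have tM := hM.trace_sub_isBigO hB
  have o : (fun z => (r z)⁻¹ ^ 2 * (r z)⁻¹ ^ 2) =O[l] fun z => (r z)⁻¹ ^ 3 := by
    have := (isBigO_refl (fun z => (r z)⁻¹ ^ 3) l).mul (inv_isBigO_one hr)
    exact (this.congr_left fun z => by ring).congr_right fun z => by ring
  have q := ((((hL.sq_error hr).sub (hM.sq_error hr)).sub ((tL.mul tL).trans o)).add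
    ((tM.mul tM).trans o)).const_mul_left (1 / 4)
  refine q.congr' ?_ .rfl
  filter_upwards [e] with z hz
  have sq : ∀ N : Mat, ((N - 1) * (N - 1)).trace = (N * N).trace - 2 * N.trace + 3 := fun N => by
    simp only [sub_mul, mul_sub, Matrix.trace_sub, one_mul, mul_one, Matrix.trace_one,
      Fintype.card_fin]
    push_cast; ring
  rw [sq, sq]
  linear_combination (1 / 4) * hz

end QuadAsymptotics

end MannMarolf

namespace MannMarolf

/-! ### Calculus of partial derivatives. -/

section PartialDerivatives

variable {n : ℕ} {f g : (Fin n → ℝ) → ℝ} {x : Fin n → ℝ} {i j : Fin n}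

theorem pd_congr (h : f =ᶠ[𝓝 x] g) : pd i f x = pd i g x := by
  simp only [pd, h.fderiv_eq]

@[simp] theorem pd_const (c : ℝ) : pd i (fun _ => c) x = 0 := by simp [pd]

theorem pd_add (hf : DifferentiableAt ℝ f x) (hg : DifferentiableAt ℝ g x) :
    pd i (fun y => f y + g y) x = pd i f x + pd i g x := by
  simp only [pd, fderiv_fun_add hf hg, _root_.add_apply]

theorem pd_sub (hf : DifferentiableAt ℝ f x) (hg : DifferentiableAt ℝ g x) :
    pd i (fun y => f y - g y) x = pd i f x - pd i g x := by
  simp only [pd, fderiv_fun_sub hf hg, _root_.sub_apply]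

theorem pd_neg : pd i (fun y => -f y) x = -pd i f x := by
  simp only [pd, fderiv_fun_neg, _root_.neg_apply]

theorem pd_mul (hf : DifferentiableAt ℝ f x) (hg : DifferentiableAt ℝ g x) :
    pd i (fun y => f y * g y) x = pd i f x * g x + f x * pd i g x := by
  simp only [pd, fderiv_fun_mul hf hg, _root_.add_apply,
    _root_.smul_apply, smul_eq_mul]
  ring

theorem pd_const_mul (c : ℝ) (hf : DifferentiableAt ℝ f x) :
    pd i (fun y => c * f y) x = c * pd i f x := by
  rw [pd_mul (differentiableAt_const c) hf]; simp

theorem pd_sum {ι : Type*} {s : Finset ι} {F : ι → (Fin n → ℝ) → ℝ}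
    (h : ∀ k ∈ s, DifferentiableAt ℝ (F k) x) :
    pd i (fun y => ∑ k ∈ s, F k y) x = ∑ k ∈ s, pd i (F k) x := by
  simp only [pd, fderiv_fun_sum h, _root_.sum_apply]

theorem pd_comp_real {φ : ℝ → ℝ} {φ' : ℝ} (hφ : HasDerivAt φ φ' (f x))
    (hf : DifferentiableAt ℝ f x) : pd i (fun y => φ (f y)) x = φ' * pd i f x := by
  have := hφ.comp_hasFDerivAt x hf.hasFDerivAt
  rw [pd, show (fun y => φ (f y)) = φ ∘ f from rfl, this.fderiv]
  simp [pd]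

theorem pd_inv (hf : DifferentiableAt ℝ f x) (h0 : f x ≠ 0) :
    pd i (fun y => (f y)⁻¹) x = -pd i f x / f x ^ 2 := by
  rw [pd_comp_real (hasDerivAt_inv h0) hf]
  ring

theorem pd_div (hf : DifferentiableAt ℝ f x) (hg : DifferentiableAt ℝ g x) (h0 : g x ≠ 0) :
    pd i (fun y => f y / g y) x = pd i f x / g x - f x * pd i g x / g x ^ 2 := by
  simp only [div_eq_mul_inv]
  rw [pd_mul hf (hg.fun_inv h0)]
  have := pd_inv (i := i) hg h0
  simp only [div_eq_mul_inv] at this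
  rw [this]; ring

theorem pd_pow (hf : DifferentiableAt ℝ f x) (m : ℕ) :
    pd i (fun y => f y ^ m) x = m * f x ^ (m - 1) * pd i f x := by
  simp only [pd, fderiv_fun_pow m hf, _root_.smul_apply, smul_eq_mul, nsmul_eq_mul]

@[simp] theorem pd_coord : pd i (fun y => y j) x = if i = j then 1 else 0 := by
  have : (fun y : Fin n → ℝ => y j) = (ContinuousLinearMap.proj (R := ℝ) (φ := fun _ => ℝ) j) := rfl
  rw [pd, this, ContinuousLinearMap.fderiv]
  simp [Pi.single_apply, eq_comm]

theorem _root_.ContDiffAt.pd {m k : WithTop ℕ∞} (h : ContDiffAt ℝ m f x) (hk : k + 1 ≤ m) :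
    ContDiffAt ℝ k (pd i f) x :=
  (h.fderiv_right hk).clm_apply contDiffAt_const

theorem pd_comm (h : ContDiffAt ℝ 2 f x) : pd i (pd j f) x = pd j (pd i f) x := by
  have h1 : DifferentiableAt ℝ (fderiv ℝ f) x :=
    (h.fderiv_right (m := 1) (by norm_num)).differentiableAt (by norm_num)
  have key : ∀ v w : Fin n → ℝ, fderiv ℝ (fun y => fderiv ℝ f y v) x w =
      fderiv ℝ (fderiv ℝ f) x w v := fun v w => by
    rw [fderiv_clm_apply h1 (differentiableAt_const v)]
    simp
  have hs : IsSymmSndFDerivAt ℝ f x := h.isSymmSndFDerivAt (by simp)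
  change fderiv ℝ (fun y => fderiv ℝ f y (Pi.single j 1)) x (Pi.single i 1) =
    fderiv ℝ (fun y => fderiv ℝ f y (Pi.single i 1)) x (Pi.single j 1)
  rw [key, key]
  exact hs _ _

end PartialDerivatives

/-! ### Tangential and radial slices of functions of `(ρ, u)`. -/

section Slices

variable {F : (Fin 4 → ℝ) → ℝ} {f : (Fin 3 → ℝ) → ℝ} {x : Fin 4 → ℝ}

theorem contDiff_tail {k : WithTop ℕ∞} :
    ContDiff ℝ k (fun x : Fin 4 → ℝ => (Fin.tail x : Fin 3 → ℝ)) :=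
  contDiff_pi.2 fun i => contDiff_apply ℝ ℝ i.succ

theorem hasFDerivAt_cons (ρ : ℝ) (u : Fin 3 → ℝ) :
    HasFDerivAt (fun v : Fin 3 → ℝ => (Fin.cons ρ v : Fin 4 → ℝ))
      (ContinuousLinearMap.pi (Fin.cases (motive := fun _ => (Fin 3 → ℝ) →L[ℝ] ℝ) 0
        fun a => ContinuousLinearMap.proj a)) u := by
  rw [hasFDerivAt_pi']
  intro i
  refine Fin.cases ?_ (fun a => ?_) i
  · simpa using hasFDerivAt_const ρ u
  · exact (ContinuousLinearMap.proj (R := ℝ) (φ := fun _ : Fin 3 => ℝ) a).hasFDerivAt (x := u)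

theorem pd_succ (hF : DifferentiableAt ℝ F x) (c : Fin 3) :
    pd c.succ F x = pd c (fun u => F (Fin.cons (x 0) u)) (Fin.tail x) := by
  have hx : (Fin.cons (x 0) (Fin.tail x) : Fin 4 → ℝ) = x := Fin.cons_self_tail x
  have h1 := HasFDerivAt.comp (g := F) (f := fun v : Fin 3 → ℝ => (Fin.cons (x 0) v : Fin 4 → ℝ))
    (Fin.tail x) (by rw [hx]; exact hF.hasFDerivAt) (hasFDerivAt_cons (x 0) (Fin.tail x))
  have h2 := h1.fderiv
  simp only [pd]
  rw [show (fun u => F (Fin.cons (x 0) u)) =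
    F ∘ fun v : Fin 3 → ℝ => (Fin.cons (x 0) v : Fin 4 → ℝ) from rfl, h2,
    ContinuousLinearMap.comp_apply]
  congr 1
  funext i
  refine Fin.cases ?_ (fun a => ?_) i
  · simp
  · simp [Pi.single_apply]

theorem hasDerivAt_cons (ρ : ℝ) (u : Fin 3 → ℝ) :
    HasDerivAt (fun r : ℝ => (Fin.cons r u : Fin 4 → ℝ)) (Pi.single 0 1) ρ := by
  rw [hasDerivAt_pi]
  intro i
  refine Fin.cases ?_ (fun a => ?_) i
  · simpa using hasDerivAt_id' ρ
  · simpa using hasDerivAt_const ρ (u a)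

theorem hasDerivAt_radial {ρ : ℝ} {u : Fin 3 → ℝ}
    (hF : DifferentiableAt ℝ F (Fin.cons ρ u)) :
    HasDerivAt (fun r => F (Fin.cons r u)) (pd 0 F (Fin.cons ρ u)) ρ :=
  hF.hasFDerivAt.comp_hasDerivAt ρ (hasDerivAt_cons ρ u)

theorem pd_succ_tail (hf : DifferentiableAt ℝ f (Fin.tail x)) (c : Fin 3) :
    pd c.succ (fun y => f (Fin.tail y)) x = pd c f (Fin.tail x) := by
  rw [pd_succ (F := fun y => f (Fin.tail y)) (DifferentiableAt.comp (g := f) x hf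
    ((contDiff_tail (k := 1)).differentiable (by norm_num)).differentiableAt)]
  simp

theorem pd_zero_tail (hf : DifferentiableAt ℝ f (Fin.tail x)) :
    pd 0 (fun y => f (Fin.tail y)) x = 0 := by
  have h : DifferentiableAt ℝ (fun y : Fin 4 → ℝ => f (Fin.tail y)) (Fin.cons (x 0) (Fin.tail x)) :=
    DifferentiableAt.comp (g := f) _ (by simpa using hf)
      ((contDiff_tail (k := 1)).differentiable (by norm_num)).differentiableAt
  have h1 := hasDerivAt_radial h
  simp only [Fin.tail_cons, Fin.cons_self_tail] at h1
  exact h1.unique (hasDerivAt_const _ _)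

end Slices

end MannMarolf

namespace MannMarolf

/-! ### Determinants and inverses of matrix-valued functions. -/

section MatrixFunctions

variable {n : ℕ} {ι : Type*} [Fintype ι] [DecidableEq ι]
  {A : (Fin n → ℝ) → Matrix ι ι ℝ} {x : Fin n → ℝ} {m : WithTop ℕ∞}

theorem contDiffAt_det (h : ∀ a b, ContDiffAt ℝ m (fun y => A y a b) x) :
    ContDiffAt ℝ m (fun y => (A y).det) x := by
  simp only [Matrix.det_apply]
  exact ContDiffAt.sum fun σ _ => ContDiffAt.const_smul _ (contDiffAt_prod fun i _ => h _ _)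

/-- Cramer's rule writes an entry of the inverse as a quotient of determinants. -/
theorem contDiffAt_inv_entry (h : ∀ a b, ContDiffAt ℝ m (fun y => A y a b) x)
    (h0 : (A x).det ≠ 0) (a b : ι) : ContDiffAt ℝ m (fun y => (A y)⁻¹ a b) x := by
  have e : (fun y => (A y)⁻¹ a b) =
      fun y => ((A y).det)⁻¹ * ((A y).updateRow b (Pi.single a 1)).det := by
    funext y
    rw [Matrix.inv_def, Matrix.smul_apply, Matrix.adjugate_apply, smul_eq_mul,
      Ring.inverse_eq_inv']
  rw [e]
  refine ((contDiffAt_det h).inv h0).mul (contDiffAt_det fun c d => ?_)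
  by_cases hc : c = b
  · subst hc; simpa using contDiffAt_const
  · simpa [Matrix.updateRow_ne hc] using h c d

/-- Differentiate `A⁻¹ A = 1`, valid near `x` since invertibility is open, and multiply by `A⁻¹`
from the right. -/
theorem pd_inv_entry (h : ∀ a b, ContDiffAt ℝ 1 (fun y => A y a b) x)
    (h0 : (A x).det ≠ 0) (i : Fin n) (a b : ι) :
    pd i (fun y => (A y)⁻¹ a b) x =
      -∑ c, ∑ d, (A x)⁻¹ a c * pd i (fun y => A y c d) x * (A x)⁻¹ d b := by
  have hd : ∀ a b, DifferentiableAt ℝ (fun y => A y a b) x := fun a b =>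
    (h a b).differentiableAt (by norm_num)
  have hi : ∀ a b, DifferentiableAt ℝ (fun y => (A y)⁻¹ a b) x := fun a b =>
    (contDiffAt_inv_entry h h0 a b).differentiableAt (by norm_num)
  have hev : ∀ᶠ y in 𝓝 x, (A y).det ≠ 0 := (contDiffAt_det h).continuousAt.eventually_ne h0
  have key : ∀ d, ∑ c, (pd i (fun y => (A y)⁻¹ a c) x * A x c d +
      (A x)⁻¹ a c * pd i (fun y => A y c d) x) = 0 := fun d => by
    have e : (fun y => ∑ c, (A y)⁻¹ a c * A y c d) =ᶠ[𝓝 x] fun _ => (1 : Matrix ι ι ℝ) a d := by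
      filter_upwards [hev] with y hy
      rw [← Matrix.mul_apply, Matrix.nonsing_inv_mul _ (isUnit_iff_ne_zero.2 hy)]
    have := pd_congr (i := i) e
    rw [pd_const, pd_sum fun c _ => (hi a c).fun_mul (hd c d)] at this
    rw [← this]
    exact Finset.sum_congr rfl fun c _ => (pd_mul (hi a c) (hd c d)).symm
  have hu : A x * (A x)⁻¹ = 1 := Matrix.mul_nonsing_inv _ (isUnit_iff_ne_zero.2 h0)
  have e1 : ∀ c, ∑ d, A x c d * (A x)⁻¹ d b = (1 : Matrix ι ι ℝ) c b := fun c => by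
    rw [← Matrix.mul_apply, hu]
  have e2 : ∑ d, (∑ c, (pd i (fun y => (A y)⁻¹ a c) x * A x c d +
      (A x)⁻¹ a c * pd i (fun y => A y c d) x)) * (A x)⁻¹ d b = 0 := by simp [key]
  simp only [Finset.sum_add_distrib, add_mul, Finset.sum_mul] at e2
  have e3 : ∑ d, ∑ c, pd i (fun y => (A y)⁻¹ a c) x * A x c d * (A x)⁻¹ d b =
      pd i (fun y => (A y)⁻¹ a b) x := by
    rw [Finset.sum_comm]
    simp only [mul_assoc, ← Finset.mul_sum, e1, Matrix.one_apply]
    simp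
  rw [e3, Finset.sum_comm] at e2
  linarith

end MatrixFunctions

noncomputable section

/-! ### Christoffel symbols of the four-metric in terms of lapse, `h` and `∂_ρ h`. -/

section ADM

variable (σ : (Fin 3 → ℝ) → ℝ) (h : ℝ → Tensor2 3)

/-- The lapse `1 + σ/ρ`. -/
def lapse (x : Fin 4 → ℝ) : ℝ := 1 + σ (Fin.tail x) / x 0

/-- `∂_ρ h_{ab}`. -/
def radial (x : Fin 4 → ℝ) : Mat :=
  Matrix.of fun a b => pd 0 (fun y => h (y 0) (Fin.tail y) a b) x

/-- `∂_ρ² h_{ab}`. -/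
def radial₂ (x : Fin 4 → ℝ) : Mat :=
  Matrix.of fun a b => pd 0 (pd 0 (fun y => h (y 0) (Fin.tail y) a b)) x

/-- `½ h^{ac} ∂_ρ h_{cb}`. -/
def weingarten (x : Fin 4 → ℝ) : Mat :=
  (1 / 2 : ℝ) • ((h (x 0) (Fin.tail x))⁻¹ * radial h x)

/-- The regularity of the data of a four-metric at a point. -/
structure Regular (x : Fin 4 → ℝ) : Prop where
  radius : x 0 ≠ 0
  lapse_ne : lapse σ x ≠ 0
  det_ne : (h (x 0) (Fin.tail x)).det ≠ 0
  smooth_σ : ContDiffAt ℝ 2 σ (Fin.tail x)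
  smooth : ∀ a b, ContDiffAt ℝ 2 (fun y : Fin 4 → ℝ => h (y 0) (Fin.tail y) a b) x

variable {σ h} {x : Fin 4 → ℝ}

namespace Regular

theorem smooth_lapse (H : Regular σ h x) : ContDiffAt ℝ 2 (lapse σ) x :=
  contDiffAt_const.add ((ContDiffAt.comp (g := σ) x H.smooth_σ contDiff_tail.contDiffAt).div
    (contDiff_apply ℝ ℝ 0).contDiffAt H.radius)

/-- The formulas for the Christoffel symbols hold at regular points. Openness of regularity turns
them into identities near `x`, which may then be differentiated. -/
theorem eventually (H : Regular σ h x) : ∀ᶠ y in 𝓝 x, Regular σ h y := by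
  have h1 : ∀ᶠ y : Fin 4 → ℝ in 𝓝 x, y 0 ≠ 0 := (continuous_apply 0).continuousAt.eventually_ne
    H.radius
  have h2 := H.smooth_lapse.continuousAt.eventually_ne H.lapse_ne
  have h3 := (contDiffAt_det H.smooth).continuousAt.eventually_ne H.det_ne
  have h4 : ∀ᶠ y : Fin 4 → ℝ in 𝓝 x, ContDiffAt ℝ 2 σ (Fin.tail y) :=
    ((contDiff_tail (k := 1)).continuous.tendsto x).eventually (H.smooth_σ.eventually (by simp))
  have h5 : ∀ᶠ y : Fin 4 → ℝ in 𝓝 x, ∀ a b,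
      ContDiffAt ℝ 2 (fun y : Fin 4 → ℝ => h (y 0) (Fin.tail y) a b) y := by
    simp only [eventually_all]
    exact fun a b => (H.smooth a b).eventually (by simp)
  filter_upwards [h1, h2, h3, h4, h5] with y a b c d e using ⟨a, b, c, d, e⟩

theorem inv_metric (H : Regular σ h x) : (metric4 σ h x)⁻¹ =
    Matrix.of fun i j => Fin.cases (motive := fun _ => ℝ)
      (Fin.cases (motive := fun _ => ℝ) (lapse σ x ^ 2)⁻¹ (fun _ => 0) j)
      (fun a => Fin.cases (motive := fun _ => ℝ) 0
        (fun b => (h (x 0) (Fin.tail x))⁻¹ a b) j) i := by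
  apply Matrix.inv_eq_right_inv
  have hu := Matrix.mul_nonsing_inv _ (isUnit_iff_ne_zero.2 H.det_ne)
  have hN := H.lapse_ne
  ext i j
  rw [Matrix.mul_apply, Fin.sum_univ_succ]
  refine Fin.cases ?_ (fun a => ?_) i <;> refine Fin.cases ?_ (fun b => ?_) j
  · simp only [metric4, Matrix.of_apply, Fin.cases_zero, Fin.cases_succ]
    change lapse σ x ^ 2 * _ + _ = _
    simp [hN]
  · simp [metric4, (Fin.succ_ne_zero b).symm]
  · simp [metric4, Fin.succ_ne_zero a]
  · have := congrFun (congrFun hu a) b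
    rw [Matrix.mul_apply] at this
    simp [metric4, this, Matrix.one_apply]

theorem inv_zero_zero (H : Regular σ h x) : (metric4 σ h x)⁻¹ 0 0 = (lapse σ x ^ 2)⁻¹ := by
  rw [H.inv_metric]; rfl

theorem inv_zero_succ (H : Regular σ h x) (a : Fin 3) : (metric4 σ h x)⁻¹ 0 a.succ = 0 := by
  rw [H.inv_metric]; rfl

theorem inv_succ_zero (H : Regular σ h x) (a : Fin 3) : (metric4 σ h x)⁻¹ a.succ 0 = 0 := by
  rw [H.inv_metric]; rfl

theorem inv_succ_succ (H : Regular σ h x) (a b : Fin 3) :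
    (metric4 σ h x)⁻¹ a.succ b.succ = (h (x 0) (Fin.tail x))⁻¹ a b := by
  rw [H.inv_metric]; rfl

theorem diff_lapse (H : Regular σ h x) : DifferentiableAt ℝ (lapse σ) x :=
  H.smooth_lapse.differentiableAt (by norm_num)

theorem diff_h (H : Regular σ h x) (a b : Fin 3) :
    DifferentiableAt ℝ (fun y : Fin 4 → ℝ => h (y 0) (Fin.tail y) a b) x :=
  (H.smooth a b).differentiableAt (by norm_num)

theorem pd_zero_zero (H : Regular σ h x) (i : Fin 4) :
    pd i (fun y => metric4 σ h y 0 0) x = 2 * lapse σ x * pd i (lapse σ) x := by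
  change pd i (fun y => lapse σ y ^ 2) x = _
  rw [pd_pow H.diff_lapse]; simp

theorem pd_zero_succ (i : Fin 4) (a : Fin 3) :
    pd i (fun y => metric4 σ h y 0 a.succ) x = 0 := pd_const _

theorem pd_succ_zero (i : Fin 4) (a : Fin 3) :
    pd i (fun y => metric4 σ h y a.succ 0) x = 0 := pd_const _

theorem pd_succ_succ (i : Fin 4) (a b : Fin 3) :
    pd i (fun y => metric4 σ h y a.succ b.succ) x =
      pd i (fun y => h (y 0) (Fin.tail y) a b) x := rfl

theorem christoffel_zero_zero_zero (H : Regular σ h x) :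
    christoffel (metric4 σ h) 0 0 0 x = pd 0 (lapse σ) x / lapse σ x := by
  have := H.lapse_ne
  rw [christoffel, Fin.sum_univ_succ, H.inv_zero_zero]
  simp only [H.inv_zero_succ, H.pd_zero_zero]
  field_simp; simp

theorem christoffel_zero_zero_succ (H : Regular σ h x) (a : Fin 3) :
    christoffel (metric4 σ h) 0 0 a.succ x = pd a.succ (lapse σ) x / lapse σ x := by
  have := H.lapse_ne
  rw [christoffel, Fin.sum_univ_succ, H.inv_zero_zero]
  simp only [H.inv_zero_succ, H.pd_zero_zero, pd_zero_succ, pd_succ_zero]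
  field_simp; simp

theorem christoffel_zero_succ_zero (H : Regular σ h x) (a : Fin 3) :
    christoffel (metric4 σ h) 0 a.succ 0 x = pd a.succ (lapse σ) x / lapse σ x := by
  have := H.lapse_ne
  rw [christoffel, Fin.sum_univ_succ, H.inv_zero_zero]
  simp only [H.inv_zero_succ, H.pd_zero_zero, pd_zero_succ, pd_succ_zero]
  field_simp; simp

theorem christoffel_zero_succ_succ (H : Regular σ h x) (a b : Fin 3) :
    christoffel (metric4 σ h) 0 a.succ b.succ x = -(1 / 2) * radial h x a b / lapse σ x ^ 2 := by
  have := H.lapse_ne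
  rw [christoffel, Fin.sum_univ_succ, H.inv_zero_zero]
  simp only [H.inv_zero_succ, pd_zero_succ, pd_succ_succ, radial, Matrix.of_apply]
  field_simp; simp

theorem christoffel_succ_zero_zero (H : Regular σ h x) (c : Fin 3) :
    christoffel (metric4 σ h) c.succ 0 0 x =
      -lapse σ x * ∑ d, (h (x 0) (Fin.tail x))⁻¹ c d * pd d.succ (lapse σ) x := by
  rw [christoffel, Fin.sum_univ_succ, H.inv_succ_zero]
  simp only [H.inv_succ_succ, pd_succ_zero, H.pd_zero_zero, Finset.mul_sum, zero_mul, zero_add]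
  exact Finset.sum_congr rfl fun d _ => by ring

theorem christoffel_succ_zero_succ (H : Regular σ h x) (c b : Fin 3) :
    christoffel (metric4 σ h) c.succ 0 b.succ x = weingarten h x c b := by
  rw [christoffel, Fin.sum_univ_succ, H.inv_succ_zero]
  simp only [H.inv_succ_succ, pd_succ_zero, pd_zero_succ, pd_succ_succ, weingarten, radial,
    Matrix.smul_apply, Matrix.mul_apply, Matrix.of_apply, smul_eq_mul]
  simp

theorem christoffel_succ_succ_zero (H : Regular σ h x) (c a : Fin 3) :
    christoffel (metric4 σ h) c.succ a.succ 0 x = weingarten h x c a := by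
  rw [christoffel, Fin.sum_univ_succ, H.inv_succ_zero]
  simp only [H.inv_succ_succ, pd_succ_zero, pd_zero_succ, pd_succ_succ, weingarten, radial,
    Matrix.smul_apply, Matrix.mul_apply, Matrix.of_apply, smul_eq_mul]
  simp

theorem christoffel_succ_succ_succ (H : Regular σ h x) (c a b : Fin 3) :
    christoffel (metric4 σ h) c.succ a.succ b.succ x =
      christoffel (h (x 0)) c a b (Fin.tail x) := by
  rw [christoffel, Fin.sum_univ_succ, H.inv_succ_zero, christoffel]
  simp only [H.inv_succ_succ, pd_succ_succ, pd_succ (H.diff_h _ _), Fin.cons_zero, Fin.tail_cons]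
  simp

end Regular

end ADM

end

end MannMarolf

namespace MannMarolf

/-! ### The Ricci tensor of the four-metric: the Gauss–Codazzi equations. -/

section ADMEquations

variable {σ : (Fin 3 → ℝ) → ℝ} {h : ℝ → Tensor2 3} {x : Fin 4 → ℝ}

/-- Read `I` as the inverse metric, `T c a b` as `∂_c h_{ab}` and `v` as a gradient. This is `∂_c
h^{cd} + Γ^c_{cb} h^{bd} = -h^{ab} Γ^d_{ab}`, which turns the coordinate divergence of a gradient
into the trace of its Hessian. -/
theorem divergence_inverse_identity (I : Fin 3 → Fin 3 → ℝ) (T : Fin 3 → Fin 3 → Fin 3 → ℝ)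
    (v : Fin 3 → ℝ) (hI : ∀ a b, I a b = I b a) (hT : ∀ c a b, T c a b = T c b a) :
    (∑ c, ∑ d, (-∑ a, ∑ b, I c a * T c a b * I b d) * v d) +
        ∑ c, ∑ d, (1 / 2 * ∑ e, I c e * (T c e d + T d e c - T e c d)) * ∑ f, I d f * v f =
      -∑ c, ∑ d, I c d * ∑ e, (1 / 2 * ∑ f, I e f * (T c f d + T d f c - T f c d)) * v e := by
  simp only [Fin.sum_univ_three, hI 1 0, hI 2 0, hI 2 1, hT _ 1 0, hT _ 2 0, hT _ 2 1]
  ring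

namespace Regular

theorem contDiffAt_radial (H : Regular σ h x) (a b : Fin 3) :
    ContDiffAt ℝ 1 (fun y => radial h y a b) x := by
  simp only [radial, Matrix.of_apply]
  exact (H.smooth a b).pd (by norm_num)

theorem contDiffAt_inv (H : Regular σ h x) (a b : Fin 3) :
    ContDiffAt ℝ 2 (fun y : Fin 4 → ℝ => (h (y 0) (Fin.tail y))⁻¹ a b) x :=
  contDiffAt_inv_entry H.smooth H.det_ne a b

theorem diff_inv (H : Regular σ h x) (a b : Fin 3) :
    DifferentiableAt ℝ (fun y : Fin 4 → ℝ => (h (y 0) (Fin.tail y))⁻¹ a b) x :=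
  (H.contDiffAt_inv a b).differentiableAt (by norm_num)

theorem diff_radial (H : Regular σ h x) (a b : Fin 3) :
    DifferentiableAt ℝ (fun y => radial h y a b) x :=
  (H.contDiffAt_radial a b).differentiableAt (by norm_num)

theorem diff_pd_lapse (H : Regular σ h x) (i : Fin 4) :
    DifferentiableAt ℝ (pd i (lapse σ)) x :=
  (H.smooth_lapse.pd (k := 1) (by norm_num)).differentiableAt (by norm_num)

theorem diff_christoffel (H : Regular σ h x) (c a b : Fin 3) :
    DifferentiableAt ℝ (fun y : Fin 4 → ℝ => christoffel (h (y 0)) c a b (Fin.tail y)) x := by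
  have e : (fun y : Fin 4 → ℝ => christoffel (h (y 0)) c a b (Fin.tail y)) =ᶠ[𝓝 x] fun y =>
      (1 / 2) * ∑ d, (h (y 0) (Fin.tail y))⁻¹ c d *
        (pd a.succ (fun z => h (z 0) (Fin.tail z) d b) y +
          pd b.succ (fun z => h (z 0) (Fin.tail z) d a) y -
          pd d.succ (fun z => h (z 0) (Fin.tail z) a b) y) := by
    filter_upwards [H.eventually] with y Hy
    simp only [pd_succ (Hy.diff_h _ _), Fin.cons_zero, Fin.tail_cons, christoffel]
  refine DifferentiableAt.congr_of_eventuallyEq ?_ e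
  have hp : ∀ i a b, DifferentiableAt ℝ
      (pd i (fun z : Fin 4 → ℝ => h (z 0) (Fin.tail z) a b)) x := fun i a b =>
    ((H.smooth a b).pd (k := 1) (by norm_num)).differentiableAt (by norm_num)
  refine (differentiableAt_const _).mul (DifferentiableAt.fun_sum fun d _ => ?_)
  exact (H.diff_inv c d).mul (((hp _ _ _).add (hp _ _ _)).sub (hp _ _ _))

theorem pd_christoffel (H : Regular σ h x) (i c a b : Fin 3) :
    pd i.succ (christoffel (metric4 σ h) c.succ a.succ b.succ) x =
      pd i (christoffel (h (x 0)) c a b) (Fin.tail x) := by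
  rw [pd_congr (g := fun y : Fin 4 → ℝ => christoffel (h (y 0)) c a b (Fin.tail y))
    (by filter_upwards [H.eventually] with y Hy using Hy.christoffel_succ_succ_succ c a b),
    pd_succ (H.diff_christoffel c a b)]
  simp only [Fin.cons_zero, Fin.tail_cons]

/-- The tangential equations: the Ricci tensor of `h`, corrected by the radial derivative of the
extrinsic curvature, its quadratic terms and the Hessian of the lapse. Symmetry of `h` is not
assumed, hence the product `radial h x * weingarten h x` appears in both index orders. -/
theorem ricci_succ_succ (H : Regular σ h x) (a b : Fin 3) :
    ricci (metric4 σ h) a.succ b.succ x = ricci (h (x 0)) a b (Fin.tail x) -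
      1 / 2 * radial₂ h x a b / lapse σ x ^ 2 +
      1 / 2 * pd 0 (lapse σ) x * radial h x a b / lapse σ x ^ 3 -
      (pd b.succ (pd a.succ (lapse σ)) x -
        ∑ c, christoffel (h (x 0)) c a b (Fin.tail x) * pd c.succ (lapse σ) x) / lapse σ x -
      1 / 2 * (weingarten h x).trace * radial h x a b / lapse σ x ^ 2 +
      1 / 2 * (radial h x * weingarten h x) b a / lapse σ x ^ 2 +
      1 / 2 * (radial h x * weingarten h x) a b / lapse σ x ^ 2 := by
  have hN := H.lapse_ne
  have e1 : pd 0 (christoffel (metric4 σ h) 0 a.succ b.succ) x =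
      -(1 / 2) * (radial₂ h x a b / lapse σ x ^ 2 -
        2 * radial h x a b * pd 0 (lapse σ) x / lapse σ x ^ 3) := by
    rw [pd_congr (g := fun y => -(1 / 2) * radial h y a b / lapse σ y ^ 2)
      (by filter_upwards [H.eventually] with y Hy using Hy.christoffel_zero_succ_succ a b),
      pd_div ((H.diff_radial a b).const_mul _) (H.diff_lapse.fun_pow 2) (pow_ne_zero 2 hN),
      pd_const_mul _ (H.diff_radial a b), pd_pow H.diff_lapse,
      show pd 0 (fun y => radial h y a b) x = radial₂ h x a b from rfl]
    field_simp
    push_cast; ring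
  have e2 : pd b.succ (christoffel (metric4 σ h) 0 a.succ 0) x =
      pd b.succ (pd a.succ (lapse σ)) x / lapse σ x -
        pd a.succ (lapse σ) x * pd b.succ (lapse σ) x / lapse σ x ^ 2 := by
    rw [pd_congr (g := fun y => pd a.succ (lapse σ) y / lapse σ y)
      (by filter_upwards [H.eventually] with y Hy using Hy.christoffel_zero_succ_zero a),
      pd_div (H.diff_pd_lapse _) H.diff_lapse hN]
  have e3 : (radial h x * weingarten h x) a b = ∑ c, weingarten h x c b * radial h x a c := by
    rw [Matrix.mul_apply]; exact Finset.sum_congr rfl fun c _ => mul_comm _ _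
  rw [ricci, ricci, Fin.sum_univ_succ (n := 3), e1, e2]
  simp only [Fin.sum_univ_succ (n := 3), H.pd_christoffel, H.christoffel_zero_zero_zero,
    H.christoffel_zero_zero_succ, H.christoffel_zero_succ_zero, H.christoffel_zero_succ_succ,
    H.christoffel_succ_succ_zero, H.christoffel_succ_succ_succ, Finset.sum_add_distrib,
    Finset.sum_sub_distrib]
  rw [e3, Matrix.mul_apply, Matrix.trace]
  simp only [Matrix.diag_apply, Fin.sum_univ_three]
  ring

/-- Differentiating `h⁻¹` in `½ tr (h⁻¹ ∂_ρ h)` contributes `-½ tr (h⁻¹ ∂_ρ h)²`, that is `-2 tr W²`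
for `W = ½ h⁻¹ ∂_ρ h`. -/
theorem pd_zero_weingarten_trace (H : Regular σ h x) :
    ∑ c, pd 0 (fun y => weingarten h y c c) x =
      1 / 2 * ((h (x 0) (Fin.tail x))⁻¹ * radial₂ h x).trace -
        2 * (weingarten h x * weingarten h x).trace := by
  have e : ∀ c, pd 0 (fun y => weingarten h y c c) x = 1 / 2 * ∑ d,
      ((-∑ a, ∑ b, (h (x 0) (Fin.tail x))⁻¹ c a * radial h x a b * (h (x 0) (Fin.tail x))⁻¹ b d) *
        radial h x d c + (h (x 0) (Fin.tail x))⁻¹ c d * radial₂ h x d c) := fun c => by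
    simp only [weingarten, Matrix.smul_apply, Matrix.mul_apply, smul_eq_mul]
    rw [pd_const_mul _ (DifferentiableAt.fun_sum fun d _ => (H.diff_inv c d).fun_mul
      (H.diff_radial d c)), pd_sum fun d _ => (H.diff_inv c d).fun_mul (H.diff_radial d c)]
    congr 1
    refine Finset.sum_congr rfl fun d _ => ?_
    rw [pd_mul (H.diff_inv c d) (H.diff_radial d c), pd_inv_entry (A := fun y : Fin 4 → ℝ =>
      h (y 0) (Fin.tail y)) (fun a b => (H.smooth a b).of_le (by norm_num)) H.det_ne]
    rfl
  simp only [e]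
  simp only [weingarten, Matrix.trace, Matrix.diag_apply, Matrix.mul_apply, Matrix.smul_apply,
    smul_eq_mul]
  simp only [Fin.sum_univ_three]
  ring

/-- The radial equation of Raychaudhuri type, with the Laplacian of the lapse assembled by
`divergence_inverse_identity`. Symmetry of the derivatives of `h` is a separate hypothesis because
`h` is known to be symmetric only on a closed slab, not on a neighbourhood. -/
theorem ricci_zero_zero (H : Regular σ h x) (hs : (h (x 0) (Fin.tail x)).IsSymm)
    (hd : ∀ c a b, pd c (fun u => h (x 0) u a b) (Fin.tail x) =
      pd c (fun u => h (x 0) u b a) (Fin.tail x)) :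
    ricci (metric4 σ h) 0 0 x =
      -lapse σ x * ∑ c, ∑ d, (h (x 0) (Fin.tail x))⁻¹ c d * (pd c.succ (pd d.succ (lapse σ)) x -
        ∑ e, christoffel (h (x 0)) e c d (Fin.tail x) * pd e.succ (lapse σ) x) -
      1 / 2 * ((h (x 0) (Fin.tail x))⁻¹ * radial₂ h x).trace +
      (weingarten h x * weingarten h x).trace +
      (weingarten h x).trace * pd 0 (lapse σ) x / lapse σ x := by
  have hN := H.lapse_ne
  set I := (h (x 0) (Fin.tail x))⁻¹ with hI
  have e1 : ∀ c : Fin 3, pd c.succ (christoffel (metric4 σ h) c.succ 0 0) x =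
      -(pd c.succ (lapse σ) x * ∑ d, I c d * pd d.succ (lapse σ) x) - lapse σ x * ∑ d,
        ((-∑ a, ∑ b, I c a * pd c (fun u => h (x 0) u a b) (Fin.tail x) * I b d) *
          pd d.succ (lapse σ) x + I c d * pd c.succ (pd d.succ (lapse σ)) x) := fun c => by
    have d1 : ∀ d : Fin 3, DifferentiableAt ℝ (fun y : Fin 4 → ℝ =>
        (h (y 0) (Fin.tail y))⁻¹ c d * pd d.succ (lapse σ) y) x := fun d =>
      (H.diff_inv c d).mul (H.diff_pd_lapse _)
    rw [pd_congr (g := fun y : Fin 4 → ℝ => -lapse σ y *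
        ∑ d, (h (y 0) (Fin.tail y))⁻¹ c d * pd d.succ (lapse σ) y)
      (by filter_upwards [H.eventually] with y Hy using Hy.christoffel_succ_zero_zero c),
      pd_mul H.diff_lapse.fun_neg (DifferentiableAt.fun_sum fun d _ => d1 d), pd_neg,
      pd_sum fun d _ => d1 d]
    have e : ∀ d : Fin 3, pd c.succ (fun y : Fin 4 → ℝ =>
        (h (y 0) (Fin.tail y))⁻¹ c d * pd d.succ (lapse σ) y) x =
        (-∑ a, ∑ b, I c a * pd c (fun u => h (x 0) u a b) (Fin.tail x) * I b d) *
          pd d.succ (lapse σ) x + I c d * pd c.succ (pd d.succ (lapse σ)) x := fun d => by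
      rw [pd_mul (H.diff_inv c d) (H.diff_pd_lapse _), pd_inv_entry (A := fun y : Fin 4 → ℝ =>
        h (y 0) (Fin.tail y)) (fun a b => (H.smooth a b).of_le (by norm_num)) H.det_ne]
      simp only [pd_succ (H.diff_h _ _), Fin.cons_zero, Fin.tail_cons]
      rfl
    simp only [e]
    ring
  have e2 : ∀ c : Fin 3, pd 0 (christoffel (metric4 σ h) c.succ 0 c.succ) x =
      pd 0 (fun y => weingarten h y c c) x := fun c =>
    pd_congr (by filter_upwards [H.eventually] with y Hy using Hy.christoffel_succ_zero_succ c c)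
  have e3 := divergence_inverse_identity (fun a b => I a b)
    (fun c a b => pd c (fun u => h (x 0) u a b) (Fin.tail x)) (fun e => pd e.succ (lapse σ) x)
    (fun a b => by
      have : I.IsSymm := by rw [hI, Matrix.IsSymm, Matrix.transpose_nonsing_inv, hs.eq]
      exact this.apply b a) hd
  have e4 := H.pd_zero_weingarten_trace
  rw [ricci, Fin.sum_univ_succ (n := 3)]
  simp only [Fin.sum_univ_succ (n := 3), H.christoffel_zero_zero_zero,
    H.christoffel_zero_zero_succ, H.christoffel_succ_zero_zero,
    H.christoffel_succ_zero_succ, H.christoffel_succ_succ_zero, H.christoffel_succ_succ_succ, e1,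
    e2, Finset.sum_add_distrib, Finset.sum_sub_distrib, sub_self, e4]
  have e6 : (weingarten h x).trace = ∑ c, weingarten h x c c := rfl
  have e7 : ∀ a b, -lapse σ x * b * (a / lapse σ x) = -(a * b) := fun a b => by field_simp
  have e5 : (weingarten h x * weingarten h x).trace =
      ∑ c, ∑ d, weingarten h x c d * weingarten h x d c := rfl
  rw [e5, e6]
  simp only [e7]
  simp only [christoffel, ← hI, Fin.sum_univ_three] at e3 ⊢
  linear_combination (-lapse σ x) * e3

end Regular

end ADMEquations

end MannMarolf

namespace MannMarolf

noncomputable section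

/-! ### Derivatives of the lapse `1 + σ/ρ`. -/

section LapseDerivatives

variable {σ : (Fin 3 → ℝ) → ℝ} {h : ℝ → Tensor2 3} {x : Fin 4 → ℝ}

namespace Regular

theorem diff_σ (H : Regular σ h x) : DifferentiableAt ℝ σ (Fin.tail x) :=
  H.smooth_σ.differentiableAt (by norm_num)

theorem diff_σ_tail (H : Regular σ h x) :
    DifferentiableAt ℝ (fun y : Fin 4 → ℝ => σ (Fin.tail y)) x :=
  DifferentiableAt.comp (g := σ) x H.diff_σ
    ((contDiff_tail (k := 1)).differentiable (by norm_num)).differentiableAt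

theorem pd_zero_lapse (H : Regular σ h x) : pd 0 (lapse σ) x = -σ (Fin.tail x) / x 0 ^ 2 := by
  have h0 : DifferentiableAt ℝ (fun y : Fin 4 → ℝ => y 0) x := differentiableAt_apply 0 x
  have h1 : DifferentiableAt ℝ (fun y : Fin 4 → ℝ => σ (Fin.tail y) / y 0) x :=
    by simpa only [div_eq_mul_inv] using H.diff_σ_tail.fun_mul (h0.fun_inv H.radius)
  change pd 0 (fun y => 1 + σ (Fin.tail y) / y 0) x = _
  rw [pd_add (differentiableAt_const _) h1, pd_const,
    pd_div H.diff_σ_tail h0 H.radius, pd_zero_tail H.diff_σ, pd_coord]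
  simp [neg_div]

theorem pd_succ_lapse (H : Regular σ h x) (a : Fin 3) :
    pd a.succ (lapse σ) x = pd a σ (Fin.tail x) / x 0 := by
  have h0 : DifferentiableAt ℝ (fun y : Fin 4 → ℝ => y 0) x := differentiableAt_apply 0 x
  have h1 : DifferentiableAt ℝ (fun y : Fin 4 → ℝ => σ (Fin.tail y) / y 0) x :=
    by simpa only [div_eq_mul_inv] using H.diff_σ_tail.fun_mul (h0.fun_inv H.radius)
  change pd a.succ (fun y => 1 + σ (Fin.tail y) / y 0) x = _
  rw [pd_add (differentiableAt_const _) h1, pd_const,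
    pd_div H.diff_σ_tail h0 H.radius, pd_succ_tail H.diff_σ, pd_coord, if_neg (Fin.succ_ne_zero a)]
  simp

theorem pd_succ_pd_succ_lapse (H : Regular σ h x) (a b : Fin 3) :
    pd b.succ (pd a.succ (lapse σ)) x = pd b (pd a σ) (Fin.tail x) / x 0 := by
  have h0 : DifferentiableAt ℝ (fun y : Fin 4 → ℝ => y 0) x := differentiableAt_apply 0 x
  have h1 : DifferentiableAt ℝ (pd a σ) (Fin.tail x) :=
    (H.smooth_σ.pd (k := 1) (by norm_num)).differentiableAt (by norm_num)
  have h2 : DifferentiableAt ℝ (fun y : Fin 4 → ℝ => pd a σ (Fin.tail y)) x :=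
    DifferentiableAt.comp (g := pd a σ) x h1
      ((contDiff_tail (k := 1)).differentiable (by norm_num)).differentiableAt
  rw [pd_congr (g := fun y : Fin 4 → ℝ => pd a σ (Fin.tail y) / y 0)
    (by filter_upwards [H.eventually] with y Hy using Hy.pd_succ_lapse a),
    pd_div h2 h0 H.radius, pd_succ_tail h1, pd_coord, if_neg (Fin.succ_ne_zero b)]
  simp

end Regular

end LapseDerivatives

/-! ### The metric of the hyperboloid, slabs, and uniform limits over a slab. -/

section Slab

/-- The conformal factor of the spatial part of `dS`. -/
def dSFactor (u : Fin 3 → ℝ) : ℝ := 4 * Real.cosh (u 0) ^ 2 / (1 + u 1 ^ 2 + u 2 ^ 2) ^ 2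

theorem one_add_sq_pos (u : Fin 3 → ℝ) : 0 < 1 + u 1 ^ 2 + u 2 ^ 2 := by positivity

theorem dSFactor_pos (u : Fin 3 → ℝ) : 0 < dSFactor u := by
  have := one_add_sq_pos u
  have := Real.cosh_pos (u 0)
  unfold dSFactor; positivity

theorem contDiff_dSFactor {k : WithTop ℕ∞} : ContDiff ℝ k dSFactor := by
  unfold dSFactor
  refine ContDiff.div ?_ ?_ fun u => pow_ne_zero 2 (one_add_sq_pos u).ne'
  · exact contDiff_const.mul ((Real.contDiff_cosh.comp (contDiff_apply ℝ ℝ 0)).pow 2)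
  · exact (((contDiff_const.add ((contDiff_apply ℝ ℝ 1).pow 2))).add
      ((contDiff_apply ℝ ℝ 2).pow 2)).pow 2

theorem dS_eq (u : Fin 3 → ℝ) : dS u = Matrix.diagonal ![-1, dSFactor u, dSFactor u] := rfl

theorem dS_symm (u : Fin 3 → ℝ) : (dS u).IsSymm := Matrix.isSymm_diagonal _

theorem dS_mul_inv (u : Fin 3 → ℝ) :
    dS u * Matrix.diagonal ![-1, (dSFactor u)⁻¹, (dSFactor u)⁻¹] = 1 := by
  have := (dSFactor_pos u).ne'
  rw [dS_eq, Matrix.diagonal_mul_diagonal, ← Matrix.diagonal_one]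
  congr 1
  funext i
  fin_cases i <;> simp [this]

theorem dS_inv (u : Fin 3 → ℝ) :
    (dS u)⁻¹ = Matrix.diagonal ![-1, (dSFactor u)⁻¹, (dSFactor u)⁻¹] :=
  Matrix.inv_eq_right_inv (dS_mul_inv u)

theorem dS_det (u : Fin 3 → ℝ) : (dS u).det = -dSFactor u ^ 2 := by
  rw [dS_eq, Matrix.det_diagonal, Fin.prod_univ_three]
  simp; ring

theorem sqrt_dS_det (u : Fin 3 → ℝ) : Real.sqrt (-(dS u).det) = dSFactor u := by
  rw [dS_det, neg_neg, Real.sqrt_sq (dSFactor_pos u).le]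

theorem contDiff_dS {k : WithTop ℕ∞} (a b : Fin 3) : ContDiff ℝ k (fun u => dS u a b) := by
  have hf := contDiff_dSFactor (k := k)
  by_cases hab : a = b
  · subst hab
    simp only [dS_eq, Matrix.diagonal_apply_eq]
    fin_cases a
    · simpa using contDiff_const
    · simpa using hf
    · simpa using hf
  · simp only [dS_eq, Matrix.diagonal_apply_ne _ hab]
    exact contDiff_const

theorem isCompact_slab (τ₁ τ₂ : ℝ) : IsCompact (slab τ₁ τ₂) := by
  refine Metric.isCompact_of_isClosed_isBounded ?_ ?_
  · have h0 : Continuous fun u : Fin 3 → ℝ => u 0 := continuous_apply 0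
    have h1 : Continuous fun u : Fin 3 → ℝ => u 1 ^ 2 + u 2 ^ 2 := by fun_prop
    exact (isClosed_le continuous_const h0).inter
      ((isClosed_le h0 continuous_const).inter (isClosed_le h1 continuous_const))
  · refine (Metric.isBounded_Icc (![τ₁, -1, -1] : Fin 3 → ℝ) ![τ₂, 1, 1]).subset ?_
    rintro u ⟨h1, h2, h3⟩
    constructor <;> intro i <;> fin_cases i
    · exact h1
    · show -1 ≤ u 1; nlinarith [sq_nonneg (u 2)]
    · show -1 ≤ u 2; nlinarith [sq_nonneg (u 1)]
    · exact h2
    · show u 1 ≤ 1; nlinarith [sq_nonneg (u 2)]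
    · show u 2 ≤ 1; nlinarith [sq_nonneg (u 1)]

theorem slab_subset_patch (τ₁ τ₂ : ℝ) : slab τ₁ τ₂ ⊆ patch := fun _ hu => hu.2.2

theorem convex_slab (τ₁ τ₂ : ℝ) : Convex ℝ (slab τ₁ τ₂) := by
  rintro u ⟨hu1, hu2, hu3⟩ v ⟨hv1, hv2, hv3⟩ a b ha hb hab
  refine ⟨?_, ?_, ?_⟩
  · simp only [Pi.add_apply, Pi.smul_apply, smul_eq_mul]
    obtain rfl : b = 1 - a := by linarith
    nlinarith
  · simp only [Pi.add_apply, Pi.smul_apply, smul_eq_mul]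
    obtain rfl : b = 1 - a := by linarith
    nlinarith
  · simp only [Pi.add_apply, Pi.smul_apply, smul_eq_mul]
    obtain rfl : b = 1 - a := by linarith
    nlinarith [mul_nonneg ha hb, sq_nonneg (u 1 - v 1), sq_nonneg (u 2 - v 2),
      mul_nonneg (mul_nonneg ha hb) (sq_nonneg (u 1 - v 1)),
      mul_nonneg (mul_nonneg ha hb) (sq_nonneg (u 2 - v 2)), mul_le_mul_of_nonneg_left hu3 ha,
      mul_le_mul_of_nonneg_left hv3 hb]

theorem interior_slab_nonempty {τ₁ τ₂ : ℝ} (h : τ₁ < τ₂) : (interior (slab τ₁ τ₂)).Nonempty := by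
  refine ⟨![(τ₁ + τ₂) / 2, 0, 0], mem_interior.2
    ⟨{u | τ₁ < u 0 ∧ u 0 < τ₂ ∧ u 1 ^ 2 + u 2 ^ 2 < 1}, fun u hu => ⟨hu.1.le, hu.2.1.le, hu.2.2.le⟩,
      ?_, ?_⟩⟩
  · have h0 : Continuous fun u : Fin 3 → ℝ => u 0 := continuous_apply 0
    have h1 : Continuous fun u : Fin 3 → ℝ => u 1 ^ 2 + u 2 ^ 2 := by fun_prop
    exact (isOpen_lt continuous_const h0).inter
      ((isOpen_lt h0 continuous_const).inter (isOpen_lt h1 continuous_const))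
  · refine ⟨?_, ?_, ?_⟩ <;> simp <;> linarith

/-- A function that vanishes on a slab has vanishing derivatives there, also on its boundary. -/
theorem pd_eq_zero_of_eqOn_slab {τ₁ τ₂ : ℝ} (h : τ₁ < τ₂) {f : (Fin 3 → ℝ) → ℝ} {u : Fin 3 → ℝ}
    (hu : u ∈ slab τ₁ τ₂) (hf : DifferentiableAt ℝ f u) (h0 : ∀ v ∈ slab τ₁ τ₂, f v = 0)
    (i : Fin 3) : pd i f u = 0 := by
  -- The slab is convex with nonempty interior, so the full derivative is determined by the values
  -- on the slab, even at its edge. This is how identities imposed on the closed patch are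
  -- differentiated up to the equator.
  have hd : UniqueDiffWithinAt ℝ (slab τ₁ τ₂) u :=
    uniqueDiffOn_convex (convex_slab τ₁ τ₂) (interior_slab_nonempty h) u hu
  have h1 : HasFDerivWithinAt f (0 : (Fin 3 → ℝ) →L[ℝ] ℝ) (slab τ₁ τ₂) u :=
    (hasFDerivWithinAt_const (0 : ℝ) u _).congr h0 (h0 u hu)
  rw [pd, hd.eq hf.hasFDerivAt.hasFDerivWithinAt h1]
  rfl

theorem exists_slab_of_mem_patch {u : Fin 3 → ℝ} (hu : u ∈ patch) :
    u ∈ slab (u 0 - 1) (u 0 + 1) := ⟨by linarith, by linarith, hu⟩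

/-- The filter of points at large radius over a slab. -/
def farSlab (τ₁ τ₂ : ℝ) : Filter (ℝ × (Fin 3 → ℝ)) := atTop ×ˢ 𝓟 (slab τ₁ τ₂)

/-- The principal factor makes every statement along `farSlab` uniform over the slab, so that
asymptotics along this filter are the required uniform estimates. -/
theorem eventually_farSlab {τ₁ τ₂ : ℝ} {p : ℝ × (Fin 3 → ℝ) → Prop} :
    (∀ᶠ z in farSlab τ₁ τ₂, p z) ↔ ∃ R > 0, ∀ ρ > R, ∀ u ∈ slab τ₁ τ₂, p (ρ, u) := by
  rw [farSlab, Filter.eventually_prod_principal_iff]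
  constructor
  · intro h
    obtain ⟨R, hR⟩ := eventually_atTop.1 h
    exact ⟨max R 1, by positivity, fun ρ hρ u hu => hR ρ ((le_max_left _ _).trans hρ.le) u hu⟩
  · rintro ⟨R, -, hR⟩
    exact (eventually_gt_atTop R).mono fun ρ hρ u hu => hR ρ hρ u hu

theorem tendsto_radius (τ₁ τ₂ : ℝ) : Tendsto (fun z => z.1) (farSlab τ₁ τ₂) atTop :=
  tendsto_fst

theorem eventually_mem_slab (τ₁ τ₂ : ℝ) : ∀ᶠ z in farSlab τ₁ τ₂, z.2 ∈ slab τ₁ τ₂ :=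
  eventually_farSlab.2 ⟨1, one_pos, fun _ _ _ hu => hu⟩

theorem isBigO_one_of_continuousOn {E : Type*} [NormedAddCommGroup E] {τ₁ τ₂ : ℝ}
    {f : (Fin 3 → ℝ) → E} (hf : ContinuousOn f (slab τ₁ τ₂)) :
    (fun z => f z.2) =O[farSlab τ₁ τ₂] (fun _ => (1 : ℝ)) := by
  obtain ⟨C, hC⟩ := (isCompact_slab τ₁ τ₂).exists_bound_of_continuousOn hf
  refine IsBigO.of_bound C ?_
  filter_upwards [eventually_mem_slab τ₁ τ₂] with z hz
  simpa using hC z.2 hz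

theorem isBigO_farSlab {E : Type*} [NormedAddCommGroup E] {τ₁ τ₂ : ℝ}
    {f : ℝ × (Fin 3 → ℝ) → E} {n : ℕ} (h : f =O[farSlab τ₁ τ₂] fun z => z.1⁻¹ ^ n) :
    ∃ C, ∃ R > 0, ∀ ρ > R, ∀ u ∈ slab τ₁ τ₂, ‖f (ρ, u)‖ ≤ C / ρ ^ n := by
  obtain ⟨C, hC⟩ := h.bound
  obtain ⟨R, hR, h⟩ := eventually_farSlab.1 hC
  refine ⟨C, R, hR, fun ρ hρ u hu => ?_⟩
  have := h ρ hρ u hu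
  have hp : 0 < ρ := hR.trans hρ
  rwa [Real.norm_of_nonneg (by positivity), inv_pow, ← div_eq_mul_inv] at this

end Slab

end

end MannMarolf

namespace MannMarolf

noncomputable section

/-! ### Differentiating the Beig–Schmidt expansion. -/

section RadialExpansion

variable {A B C : (Fin 3 → ℝ) → ℝ} {E F : (Fin 4 → ℝ) → ℝ} {x : Fin 4 → ℝ}

theorem diff_tail {f : (Fin 3 → ℝ) → ℝ} (hf : DifferentiableAt ℝ f (Fin.tail x)) :
    DifferentiableAt ℝ (fun y : Fin 4 → ℝ => f (Fin.tail y)) x :=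
  DifferentiableAt.comp (g := f) x hf
    ((contDiff_tail (k := 1)).differentiable (by norm_num)).differentiableAt

/-- The form `ρ² A + ρ B + C + ρ² E` is that of a component of `h`: `A`, `B`, `C` come from the
metrics of order zero, one and two, and `E` is the remainder. -/
theorem pd_zero_expansion (hA : DifferentiableAt ℝ A (Fin.tail x))
    (hB : DifferentiableAt ℝ B (Fin.tail x)) (hC : DifferentiableAt ℝ C (Fin.tail x))
    (hE : DifferentiableAt ℝ E x)
    (hF : F =ᶠ[𝓝 x] fun y => y 0 ^ 2 * A (Fin.tail y) + y 0 * B (Fin.tail y) + C (Fin.tail y) +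
      y 0 ^ 2 * E y) :
    pd 0 F x = 2 * x 0 * A (Fin.tail x) + B (Fin.tail x) + 2 * x 0 * E x + x 0 ^ 2 * pd 0 E x := by
  have h0 : DifferentiableAt ℝ (fun y : Fin 4 → ℝ => y 0) x := differentiableAt_apply 0 x
  have h1 : DifferentiableAt ℝ (fun y : Fin 4 → ℝ => y 0 ^ 2) x := h0.fun_pow 2
  rw [pd_congr hF, pd_add ((((h1.fun_mul (diff_tail hA)).fun_add (h0.fun_mul (diff_tail hB)))).fun_add
      (diff_tail hC)) (h1.fun_mul hE),
    pd_add ((h1.fun_mul (diff_tail hA)).fun_add (h0.fun_mul (diff_tail hB))) (diff_tail hC),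
    pd_add (h1.fun_mul (diff_tail hA)) (h0.fun_mul (diff_tail hB)), pd_mul h1 (diff_tail hA),
    pd_mul h0 (diff_tail hB), pd_mul h1 hE, pd_pow h0, pd_coord, pd_zero_tail hA, pd_zero_tail hB,
    pd_zero_tail hC]
  simp; ring

theorem pd_succ_expansion (hA : DifferentiableAt ℝ A (Fin.tail x))
    (hB : DifferentiableAt ℝ B (Fin.tail x)) (hC : DifferentiableAt ℝ C (Fin.tail x))
    (hE : DifferentiableAt ℝ E x)
    (hF : F =ᶠ[𝓝 x] fun y => y 0 ^ 2 * A (Fin.tail y) + y 0 * B (Fin.tail y) + C (Fin.tail y) +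
      y 0 ^ 2 * E y) (c : Fin 3) :
    pd c.succ F x = x 0 ^ 2 * pd c A (Fin.tail x) + x 0 * pd c B (Fin.tail x) +
      pd c C (Fin.tail x) + x 0 ^ 2 * pd c.succ E x := by
  have h0 : DifferentiableAt ℝ (fun y : Fin 4 → ℝ => y 0) x := differentiableAt_apply 0 x
  have h1 : DifferentiableAt ℝ (fun y : Fin 4 → ℝ => y 0 ^ 2) x := h0.fun_pow 2
  rw [pd_congr hF, pd_add ((((h1.fun_mul (diff_tail hA)).fun_add (h0.fun_mul (diff_tail hB)))).fun_add
      (diff_tail hC)) (h1.fun_mul hE),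
    pd_add ((h1.fun_mul (diff_tail hA)).fun_add (h0.fun_mul (diff_tail hB))) (diff_tail hC),
    pd_add (h1.fun_mul (diff_tail hA)) (h0.fun_mul (diff_tail hB)), pd_mul h1 (diff_tail hA),
    pd_mul h0 (diff_tail hB), pd_mul h1 hE, pd_pow h0, pd_coord, pd_succ_tail hA, pd_succ_tail hB,
    pd_succ_tail hC, if_neg (Fin.succ_ne_zero c)]
  simp

theorem pd_zero_pd_zero_expansion (hA : ContDiffAt ℝ 1 A (Fin.tail x))
    (hB : ContDiffAt ℝ 1 B (Fin.tail x)) (hC : ContDiffAt ℝ 1 C (Fin.tail x))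
    (hE : ContDiffAt ℝ 2 E x)
    (hF : F =ᶠ[𝓝 x] fun y => y 0 ^ 2 * A (Fin.tail y) + y 0 * B (Fin.tail y) + C (Fin.tail y) +
      y 0 ^ 2 * E y) :
    pd 0 (pd 0 F) x = 2 * A (Fin.tail x) + 2 * E x + 4 * x 0 * pd 0 E x +
      x 0 ^ 2 * pd 0 (pd 0 E) x := by
  have h0 : DifferentiableAt ℝ (fun y : Fin 4 → ℝ => y 0) x := differentiableAt_apply 0 x
  have h1 : DifferentiableAt ℝ (fun y : Fin 4 → ℝ => y 0 ^ 2) x := h0.fun_pow 2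
  have ht := (contDiff_tail (k := 1)).continuous.tendsto x
  have e : pd 0 F =ᶠ[𝓝 x] fun y => 2 * y 0 * A (Fin.tail y) + B (Fin.tail y) + 2 * y 0 * E y +
      y 0 ^ 2 * pd 0 E y := by
    filter_upwards [ht.eventually (hA.eventually (by simp)), ht.eventually (hB.eventually (by simp)),
      ht.eventually (hC.eventually (by simp)), hE.eventually (by simp), hF.eventuallyEq_nhds]
      with y a b c d f
    exact pd_zero_expansion (a.differentiableAt (by norm_num)) (b.differentiableAt (by norm_num))
      (c.differentiableAt (by norm_num)) (d.differentiableAt (by norm_num)) f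
  have dA := hA.differentiableAt (by norm_num)
  have dB := hB.differentiableAt (by norm_num)
  have dE : DifferentiableAt ℝ E x := hE.differentiableAt (by norm_num)
  have dE' : DifferentiableAt ℝ (pd 0 E) x :=
    (hE.pd (k := 1) (by norm_num)).differentiableAt (by norm_num)
  have h2 : DifferentiableAt ℝ (fun y : Fin 4 → ℝ => 2 * y 0) x := h0.const_mul 2
  rw [pd_congr e, pd_add (((h2.fun_mul (diff_tail dA)).fun_add (diff_tail dB)).fun_add (h2.fun_mul dE))
      (h1.fun_mul dE'), pd_add ((h2.fun_mul (diff_tail dA)).fun_add (diff_tail dB)) (h2.fun_mul dE),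
    pd_add (h2.fun_mul (diff_tail dA)) (diff_tail dB), pd_mul h2 (diff_tail dA), pd_mul h2 dE,
    pd_mul h1 dE', pd_pow h0, pd_const_mul _ h0, pd_coord, pd_zero_tail dA, pd_zero_tail dB]
  simp; ring

end RadialExpansion

/-! ### Expansions of `h` and its derivatives for a configuration. -/

namespace Configuration

variable (X : Configuration) (P : Fin 2) (τ₁ τ₂ : ℝ)

/-- The first-order metric `h⁽¹⁾ = -2 σ h⁽⁰⁾ + k`. -/
def h₁ (u : Fin 3 → ℝ) : Mat := (-2 * X.σ P u) • dS u + X.k P u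

/-- The remainder of the expansion of the metric. -/
def rem (a b : Fin 3) : (Fin 4 → ℝ) → ℝ := remainder (X.σ P) (X.k P) (X.h₂ P) (X.h P) a b

variable {P τ₁ τ₂}

theorem contDiffAt_h₁ {u : Fin 3 → ℝ} (hu : u ∈ patch) (a b : Fin 3) :
    ContDiffAt ℝ ∞ (fun v => X.h₁ P v a b) u := by
  simp only [h₁, Matrix.add_apply, Matrix.smul_apply, smul_eq_mul]
  exact ((contDiffAt_const.mul (X.σ_smooth P).contDiffAt).mul (contDiff_dS a b).contDiffAt).add
    (X.k_smooth P u hu a b)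

theorem eventually_contDiffAt_h (P : Fin 2) (τ₁ τ₂ : ℝ) : ∀ᶠ z in farSlab τ₁ τ₂,
    (X.h P z.1 z.2).IsSymm ∧ ∀ a b, ContDiffAt ℝ ∞
      (fun x : Fin 4 → ℝ => X.h P (x 0) (Fin.tail x) a b) (Fin.cons z.1 z.2) := by
  obtain ⟨R, hR, h⟩ := X.h_smooth τ₁ τ₂
  exact eventually_farSlab.2 ⟨R, hR, h P⟩

theorem h_eq_expansion {y : Fin 4 → ℝ} (hy : y 0 ≠ 0) (a b : Fin 3) :
    X.h P (y 0) (Fin.tail y) a b = y 0 ^ 2 * dS (Fin.tail y) a b + y 0 * X.h₁ P (Fin.tail y) a b +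
      X.h₂ P (Fin.tail y) a b + y 0 ^ 2 * X.rem P a b y := by
  simp only [rem, remainder, h₁, Matrix.add_apply, Matrix.smul_apply, smul_eq_mul]
  field_simp
  ring

theorem h_eventuallyEq_expansion {x : Fin 4 → ℝ} (hx : x 0 ≠ 0) (a b : Fin 3) :
    (fun y : Fin 4 → ℝ => X.h P (y 0) (Fin.tail y) a b) =ᶠ[𝓝 x] fun y =>
      y 0 ^ 2 * dS (Fin.tail y) a b + y 0 * X.h₁ P (Fin.tail y) a b + X.h₂ P (Fin.tail y) a b +
        y 0 ^ 2 * X.rem P a b y :=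
  ((continuous_apply 0).continuousAt.eventually_ne hx).mono fun _ hy => X.h_eq_expansion hy a b

theorem contDiffAt_rem {x : Fin 4 → ℝ} (hx : x 0 ≠ 0) (hp : Fin.tail x ∈ patch) (a b : Fin 3)
    (hh : ContDiffAt ℝ ∞ (fun y : Fin 4 → ℝ => X.h P (y 0) (Fin.tail y) a b) x) :
    ContDiffAt ℝ ∞ (X.rem P a b) x := by
  have h0 : ContDiffAt ℝ ∞ (fun y : Fin 4 → ℝ => y 0) x := (contDiff_apply ℝ ℝ 0).contDiffAt
  have ht : ∀ {f : (Fin 3 → ℝ) → ℝ}, ContDiffAt ℝ ∞ f (Fin.tail x) →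
      ContDiffAt ℝ ∞ (fun y : Fin 4 → ℝ => f (Fin.tail y)) x := fun hf =>
    ContDiffAt.comp x hf contDiff_tail.contDiffAt
  have hd := ht (contDiff_dS a b).contDiffAt
  exact (hh.div (h0.pow 2) (pow_ne_zero 2 hx)).sub ((hd.add
    ((((contDiffAt_const.mul (ht (X.σ_smooth P).contDiffAt)).mul hd).add
      (ht (X.k_smooth P _ hp a b))).div h0 hx)).add
    ((ht (X.h₂_smooth P _ hp a b)).div (h0.pow 2) (pow_ne_zero 2 hx)))

theorem rem_isBigO (P : Fin 2) (τ₁ τ₂ : ℝ) (a b : Fin 3) :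
    (fun z => X.rem P a b (Fin.cons z.1 z.2)) =O[farSlab τ₁ τ₂] (fun z => z.1⁻¹ ^ 3) ∧
    (∀ i, (fun z => pd i (X.rem P a b) (Fin.cons z.1 z.2)) =O[farSlab τ₁ τ₂]
      (fun z => z.1⁻¹ ^ (3 + weight i))) ∧
    (∀ i j, (fun z => pd i (pd j (X.rem P a b)) (Fin.cons z.1 z.2)) =O[farSlab τ₁ τ₂]
      (fun z => z.1⁻¹ ^ (3 + weight i + weight j))) := by
  obtain ⟨C, R, hR, h⟩ := X.expansion τ₁ τ₂
  have key : ∀ (f : (Fin 4 → ℝ) → ℝ) (n : ℕ), (∀ ρ > R, ∀ u ∈ slab τ₁ τ₂,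
      |f (Fin.cons ρ u)| ≤ C / ρ ^ n) →
      (fun z : ℝ × (Fin 3 → ℝ) => f (Fin.cons z.1 z.2)) =O[farSlab τ₁ τ₂] (fun z => z.1⁻¹ ^ n) :=
    fun f n hf => IsBigO.of_bound C (eventually_farSlab.2 ⟨R, hR, fun ρ hρ u hu => by
      have hp : 0 < ρ := hR.trans hρ
      rw [Real.norm_eq_abs, Real.norm_of_nonneg (by positivity), inv_pow, ← div_eq_mul_inv]
      exact hf ρ hρ u hu⟩)
  exact ⟨key _ _ fun ρ hρ u hu => (h P ρ hρ u hu a b).1,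
    fun i => key _ _ fun ρ hρ u hu => (h P ρ hρ u hu a b).2.1 i,
    fun i j => key _ _ fun ρ hρ u hu => (h P ρ hρ u hu a b).2.2 i j⟩

theorem continuousOn_of_patch {f : (Fin 3 → ℝ) → ℝ} (hf : ∀ u ∈ patch, ContDiffAt ℝ ∞ f u) :
    ContinuousOn f (slab τ₁ τ₂) := fun u hu =>
  (hf u (slab_subset_patch _ _ hu)).continuousAt.continuousWithinAt

theorem isBigO_one_of_patch {f : (Fin 3 → ℝ) → ℝ} (hf : ∀ u ∈ patch, ContDiffAt ℝ ∞ f u) :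
    (fun z => f z.2) =O[farSlab τ₁ τ₂] (fun _ => (1 : ℝ)) :=
  isBigO_one_of_continuousOn (continuousOn_of_patch hf)

open scoped Matrix.Norms.Operator

theorem mat_isBigO_one_of_patch {M : (Fin 3 → ℝ) → Mat}
    (hf : ∀ u ∈ patch, ∀ a b, ContDiffAt ℝ ∞ (fun v => M v a b) u) :
    (fun z => M z.2) =O[farSlab τ₁ τ₂] (fun _ => (1 : ℝ)) :=
  isBigO_of_entries fun a b => isBigO_one_of_patch (f := fun v => M v a b) fun u hu => hf u hu a b

theorem dS_isBigO : (fun z => dS z.2) =O[farSlab τ₁ τ₂] (fun _ => (1 : ℝ)) :=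
  mat_isBigO_one_of_patch fun _ _ a b => (contDiff_dS a b).contDiffAt

theorem dS_inv_isBigO : (fun z => (dS z.2)⁻¹) =O[farSlab τ₁ τ₂] (fun _ => (1 : ℝ)) :=
  mat_isBigO_one_of_patch fun u _ a b => contDiffAt_inv_entry
    (fun a b => (contDiff_dS a b).contDiffAt)
    (by rw [dS_det]; exact neg_ne_zero.2 (pow_ne_zero 2 (dSFactor_pos u).ne')) a b

theorem h₁_isBigO : (fun z => X.h₁ P z.2) =O[farSlab τ₁ τ₂] (fun _ => (1 : ℝ)) :=
  mat_isBigO_one_of_patch fun _ hu => X.contDiffAt_h₁ hu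

theorem inv_pow_isBigO {m n : ℕ} (h : n ≤ m) :
    (fun z : ℝ × (Fin 3 → ℝ) => z.1⁻¹ ^ m) =O[farSlab τ₁ τ₂] fun z => z.1⁻¹ ^ n := by
  obtain ⟨k, rfl⟩ := Nat.exists_eq_add_of_le h
  have := (isBigO_refl (fun z : ℝ × (Fin 3 → ℝ) => z.1⁻¹ ^ n) (farSlab τ₁ τ₂)).mul
    ((inv_isBigO_one (tendsto_radius τ₁ τ₂)).pow k)
  simpa [pow_add] using this

theorem eventually_ne (τ₁ τ₂ : ℝ) : ∀ᶠ z in farSlab τ₁ τ₂, z.1 ≠ 0 :=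
  (tendsto_radius τ₁ τ₂).eventually_ne_atTop 0

variable (P τ₁ τ₂)

/-- The expansion of `ρ⁻² h`. -/
theorem jet_metric : Jet (farSlab τ₁ τ₂) (fun z => z.1) (fun z => (z.1⁻¹ ^ 2) • X.h P z.1 z.2)
    (fun z => dS z.2) (fun z => X.h₁ P z.2) := by
  refine ⟨dS_isBigO, X.h₁_isBigO, isBigO_of_entries fun a b => ?_⟩
  have h2 : (fun z => z.1⁻¹ ^ 2 * X.h₂ P z.2 a b) =O[farSlab τ₁ τ₂]
      (fun z => z.1⁻¹ ^ 2 * 1) := (isBigO_refl _ _).mul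
    (isBigO_one_of_patch (f := fun v => X.h₂ P v a b) fun u hu => X.h₂_smooth P u hu a b)
  simp only [mul_one] at h2
  refine (h2.add ((X.rem_isBigO P τ₁ τ₂ a b).1.trans (inv_pow_isBigO (by norm_num)))).congr' ?_ .rfl
  filter_upwards [eventually_ne τ₁ τ₂] with z hz
  have := X.h_eq_expansion (P := P) (y := Fin.cons z.1 z.2) (by simpa using hz) a b
  simp only [Fin.cons_zero, Fin.tail_cons] at this
  simp only [Matrix.sub_apply, Matrix.smul_apply, smul_eq_mul, this]
  field_simp
  ring

theorem eventually_smooth : ∀ᶠ z in farSlab τ₁ τ₂, z.1 ≠ 0 ∧ z.2 ∈ patch ∧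
    ∀ a b, ContDiffAt ℝ ∞ (X.rem P a b) (Fin.cons z.1 z.2) := by
  filter_upwards [eventually_ne τ₁ τ₂, eventually_mem_slab τ₁ τ₂,
    X.eventually_contDiffAt_h P τ₁ τ₂] with z hz hs hc
  exact ⟨hz, hs.2.2, fun a b => X.contDiffAt_rem (by simpa using hz)
    (by simpa using slab_subset_patch _ _ hs) a b (hc.2 a b)⟩

theorem pow_mul_isBigO {f : ℝ × (Fin 3 → ℝ) → ℝ} {m n : ℕ} (k : ℕ)
    (h : f =O[farSlab τ₁ τ₂] fun z => z.1⁻¹ ^ m) (hmn : n + k ≤ m) :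
    (fun z => z.1 ^ k * f z) =O[farSlab τ₁ τ₂] fun z => z.1⁻¹ ^ n := by
  have := (isBigO_refl (fun z : ℝ × (Fin 3 → ℝ) => z.1 ^ k) (farSlab τ₁ τ₂)).mul
    (h.trans (inv_pow_isBigO hmn))
  refine this.congr' .rfl ?_
  filter_upwards [eventually_ne τ₁ τ₂] with z hz
  rw [pow_add, mul_left_comm, ← mul_pow, mul_inv_cancel₀ hz, one_pow, mul_one]

/-- The expansion of `ρ⁻¹ ∂_ρ h`. -/
theorem jet_radial : Jet (farSlab τ₁ τ₂) (fun z => z.1)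
    (fun z => z.1⁻¹ • radial (X.h P) (Fin.cons z.1 z.2))
    (fun z => (2 : ℝ) • dS z.2) (fun z => X.h₁ P z.2) := by
  refine ⟨dS_isBigO.const_smul_left (2 : ℝ), X.h₁_isBigO, isBigO_of_entries fun a b => ?_⟩
  obtain ⟨r0, r1, -⟩ := X.rem_isBigO P τ₁ τ₂ a b
  have e1 := (r0.trans (inv_pow_isBigO (n := 2) (by norm_num))).const_mul_left 2
  have e2 := pow_mul_isBigO τ₁ τ₂ (n := 2) 1 (r1 0) (by simp [weight])
  refine (e1.add e2).congr' ?_ .rfl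
  filter_upwards [X.eventually_smooth P τ₁ τ₂] with z ⟨hz, hp, hr⟩
  have hz' : (Fin.cons z.1 z.2 : Fin 4 → ℝ) 0 ≠ 0 := by simpa using hz
  have hp' : Fin.tail (Fin.cons z.1 z.2 : Fin 4 → ℝ) ∈ patch := by simpa using hp
  have := pd_zero_expansion ((contDiff_dS (k := 1) a b).differentiable (by norm_num) _)
    ((X.contDiffAt_h₁ hp' a b).differentiableAt (by simp))
    ((X.h₂_smooth P _ hp' a b).differentiableAt (by simp)) ((hr a b).differentiableAt (by simp))
    (X.h_eventuallyEq_expansion hz' a b)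
  simp only [Fin.cons_zero, Fin.tail_cons] at this
  simp only [Matrix.sub_apply, Matrix.smul_apply, smul_eq_mul, radial, Matrix.of_apply, this]
  field_simp
  ring

/-- The expansion of `∂_ρ² h`. -/
theorem jet_radial₂ : Jet (farSlab τ₁ τ₂) (fun z => z.1)
    (fun z => radial₂ (X.h P) (Fin.cons z.1 z.2)) (fun z => (2 : ℝ) • dS z.2) 0 := by
  -- There is no term of order `1/ρ`, because `ρ h⁽¹⁾` is linear in `ρ`.
  refine ⟨dS_isBigO.const_smul_left (2 : ℝ), isBigO_zero _ _, isBigO_of_entries fun a b => ?_⟩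
  obtain ⟨r0, r1, r2⟩ := X.rem_isBigO P τ₁ τ₂ a b
  have e1 := (r0.trans (inv_pow_isBigO (n := 2) (by norm_num))).const_mul_left 2
  have e2 := (pow_mul_isBigO τ₁ τ₂ (n := 2) 1 (r1 0) (by simp [weight])).const_mul_left 4
  -- The gain of powers under `∂_ρ` matters here: without it, `ρ² ∂_ρ² E` would only be `O(ρ⁻¹)`.
  have e3 := pow_mul_isBigO τ₁ τ₂ (n := 2) 2 (r2 0 0) (by simp [weight])
  refine ((e1.add e2).add e3).congr' ?_ .rfl
  filter_upwards [X.eventually_smooth P τ₁ τ₂] with z ⟨hz, hp, hr⟩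
  have hz' : (Fin.cons z.1 z.2 : Fin 4 → ℝ) 0 ≠ 0 := by simpa using hz
  have hp' : Fin.tail (Fin.cons z.1 z.2 : Fin 4 → ℝ) ∈ patch := by simpa using hp
  have := pd_zero_pd_zero_expansion (contDiff_dS a b).contDiffAt
    ((X.contDiffAt_h₁ hp' a b).of_le (by simp)) ((X.h₂_smooth P _ hp' a b).of_le (by simp))
    ((hr a b).of_le ENat.LEInfty.out) (X.h_eventuallyEq_expansion hz' a b)
  simp only [Fin.cons_zero, Fin.tail_cons] at this
  simp only [Matrix.sub_apply, Matrix.smul_apply, smul_eq_mul, radial₂, Matrix.of_apply, this,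
    Pi.zero_apply, Matrix.zero_apply]
  ring

/-- The leading order of the tangential derivatives of `ρ⁻² h`. -/
theorem tangential_isBigO (a b c : Fin 3) :
    (fun z => z.1⁻¹ ^ 2 * pd c (fun u => X.h P z.1 u a b) z.2 - pd c (fun u => dS u a b) z.2)
      =O[farSlab τ₁ τ₂] fun z => z.1⁻¹ := by
  have e1 : (fun z => z.1⁻¹ * pd c (fun v => X.h₁ P v a b) z.2) =O[farSlab τ₁ τ₂]
      (fun z => z.1⁻¹ * 1) := (isBigO_refl _ _).mul
    (isBigO_one_of_patch (f := pd c fun v => X.h₁ P v a b) fun u hu =>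
      (X.contDiffAt_h₁ hu a b).pd (by simp))
  have e2 : (fun z => z.1⁻¹ ^ 2 * pd c (fun v => X.h₂ P v a b) z.2) =O[farSlab τ₁ τ₂]
      (fun z => z.1⁻¹ ^ 2 * 1) := (isBigO_refl _ _).mul
    (isBigO_one_of_patch (f := pd c fun v => X.h₂ P v a b) fun u hu =>
      (X.h₂_smooth P u hu a b).pd (by simp))
  simp only [mul_one] at e1 e2
  have e3 := ((X.rem_isBigO P τ₁ τ₂ a b).2.1 c.succ).trans
    (inv_pow_isBigO (n := 1) (by omega))
  simp only [pow_one] at e3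
  refine ((e1.add (e2.trans (inv_sq_isBigO_inv (tendsto_radius τ₁ τ₂)))).add e3).congr' ?_ .rfl
  filter_upwards [X.eventually_smooth P τ₁ τ₂, X.eventually_contDiffAt_h P τ₁ τ₂]
    with z ⟨hz, hp, hr⟩ hh
  have hz' : (Fin.cons z.1 z.2 : Fin 4 → ℝ) 0 ≠ 0 := by simpa using hz
  have hp' : Fin.tail (Fin.cons z.1 z.2 : Fin 4 → ℝ) ∈ patch := by simpa using hp
  have := pd_succ_expansion ((contDiff_dS (k := 1) a b).differentiable (by norm_num) _)
    ((X.contDiffAt_h₁ hp' a b).differentiableAt (by simp))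
    ((X.h₂_smooth P _ hp' a b).differentiableAt (by simp)) ((hr a b).differentiableAt (by simp))
    (X.h_eventuallyEq_expansion hz' a b) c
  rw [pd_succ ((hh.2 a b).differentiableAt (by simp))] at this
  simp only [Fin.cons_zero, Fin.tail_cons] at this
  rw [this]
  field_simp
  ring

end Configuration

end

end MannMarolf

namespace MannMarolf

noncomputable section

/-! ### Symmetry, nondegeneracy and regularity at large radius. -/

section SymmetricHessian

theorem christoffel_symm {n : ℕ} {g : Tensor2 n} {u : Fin n → ℝ}
    (hd : ∀ c a b, pd c (fun u => g u a b) u = pd c (fun u => g u b a) u) (c a b : Fin n) :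
    christoffel g c a b u = christoffel g c b a u := by
  simp only [christoffel]
  congr 1
  refine Finset.sum_congr rfl fun d _ => ?_
  rw [hd d a b]; ring

theorem hess_symm {n : ℕ} {g : Tensor2 n} {f : (Fin n → ℝ) → ℝ} {u : Fin n → ℝ}
    (hf : ContDiffAt ℝ 2 f u)
    (hd : ∀ c a b, pd c (fun u => g u a b) u = pd c (fun u => g u b a) u) :
    (hess g f u).IsSymm := by
  ext a b
  simp only [Matrix.transpose_apply, hess, Matrix.of_apply]
  rw [pd_comm hf]
  exact congrArg _ (Finset.sum_congr rfl fun c _ => by rw [christoffel_symm hd])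

end SymmetricHessian

open scoped Matrix.Norms.Operator

/-- `A B₀` differs from `1` by a term of norm below one, so the Neumann series inverts it. Applied
to `ρ⁻² h`, this gives nondegeneracy of `h` at large radius. -/
theorem Jet.eventually_isUnit {α E : Type*} [NormedRing E] [NormedAlgebra ℝ E] [CompleteSpace E]
    {l : Filter α} {r : α → ℝ} {A A₀ A₁ B₀ : α → E} (h : Jet l r A A₀ A₁) (hr : Tendsto r l atTop)
    (hB₀ : B₀ =O[l] (fun _ => (1 : ℝ))) (h₀ : ∀ᶠ z in l, A₀ z * B₀ z = 1) :
    ∀ᶠ z in l, IsUnit (A z * B₀ z) := by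
  have t : Tendsto (fun z => (A₀ z - A z) * B₀ z) l (𝓝 0) := by
    have := ((h.sub_isBigO hr).mul hB₀).trans_tendsto
      ((hr.inv_tendsto_atTop).congr fun z => by simp)
    simpa [sub_mul] using this.neg
  filter_upwards [(tendsto_zero_iff_norm_tendsto_zero.1 t).eventually
    (gt_mem_nhds (show (0 : ℝ) < 1 by norm_num)), h₀] with z hz h0
  have : A z * B₀ z = 1 - (A₀ z - A z) * B₀ z := by rw [sub_mul, h0]; abel
  rw [this]
  exact isUnit_one_sub_of_norm_lt_one hz

namespace Configuration

variable (X : Configuration) (P : Fin 2) (τ₁ τ₂ : ℝ)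

/-- The properties of the configuration at a point that hold for large `ρ`. -/
structure Good (z : ℝ × (Fin 3 → ℝ)) : Prop where
  pos : 0 < z.1
  mem : z.2 ∈ patch
  reg : Regular (X.σ P) (X.h P) (Fin.cons z.1 z.2)
  smooth : ∀ a b, ContDiffAt ℝ ∞ (fun x : Fin 4 → ℝ => X.h P (x 0) (Fin.tail x) a b)
    (Fin.cons z.1 z.2)
  symm : (X.h P z.1 z.2).IsSymm
  radial_symm : (radial (X.h P) (Fin.cons z.1 z.2)).IsSymm
  radial₂_symm : (radial₂ (X.h P) (Fin.cons z.1 z.2)).IsSymm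
  tangential_symm : ∀ c a b, pd c (fun u => X.h P z.1 u a b) z.2 =
    pd c (fun u => X.h P z.1 u b a) z.2
  flat : ∀ i j, ricci (metric4 (X.σ P) (X.h P)) i j (Fin.cons z.1 z.2) = 0

theorem slab_subset_slab (τ₁ τ₂ : ℝ) : slab τ₁ τ₂ ⊆ slab (τ₁ - 1) (τ₂ + 1) :=
  fun _ hu => ⟨by linarith [hu.1], by linarith [hu.2.1], hu.2.2⟩

theorem diff_slice {z : ℝ × (Fin 3 → ℝ)} {F : (Fin 4 → ℝ) → ℝ}
    (h : DifferentiableAt ℝ F (Fin.cons z.1 z.2)) :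
    DifferentiableAt ℝ (fun u => F (Fin.cons z.1 u)) z.2 :=
  DifferentiableAt.comp (g := F) z.2 h (hasFDerivAt_cons z.1 z.2).differentiableAt

/-- Symmetry is known only on the closed slab, so its derivatives at the edge come from
`pd_eq_zero_of_eqOn_slab`. Enlarging the time interval by one unit at each end gives the slab an
interior even when `τ₁ = τ₂`. -/
theorem eventually_tangential_symm : ∀ᶠ z in farSlab τ₁ τ₂, ∀ c a b,
    pd c (fun u => X.h P z.1 u a b) z.2 = pd c (fun u => X.h P z.1 u b a) z.2 := by
  obtain ⟨R, hR, h⟩ := X.h_smooth (τ₁ - 1) (τ₂ + 1)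
  refine eventually_farSlab.2 ⟨R, hR, fun ρ hρ u hu c a b => ?_⟩
  have hu' := slab_subset_slab _ _ hu
  have hd : ∀ a b, DifferentiableAt ℝ (fun v => X.h P ρ v a b) u := fun a b =>
    diff_slice (z := (ρ, u)) (((h P ρ hρ u hu').2 a b).differentiableAt (by simp))
  have := pd_eq_zero_of_eqOn_slab (by linarith [hu.1, hu.2.1]) hu' ((hd a b).fun_sub (hd b a))
    (fun v hv => sub_eq_zero.2 ((h P ρ hρ v hv).1.apply b a)) c
  rwa [pd_sub (hd a b) (hd b a), sub_eq_zero] at this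

theorem radial_eq_deriv {z : ℝ × (Fin 3 → ℝ)} {a b : Fin 3} (h : DifferentiableAt ℝ
    (fun x : Fin 4 → ℝ => X.h P (x 0) (Fin.tail x) a b) (Fin.cons z.1 z.2)) :
    HasDerivAt (fun r => X.h P r z.2 a b) (radial (X.h P) (Fin.cons z.1 z.2) a b) z.1 := by
  have := hasDerivAt_radial h
  simp only [Fin.cons_zero, Fin.tail_cons] at this
  exact this

/-- Symmetry holds for all `ρ > R`, an open set of radii, and can therefore be differentiated twice
in `ρ` directly. -/
theorem eventually_radial_symm : ∀ᶠ z in farSlab τ₁ τ₂,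
    (radial (X.h P) (Fin.cons z.1 z.2)).IsSymm ∧ (radial₂ (X.h P) (Fin.cons z.1 z.2)).IsSymm := by
  obtain ⟨R, hR, h⟩ := X.h_smooth τ₁ τ₂
  have h1 : ∀ ρ > R, ∀ u ∈ slab τ₁ τ₂, (radial (X.h P) (Fin.cons ρ u)).IsSymm := by
    intro ρ hρ u hu
    ext a b
    have hd := fun a b => X.radial_eq_deriv P (z := (ρ, u)) (a := a) (b := b)
      (((h P ρ hρ u hu).2 a b).differentiableAt (by simp))
    refine (hd b a).unique ((hd a b).congr_of_eventuallyEq ?_)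
    filter_upwards [lt_mem_nhds hρ] with r hr using (h P r hr u hu).1.apply a b
  refine eventually_farSlab.2 ⟨R, hR, fun ρ hρ u hu => ⟨h1 ρ hρ u hu, ?_⟩⟩
  ext a b
  have hd : ∀ a b, HasDerivAt (fun r => radial (X.h P) (Fin.cons r u) a b)
      (radial₂ (X.h P) (Fin.cons ρ u) a b) ρ := fun a b =>
    hasDerivAt_radial (F := fun x => radial (X.h P) x a b)
      ((((h P ρ hρ u hu).2 a b).pd (k := 1) (by norm_cast)).differentiableAt (by norm_num))
  refine (hd b a).unique ((hd a b).congr_of_eventuallyEq ?_)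
  filter_upwards [lt_mem_nhds hρ] with r hr using (h1 r hr u hu).apply a b

theorem jet_lapse : Jet (farSlab τ₁ τ₂) (fun z => z.1)
    (fun z => lapse (X.σ P) (Fin.cons z.1 z.2)) (fun _ => 1) (fun z => X.σ P z.2) := by
  have h1 : Jet (farSlab τ₁ τ₂) (fun z => z.1) (fun _ => (1 : ℝ)) (fun _ => 1) 0 :=
    Jet.const (isBigO_refl _ _)
  have h2 := h1.add (Jet.inv_smul (l := farSlab τ₁ τ₂) (r := fun z => z.1)
    (M₁ := fun z => X.σ P z.2) (isBigO_one_of_patch fun u _ => (X.σ_smooth P).contDiffAt))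
  refine h2.congr (.of_eq ?_) (.of_eq ?_) (.of_eq ?_) <;> funext z <;> simp [lapse]
  field_simp

theorem eventually_dS_mul_inv (τ₁ τ₂ : ℝ) :
    ∀ᶠ z in farSlab τ₁ τ₂, dS z.2 * (dS z.2)⁻¹ = 1 :=
  .of_forall fun z => by rw [dS_inv, dS_mul_inv]

theorem eventually_good : ∀ᶠ z in farSlab τ₁ τ₂, X.Good P z := by
  have hr := tendsto_radius τ₁ τ₂
  have hN : ∀ᶠ z in farSlab τ₁ τ₂, lapse (X.σ P) (Fin.cons z.1 z.2) ≠ 0 := by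
    have := ((X.jet_lapse P τ₁ τ₂).tendsto_sub hr).add_const 1
    simp only [sub_add_cancel, zero_add] at this
    exact this.eventually_ne one_ne_zero
  obtain ⟨R, hR, hflat⟩ := X.ricci_flat τ₁ τ₂
  filter_upwards [hN, hr.eventually_gt_atTop 0, X.eventually_smooth P τ₁ τ₂,
    X.eventually_contDiffAt_h P τ₁ τ₂, X.eventually_tangential_symm P τ₁ τ₂,
    X.eventually_radial_symm P τ₁ τ₂, eventually_farSlab (p := fun z => ∀ i j, ricci (metric4 (X.σ P) (X.h P)) i j
      (Fin.cons z.1 z.2) = 0) |>.2 ⟨R, hR, hflat P⟩,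
    (X.jet_metric P τ₁ τ₂).eventually_isUnit hr dS_inv_isBigO (eventually_dS_mul_inv _ _)]
    with z h1 h0 h2 h3 h4 h5 h6 h7
  refine ⟨h0, h2.2.1, ⟨by simpa using h2.1, h1, ?_, (X.σ_smooth P).contDiffAt.of_le ENat.LEInfty.out,
    fun a b => (h3.2 a b).of_le ENat.LEInfty.out⟩, h3.2, h3.1, h5.1, h5.2, h4, h6⟩
  simp only [Fin.cons_zero, Fin.tail_cons]
  intro hdet
  have := (Matrix.isUnit_iff_isUnit_det _).1 h7
  rw [Matrix.det_mul, Matrix.det_smul, hdet] at this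
  simp at this

end Configuration

end

end MannMarolf

/-! ### The vacuum equations for the mixed tensors. -/

namespace MannMarolf

noncomputable section

open scoped Matrix.Norms.Operator

namespace Configuration

variable (X : Configuration) (P : Fin 2) (τ₁ τ₂ : ℝ)

/-- The Ricci tensor of `h` as a matrix. -/
def ric (z : ℝ × (Fin 3 → ℝ)) : Mat := Matrix.of fun a b => ricci (X.h P z.1) a b z.2

/-- `ρ⁻² h`. -/
def unitMetric (z : ℝ × (Fin 3 → ℝ)) : Mat := (z.1⁻¹ ^ 2) • X.h P z.1 z.2

/-- `ρ² h^{ac} R_{cb}`. -/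
def mixedRicci (z : ℝ × (Fin 3 → ℝ)) : Mat := (X.unitMetric P z)⁻¹ * X.ric P z

/-- `ρ h^{ac} K_{cb}`. -/
def mixedExtrinsic (z : ℝ × (Fin 3 → ℝ)) : Mat :=
  ((lapse (X.σ P) (Fin.cons z.1 z.2))⁻¹ * z.1) • weingarten (X.h P) (Fin.cons z.1 z.2)

theorem inv_mul_radial (z : ℝ × (Fin 3 → ℝ)) :
    (X.h P z.1 z.2)⁻¹ * radial (X.h P) (Fin.cons z.1 z.2) =
    (2 : ℝ) • weingarten (X.h P) (Fin.cons z.1 z.2) := by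
  simp [weingarten, smul_smul]

namespace Good

variable {X P} {z : ℝ × (Fin 3 → ℝ)}

theorem det_ne (G : X.Good P z) : (X.h P z.1 z.2).det ≠ 0 := by
  simpa using G.reg.det_ne

theorem mul_inv (G : X.Good P z) : X.h P z.1 z.2 * (X.h P z.1 z.2)⁻¹ = 1 :=
  Matrix.mul_nonsing_inv _ (isUnit_iff_ne_zero.2 G.det_ne)

theorem inv_mul (G : X.Good P z) : (X.h P z.1 z.2)⁻¹ * X.h P z.1 z.2 = 1 :=
  Matrix.nonsing_inv_mul _ (isUnit_iff_ne_zero.2 G.det_ne)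

theorem inv_unitMetric (G : X.Good P z) :
    (X.unitMetric P z)⁻¹ = z.1 ^ 2 • (X.h P z.1 z.2)⁻¹ := by
  have := G.pos.ne'
  refine Matrix.inv_eq_right_inv ?_
  rw [unitMetric, smul_mul_smul_comm, G.mul_inv, ← mul_pow, inv_mul_cancel₀ this, one_pow, one_smul]

theorem inv_unitMetric_mul (G : X.Good P z) : (X.unitMetric P z)⁻¹ * X.unitMetric P z = 1 := by
  have := G.pos.ne'
  rw [G.inv_unitMetric, unitMetric, smul_mul_smul_comm, G.inv_mul, ← mul_pow, mul_inv_cancel₀ this,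
    one_pow, one_smul]

theorem hess_symm (G : X.Good P z) : (hess (X.h P z.1) (X.σ P) z.2).IsSymm :=
  MannMarolf.hess_symm ((X.σ_smooth P).contDiffAt.of_le ENat.LEInfty.out) G.tangential_symm

theorem radial_mul_weingarten_symm (G : X.Good P z) :
    (radial (X.h P) (Fin.cons z.1 z.2) * weingarten (X.h P) (Fin.cons z.1 z.2)).IsSymm := by
  simp only [weingarten, Matrix.IsSymm, Matrix.mul_smul, Matrix.transpose_smul,
    Matrix.transpose_mul, G.radial_symm.eq, Matrix.transpose_nonsing_inv, Fin.cons_zero,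
    Fin.tail_cons, G.symm.eq, Matrix.mul_assoc]

/-- The tangential vacuum equations solved for the Ricci tensor of `h`. Only first derivatives of
`h` along the hyperboloid remain on the right, through the Hessian of `σ`. -/
theorem ric_eq (G : X.Good P z) :
    X.ric P z = ((lapse (X.σ P) (Fin.cons z.1 z.2))⁻¹ ^ 2) •
      ((1 / 2 : ℝ) • radial₂ (X.h P) (Fin.cons z.1 z.2) +
        (1 / 2 * (X.σ P z.2 * z.1⁻¹ ^ 2 * (lapse (X.σ P) (Fin.cons z.1 z.2))⁻¹)) •
          radial (X.h P) (Fin.cons z.1 z.2) +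
        (1 / 2 * (weingarten (X.h P) (Fin.cons z.1 z.2)).trace) •
          radial (X.h P) (Fin.cons z.1 z.2) -
        radial (X.h P) (Fin.cons z.1 z.2) * weingarten (X.h P) (Fin.cons z.1 z.2)) +
      ((lapse (X.σ P) (Fin.cons z.1 z.2))⁻¹ * z.1⁻¹) • hess (X.h P z.1) (X.σ P) z.2 := by
  ext a b
  have h1 := G.reg.ricci_succ_succ a b
  have hs := G.radial_mul_weingarten_symm.apply a b
  have hσ : ContDiffAt ℝ 2 (X.σ P) z.2 := (X.σ_smooth P).contDiffAt.of_le ENat.LEInfty.out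
  rw [G.flat, hs] at h1
  simp only [G.reg.pd_zero_lapse, G.reg.pd_succ_lapse, G.reg.pd_succ_pd_succ_lapse, Fin.cons_zero,
    Fin.tail_cons] at h1
  rw [pd_comm hσ] at h1
  have hN := G.reg.lapse_ne
  have hz := G.pos.ne'
  have e : ∑ c, christoffel (X.h P z.1) c a b z.2 * (pd c (X.σ P) z.2 / z.1) =
      (∑ c, christoffel (X.h P z.1) c a b z.2 * pd c (X.σ P) z.2) * z.1⁻¹ := by
    rw [Finset.sum_mul]; exact Finset.sum_congr rfl fun c _ => by ring
  rw [e] at h1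
  simp only [ric, Matrix.of_apply, Matrix.add_apply, Matrix.sub_apply, Matrix.smul_apply,
    smul_eq_mul, hess]
  linear_combination -h1

theorem ric_symm (G : X.Good P z) : (X.ric P z).IsSymm := by
  rw [G.ric_eq]
  simp only [Matrix.IsSymm, Matrix.transpose_add, Matrix.transpose_sub, Matrix.transpose_smul,
    G.radial_symm.eq, G.radial₂_symm.eq, G.hess_symm.eq, G.radial_mul_weingarten_symm.eq]

/-- Powers of `ρ` are distributed so that every factor, such as `ρ⁻² h`, `ρ` times the Weingarten
map and `ρ⁻¹` times the Hessian, has a first-order expansion. -/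
theorem mixedRicci_eq (G : X.Good P z) : X.mixedRicci P z =
    ((lapse (X.σ P) (Fin.cons z.1 z.2))⁻¹ * (lapse (X.σ P) (Fin.cons z.1 z.2))⁻¹) •
      ((1 / 2 : ℝ) • ((X.unitMetric P z)⁻¹ * radial₂ (X.h P) (Fin.cons z.1 z.2)) +
        (z.1⁻¹ • X.σ P z.2) • ((lapse (X.σ P) (Fin.cons z.1 z.2))⁻¹ •
          (z.1 • weingarten (X.h P) (Fin.cons z.1 z.2))) +
        (z.1 • weingarten (X.h P) (Fin.cons z.1 z.2)).trace •
          (z.1 • weingarten (X.h P) (Fin.cons z.1 z.2)) -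
        (2 : ℝ) • ((z.1 • weingarten (X.h P) (Fin.cons z.1 z.2)) *
          (z.1 • weingarten (X.h P) (Fin.cons z.1 z.2)))) +
      (lapse (X.σ P) (Fin.cons z.1 z.2))⁻¹ •
        ((X.unitMetric P z)⁻¹ * (z.1⁻¹ • hess (X.h P z.1) (X.σ P) z.2)) := by
  have hz := G.pos.ne'
  rw [mixedRicci, G.ric_eq, G.inv_unitMetric]
  simp only [Matrix.mul_add, Matrix.mul_sub, Matrix.mul_smul, Matrix.smul_mul, X.inv_mul_radial P z,
    ← Matrix.mul_assoc, smul_add, smul_sub, smul_smul, Matrix.trace_smul, smul_eq_mul]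
  congr 1
  · congr 1
    · congr 1
      · congr 1
        · congr 1; ring
        · congr 1; field_simp
      · congr 1; ring
    · congr 1; ring
  · congr 1; ring

/-- The radial constraint: in vacuum the normal component of the Einstein tensor vanishes, so the
scalar curvature of `h` is `K² - K_{ab} K^{ab}`. -/
theorem mixedRicci_trace (G : X.Good P z) : (X.mixedRicci P z).trace =
    (X.mixedExtrinsic P z).trace ^ 2 - (X.mixedExtrinsic P z * X.mixedExtrinsic P z).trace := by
  have h1 := G.reg.ricci_zero_zero (by simpa using G.symm) (by simpa using G.tangential_symm)
  rw [G.flat] at h1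
  simp only [G.reg.pd_zero_lapse, G.reg.pd_succ_lapse, G.reg.pd_succ_pd_succ_lapse, Fin.cons_zero,
    Fin.tail_cons] at h1
  have hN := G.reg.lapse_ne
  have hz := G.pos.ne'
  have e : ∑ c, ∑ d, (X.h P z.1 z.2)⁻¹ c d * (pd c (pd d (X.σ P)) z.2 / z.1 -
      ∑ e, christoffel (X.h P z.1) e c d z.2 * (pd e (X.σ P) z.2 / z.1)) =
      ((X.h P z.1 z.2)⁻¹ * hess (X.h P z.1) (X.σ P) z.2).trace * z.1⁻¹ := by
    rw [Matrix.trace, Finset.sum_mul]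
    refine Finset.sum_congr rfl fun c _ => ?_
    rw [Matrix.diag_apply, Matrix.mul_apply, Finset.sum_mul]
    refine Finset.sum_congr rfl fun d _ => ?_
    rw [G.hess_symm.apply c d, hess, Matrix.of_apply, mul_assoc, sub_mul, Finset.sum_mul]
    simp only [div_eq_mul_inv, mul_assoc]
  rw [e] at h1
  rw [G.mixedRicci_eq, G.inv_unitMetric, mixedExtrinsic]
  simp only [Matrix.trace_add, Matrix.trace_sub, Matrix.trace_smul, Matrix.smul_mul,
    Matrix.mul_smul, smul_eq_mul]
  generalize lapse (X.σ P) (Fin.cons z.1 z.2) = N at *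
  -- The radial equation solved for the Laplacian of `σ`. Substituting it into the trace of the
  -- tangential equations eliminates both the Hessian and `∂_ρ² h`.
  have h2 : ((X.h P z.1 z.2)⁻¹ * hess (X.h P z.1) (X.σ P) z.2).trace = z.1 * N⁻¹ * (
      -(1 / 2 * ((X.h P z.1 z.2)⁻¹ * radial₂ (X.h P) (Fin.cons z.1 z.2)).trace) +
      (weingarten (X.h P) (Fin.cons z.1 z.2) * weingarten (X.h P) (Fin.cons z.1 z.2)).trace +
      (weingarten (X.h P) (Fin.cons z.1 z.2)).trace * (-X.σ P z.2 / z.1 ^ 2) / N) := by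
    field_simp at h1 ⊢
    linear_combination h1
  rw [h2]
  field_simp
  ring

end Good

end Configuration

end

end MannMarolf

/-! ### First-order coefficients of the mixed tensors. -/

namespace MannMarolf

noncomputable section

open scoped Matrix.Norms.Operator

theorem tr_eq_trace {n : ℕ} {g A : Matrix (Fin n) (Fin n) ℝ} (hA : A.IsSymm) :
    tr g A = (g⁻¹ * A).trace := by
  simp only [tr, Matrix.trace, Matrix.diag_apply, Matrix.mul_apply]
  exact Finset.sum_congr rfl fun a _ => Finset.sum_congr rfl fun b _ => by rw [hA.apply a b]

theorem contract_eq_trace {g A B : Mat} (hg : g.IsSymm) (hB : B.IsSymm) :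
    contract g A B = ((g⁻¹ * A) * (g⁻¹ * B)).trace := by
  have hg' : (g⁻¹).IsSymm := by rw [Matrix.IsSymm, Matrix.transpose_nonsing_inv, hg.eq]
  simp only [contract, Matrix.trace, Matrix.diag_apply, Matrix.mul_apply, Fin.sum_univ_three,
    hg'.apply 0 1, hg'.apply 0 2, hg'.apply 1 2, hB.apply 0 1, hB.apply 0 2, hB.apply 1 2]
  ring

section Smoothness

variable {n : ℕ} {g : Tensor2 n} {u : Fin n → ℝ}

theorem contDiffAt_christoffel {k : WithTop ℕ∞} (hg : ∀ a b, ContDiffAt ℝ (k + 1) (fun v => g v a b) u)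
    (h0 : (g u).det ≠ 0) (c a b : Fin n) : ContDiffAt ℝ k (christoffel g c a b) u := by
  have hi := fun c d => (contDiffAt_inv_entry hg h0 c d).of_le le_self_add
  have hp : ∀ i a b, ContDiffAt ℝ k (pd i fun v => g v a b) u := fun i a b => (hg a b).pd le_rfl
  exact contDiffAt_const.mul (ContDiffAt.sum fun d _ =>
    (hi c d).mul (((hp _ _ _).add (hp _ _ _)).sub (hp _ _ _)))

theorem continuousAt_ricci (hg : ∀ a b, ContDiffAt ℝ 2 (fun v => g v a b) u)
    (h0 : (g u).det ≠ 0) (a b : Fin n) : ContinuousAt (ricci g a b) u := by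
  have hΓ : ∀ c a b, ContDiffAt ℝ 1 (christoffel g c a b) u := fun c a b =>
    contDiffAt_christoffel (k := 1) hg h0 c a b
  have hc := fun c a b => (hΓ c a b).continuousAt
  have hp : ∀ i c a b, ContinuousAt (pd i (christoffel g c a b)) u := fun i c a b =>
    ((hΓ c a b).pd (k := 0) (by norm_num)).continuousAt
  unfold ricci
  exact (tendsto_finsetSum _ fun c _ => (hp _ _ _ _).sub (hp _ _ _ _)).add
    (tendsto_finsetSum _ fun c _ => tendsto_finsetSum _ fun d _ =>
      ((hc _ _ _).mul (hc _ _ _)).sub ((hc _ _ _).mul (hc _ _ _)))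

end Smoothness

theorem dS_det_ne (u : Fin 3 → ℝ) : (dS u).det ≠ 0 := by
  rw [dS_det]; exact neg_ne_zero.2 (pow_ne_zero 2 (dSFactor_pos u).ne')

theorem contDiff_christoffel_dS {k : WithTop ℕ∞} (c a b : Fin 3) :
    ContDiff ℝ k (christoffel dS c a b) :=
  contDiff_iff_contDiffAt.2 fun u =>
    contDiffAt_christoffel (fun a b => (contDiff_dS a b).contDiffAt) (dS_det_ne u) c a b

namespace Configuration

variable (X : Configuration) (P : Fin 2) (τ₁ τ₂ : ℝ)

/-- `k` with one index raised. -/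
def kMix (u : Fin 3 → ℝ) : Mat := (dS u)⁻¹ * X.k P u

/-- `D_a D_b σ` with one index raised. -/
def σMix (u : Fin 3 → ℝ) : Mat := (dS u)⁻¹ * hess dS (X.σ P) u

theorem kMix_trace {u : Fin 3 → ℝ} (hu : u ∈ patch) : (X.kMix P u).trace = 0 := by
  rw [kMix, ← tr_eq_trace (X.k_symm P u hu), X.k_trace P u hu]

theorem inv_mul_dS (u : Fin 3 → ℝ) : (dS u)⁻¹ * dS u = 1 :=
  Matrix.nonsing_inv_mul _ (isUnit_iff_ne_zero.2 (dS_det_ne u))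

theorem inv_mul_h₁ (u : Fin 3 → ℝ) :
    (dS u)⁻¹ * X.h₁ P u = (-2 * X.σ P u) • (1 : Mat) + X.kMix P u := by
  rw [h₁, Matrix.mul_add, Matrix.mul_smul, inv_mul_dS, kMix]

theorem jet_inv_unitMetric : Jet (farSlab τ₁ τ₂) (fun z => z.1) (fun z => (X.unitMetric P z)⁻¹)
    (fun z => (dS z.2)⁻¹) (fun z => -((dS z.2)⁻¹ * X.h₁ P z.2 * (dS z.2)⁻¹)) :=
  (X.jet_metric P τ₁ τ₂).inv (tendsto_radius _ _) dS_inv_isBigO (eventually_dS_mul_inv _ _)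
    ((X.eventually_good P τ₁ τ₂).mono fun _ G => G.inv_unitMetric_mul)

/-- The inverse metric contributes `-2 h⁽¹⁾` and `∂_ρ h` contributes `h⁽¹⁾`. Half their sum is `-½
h⁽¹⁾`, that is `σ h⁽⁰⁾ - ½ k`. -/
theorem jet_weingarten : Jet (farSlab τ₁ τ₂) (fun z => z.1)
    (fun z => z.1 • weingarten (X.h P) (Fin.cons z.1 z.2)) (fun _ => 1)
    (fun z => X.σ P z.2 • (1 : Mat) - (1 / 2 : ℝ) • X.kMix P z.2) := by
  refine (((X.jet_inv_unitMetric P τ₁ τ₂).mul (X.jet_radial P τ₁ τ₂)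
    (tendsto_radius _ _)).const_smul (1 / 2)).congr ?_ (.of_forall fun z => ?_)
    (.of_forall fun z => ?_)
  · filter_upwards [X.eventually_good P τ₁ τ₂] with z G
    have hz := G.pos.ne'
    rw [G.inv_unitMetric, weingarten, smul_mul_smul_comm, smul_smul, smul_smul]
    simp only [Fin.cons_zero, Fin.tail_cons]
    congr 1
    field_simp
  · simp only [Matrix.mul_smul, inv_mul_dS, smul_smul]
    norm_num
  · simp only [Matrix.mul_smul, Matrix.neg_mul, Matrix.mul_assoc, inv_mul_dS, Matrix.mul_one,
      inv_mul_h₁]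
    module

theorem jet_inv_lapse : Jet (farSlab τ₁ τ₂) (fun z => z.1)
    (fun z => (lapse (X.σ P) (Fin.cons z.1 z.2))⁻¹) (fun _ => 1) (fun z => -X.σ P z.2) := by
  refine ((X.jet_lapse P τ₁ τ₂).inv (B₀ := fun _ => 1) (tendsto_radius _ _) (isBigO_refl _ _)
    (.of_forall fun _ => one_mul 1) ?_).congr .rfl .rfl (.of_forall fun z => by simp)
  filter_upwards [X.eventually_good P τ₁ τ₂] with z G using inv_mul_cancel₀ G.reg.lapse_ne

/-- The factor `1 - σ/ρ` from the inverse lapse cancels the `σ` in the Weingarten map, leaving only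
the traceless `-½ k`. -/
theorem jet_mixedExtrinsic : Jet (farSlab τ₁ τ₂) (fun z => z.1) (X.mixedExtrinsic P) (fun _ => 1)
    (fun z => -(1 / 2 : ℝ) • X.kMix P z.2) := by
  refine ((X.jet_inv_lapse P τ₁ τ₂).smul (X.jet_weingarten P τ₁ τ₂) (tendsto_radius _ _)).congr
    (.of_forall fun z => ?_) (.of_forall fun z => ?_) (.of_forall fun z => ?_)
  · simp only [mixedExtrinsic, smul_smul]
  · simp
  · module

theorem sub_mul_isBigO {f f₀ g g₀ : ℝ × (Fin 3 → ℝ) → ℝ}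
    (hf : (fun z => f z - f₀ z) =O[farSlab τ₁ τ₂] fun z => z.1⁻¹)
    (hg : (fun z => g z - g₀ z) =O[farSlab τ₁ τ₂] fun z => z.1⁻¹)
    (hf₀ : f₀ =O[farSlab τ₁ τ₂] fun _ => (1 : ℝ)) (hg₀ : g₀ =O[farSlab τ₁ τ₂] fun _ => (1 : ℝ)) :
    (fun z => f z * g z - f₀ z * g₀ z) =O[farSlab τ₁ τ₂] fun z => z.1⁻¹ := by
  have hf1 : f =O[farSlab τ₁ τ₂] fun _ => (1 : ℝ) :=
    ((hf.trans (inv_isBigO_one (tendsto_radius _ _))).add hf₀).congr_left fun z => by ring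
  have e1 := hf1.mul hg
  have e2 := hf.mul hg₀
  simp only [one_mul, mul_one] at e1 e2
  exact (e1.add e2).congr_left fun z => by ring

/-- Christoffel symbols do not change when the metric is rescaled by a constant, so those of `h` and
of `ρ⁻² h` agree, and the latter tends to `h⁽⁰⁾` together with its first tangential derivatives. -/
theorem christoffel_isBigO (c a b : Fin 3) :
    (fun z => christoffel (X.h P z.1) c a b z.2 - christoffel dS c a b z.2) =O[farSlab τ₁ τ₂]
      fun z => z.1⁻¹ := by
  have hp : ∀ a b c, (fun z => pd c (fun u => dS u a b) z.2) =O[farSlab τ₁ τ₂]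
      fun _ => (1 : ℝ) := fun a b c => isBigO_one_of_patch (f := pd c fun v => dS v a b)
    fun u _ => (contDiff_dS (k := ∞) a b).contDiffAt.pd (by simp)
  have ht := X.tangential_isBigO P τ₁ τ₂
  have hi : ∀ c d, (fun z => (X.unitMetric P z)⁻¹ c d - (dS z.2)⁻¹ c d) =O[farSlab τ₁ τ₂]
      fun z => z.1⁻¹ := fun c d =>
    ((entryCLM c d).isBigO_comp _ _).trans
      ((X.jet_inv_unitMetric P τ₁ τ₂).sub_isBigO (tendsto_radius _ _))
  have hi₀ : ∀ c d, (fun z => (dS z.2)⁻¹ c d) =O[farSlab τ₁ τ₂] fun _ => (1 : ℝ) := fun c d =>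
    ((entryCLM c d).isBigO_comp _ _).trans dS_inv_isBigO
  have key : ∀ d, (fun z => (X.unitMetric P z)⁻¹ c d *
        (z.1⁻¹ ^ 2 * pd a (fun u => X.h P z.1 u d b) z.2 +
          z.1⁻¹ ^ 2 * pd b (fun u => X.h P z.1 u d a) z.2 -
          z.1⁻¹ ^ 2 * pd d (fun u => X.h P z.1 u a b) z.2) -
      (dS z.2)⁻¹ c d * (pd a (fun u => dS u d b) z.2 + pd b (fun u => dS u d a) z.2 -
        pd d (fun u => dS u a b) z.2)) =O[farSlab τ₁ τ₂] fun z => z.1⁻¹ := fun d =>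
    sub_mul_isBigO τ₁ τ₂ (hi c d)
      ((((ht d b a).add (ht d a b)).sub (ht a b d)).congr_left fun z => by ring) (hi₀ c d)
      (((hp d b a).add (hp d a b)).sub (hp a b d))
  refine ((IsBigO.fun_sum fun d (_ : d ∈ Finset.univ) => key d).const_mul_left (1 / 2)).congr' ?_ .rfl
  filter_upwards [X.eventually_good P τ₁ τ₂] with z G
  have hz := G.pos.ne'
  rw [Finset.sum_sub_distrib, mul_sub, christoffel, christoffel, G.inv_unitMetric]
  congr 2
  refine Finset.sum_congr rfl fun d _ => ?_
  rw [Matrix.smul_apply, smul_eq_mul]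
  field_simp

/-- The prefactor `1/ρ` means that the Hessian is needed to leading order only. -/
theorem jet_hess : Jet (farSlab τ₁ τ₂) (fun z => z.1)
    (fun z => z.1⁻¹ • hess (X.h P z.1) (X.σ P) z.2) 0 (fun z => hess dS (X.σ P) z.2) := by
  have hσ : ∀ c, (fun z => pd c (X.σ P) z.2) =O[farSlab τ₁ τ₂] fun _ => (1 : ℝ) := fun c =>
    isBigO_one_of_patch fun u _ => (X.σ_smooth P).contDiffAt.pd (by simp)
  have h0 : (fun z => hess (X.h P z.1) (X.σ P) z.2 - hess dS (X.σ P) z.2) =O[farSlab τ₁ τ₂]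
      fun z => z.1⁻¹ := isBigO_of_entries fun a b => by
    have key : ∀ c, (fun z => (christoffel (X.h P z.1) c a b z.2 - christoffel dS c a b z.2) *
        pd c (X.σ P) z.2) =O[farSlab τ₁ τ₂] fun z => z.1⁻¹ := fun c => by
      simpa using (X.christoffel_isBigO P τ₁ τ₂ c a b).mul (hσ c)
    refine (IsBigO.fun_sum fun c (_ : c ∈ Finset.univ) => key c).neg_left.congr_left fun z => ?_
    simp only [Matrix.sub_apply, hess, Matrix.of_apply, sub_mul, Finset.sum_sub_distrib]
    ring
  have h1 := (isBigO_refl (fun z : ℝ × (Fin 3 → ℝ) => z.1⁻¹) (farSlab τ₁ τ₂)).smul h0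
  refine ⟨isBigO_zero _ _, isBigO_of_entries fun a b => ?_, ?_⟩
  · have hΓ : ∀ c, (fun z => christoffel dS c a b z.2) =O[farSlab τ₁ τ₂] fun _ => (1 : ℝ) :=
      fun c => isBigO_one_of_continuousOn
        (contDiff_christoffel_dS (k := 0) c a b).continuous.continuousOn
    have h2 : (fun z => pd a (pd b (X.σ P)) z.2) =O[farSlab τ₁ τ₂] fun _ => (1 : ℝ) :=
      isBigO_one_of_patch (f := pd a (pd b (X.σ P))) fun u _ =>
        ((X.σ_smooth P).contDiffAt.pd (k := ∞) (by simp)).pd (by simp)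
    have h3 : ∀ c, (fun z => christoffel dS c a b z.2 * pd c (X.σ P) z.2) =O[farSlab τ₁ τ₂]
        fun _ => (1 : ℝ) := fun c => by simpa using (hΓ c).mul (hσ c)
    exact h2.sub (IsBigO.fun_sum fun c _ => h3 c)
  · refine (h1.congr_left fun z => ?_).congr_right fun z => ?_
    · simp [smul_sub]
    · simp [pow_two]

/-- The algebra of jets applied to `Good.mixedRicci_eq`. The leading coefficient is `1 + 3 - 2 = 2`,
and tracelessness of `k` simplifies the first-order one. -/
theorem jet_mixedRicci : Jet (farSlab τ₁ τ₂) (fun z => z.1) (X.mixedRicci P)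
    (fun _ => (2 : ℝ) • 1)
    (fun z => X.σ P z.2 • (1 : Mat) + X.σMix P z.2 - (1 / 2 : ℝ) • X.kMix P z.2) := by
  have hr := tendsto_radius τ₁ τ₂
  have jN := X.jet_inv_lapse P τ₁ τ₂
  have jq := X.jet_weingarten P τ₁ τ₂
  have ji := X.jet_inv_unitMetric P τ₁ τ₂
  have jσ := Jet.inv_smul (l := farSlab τ₁ τ₂) (r := fun z => z.1)
    (M₁ := fun z => X.σ P z.2) (isBigO_one_of_patch fun u _ => (X.σ_smooth P).contDiffAt)
  have j1 := (ji.mul (X.jet_radial₂ P τ₁ τ₂) hr).const_smul (1 / 2)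
  have j2 := jσ.smul (jN.smul jq hr) hr
  have j3 : Jet (farSlab τ₁ τ₂) (fun z => z.1)
      (fun z => (z.1 • weingarten (X.h P) (Fin.cons z.1 z.2)).trace •
        (z.1 • weingarten (X.h P) (Fin.cons z.1 z.2)))
      (fun _ => (1 : Mat).trace • (1 : Mat))
      (fun z => (1 : Mat).trace • (X.σ P z.2 • (1 : Mat) - (1 / 2 : ℝ) • X.kMix P z.2) +
        (X.σ P z.2 • (1 : Mat) - (1 / 2 : ℝ) • X.kMix P z.2).trace • (1 : Mat)) :=
    (jq.map traceCLM).smul jq hr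
  have j4 := (jq.mul jq hr).const_smul 2
  have j5 := jN.smul (ji.mul (X.jet_hess P τ₁ τ₂) hr) hr
  refine (((jN.mul jN hr).smul (((j1.add j2).add j3).sub j4) hr).add j5).congr ?_ ?_ ?_
  · filter_upwards [X.eventually_good P τ₁ τ₂] with z G
    rw [G.mixedRicci_eq]
  · refine .of_forall fun z => ?_
    simp only [Matrix.mul_smul, inv_mul_dS, Matrix.trace_one, Fintype.card_fin,
      Pi.zero_apply, mul_zero, smul_zero, zero_smul, mul_one]
    module
  · filter_upwards [X.eventually_good P τ₁ τ₂] with z G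
    have ht := X.kMix_trace P G.mem
    simp only [Matrix.mul_smul, Matrix.neg_mul, Matrix.mul_assoc, inv_mul_dS,
      Matrix.trace_one, Fintype.card_fin, Matrix.trace_sub, Matrix.trace_smul, ht, inv_mul_h₁,
      Pi.zero_apply, mul_zero, smul_zero, zero_smul, mul_one, one_mul, σMix, smul_eq_mul]
    module

end Configuration

end

end MannMarolf

/-! ### The equation of motion of `σ` and existence of the Mann–Marolf tensor. -/

namespace MannMarolf

noncomputable section

open scoped Matrix.Norms.Operator

namespace Configuration

variable (X : Configuration) (P : Fin 2) (τ₁ τ₂ : ℝ)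

/-- By the radial constraint, a `1/ρ` term in `tr S` could only come from one in the trace of
`mixedExtrinsic`, and `k` is traceless. -/
theorem mixedRicci_trace_isBigO : (fun z => (X.mixedRicci P z).trace - 6) =O[farSlab τ₁ τ₂]
    fun z => z.1⁻¹ ^ 2 := by
  have hr := tendsto_radius τ₁ τ₂
  have hL := X.jet_mixedExtrinsic P τ₁ τ₂
  have ht := hL.trace_sub_isBigO (by
    filter_upwards [X.eventually_good P τ₁ τ₂] with z G
    rw [Matrix.trace_smul, X.kMix_trace P G.mem, smul_zero])
  have h1 := trace_isBigO ((hL.sub_isBigO hr).mul (hL.sub_isBigO hr))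
  have h2 : (fun z => ((X.mixedExtrinsic P z).trace - 3) ^ 2) =O[farSlab τ₁ τ₂]
      fun z => z.1⁻¹ ^ 2 := by
    refine (ht.pow 2).trans ?_
    simpa [← pow_mul] using inv_pow_isBigO (τ₁ := τ₁) (τ₂ := τ₂) (m := 4) (n := 2) (by norm_num)
  refine (((ht.const_mul_left 4).add h2).sub (h1.congr_right fun z => (pow_two _).symm)).congr' ?_ .rfl
  filter_upwards [X.eventually_good P τ₁ τ₂] with z G
  rw [G.mixedRicci_trace]
  simp only [sub_mul, mul_sub, Matrix.trace_sub, one_mul, mul_one, Matrix.trace_one,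
    Fintype.card_fin]
  push_cast
  ring

theorem tendsto_mk_farSlab {u : Fin 3 → ℝ} (hu : u ∈ slab τ₁ τ₂) :
    Tendsto (fun ρ : ℝ => (ρ, u)) atTop (farSlab τ₁ τ₂) :=
  tendsto_id.prodMk (tendsto_principal.2 (.of_forall fun _ => hu))

/-- The equation of motion `D_a D^a σ + 3 σ = 0`. -/
theorem σMix_trace {u : Fin 3 → ℝ} (hu : u ∈ patch) :
    (X.σMix P u).trace = -3 * X.σ P u := by
  have hs := exists_slab_of_mem_patch hu
  set τ₁ := u 0 - 1
  set τ₂ := u 0 + 1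
  -- Along the ray above `u`, the constraint gives no `1/ρ` term in `tr S`, while the tangential
  -- equations give the coefficient `3 σ + D_a D^a σ`.
  have h1 := (X.mixedRicci_trace_isBigO P τ₁ τ₂).comp_tendsto (tendsto_mk_farSlab τ₁ τ₂ hs)
  have h2 := trace_isBigO ((X.jet_mixedRicci P τ₁ τ₂).error.comp_tendsto
    (tendsto_mk_farSlab τ₁ τ₂ hs))
  have j : Jet atTop (fun ρ : ℝ => ρ) (fun ρ => (X.mixedRicci P (ρ, u)).trace - 6) 0
      (fun _ => 3 * X.σ P u + (X.σMix P u).trace) := by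
    refine ⟨isBigO_zero _ _, isBigO_const_const _ one_ne_zero _, h2.congr_left fun ρ => ?_⟩
    simp only [Function.comp, Matrix.trace_sub, Matrix.trace_smul, Matrix.trace_add,
      Matrix.trace_one, Fintype.card_fin, X.kMix_trace P hu, smul_eq_mul, Pi.zero_apply]
    push_cast
    ring
  linarith [j.eq_zero_of_isBigO_sq tendsto_id h1]

/-- The equation of motion gives `3 σ - 3 σ = 0`. This is the tracelessness that `Jet.of_quad` and
the comparison of traces require. -/
theorem first_trace {u : Fin 3 → ℝ} (hu : u ∈ patch) :
    (X.σ P u • (1 : Mat) + X.σMix P u - (1 / 2 : ℝ) • X.kMix P u).trace = 0 := by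
  simp only [Matrix.trace_sub, Matrix.trace_smul, Matrix.trace_add, Matrix.trace_one,
    Fintype.card_fin, X.kMix_trace P hu, X.σMix_trace P hu, smul_eq_mul]
  push_cast
  ring

theorem tendsto_mixedRicci : Tendsto (X.mixedRicci P) (farSlab τ₁ τ₂) (𝓝 ((2 : ℝ) • 1)) := by
  have := ((X.jet_mixedRicci P τ₁ τ₂).tendsto_sub (tendsto_radius _ _)).add_const ((2 : ℝ) • (1 : Mat))
  simp only [sub_add_cancel, zero_add] at this
  exact this

variable {X P} in
theorem Good.mul_mixedRicci {z : ℝ × (Fin 3 → ℝ)} (G : X.Good P z) :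
    X.h P z.1 z.2 * X.mixedRicci P z = z.1 ^ 2 • X.ric P z := by
  rw [mixedRicci, G.inv_unitMetric, Matrix.smul_mul, Matrix.mul_smul, ← Matrix.mul_assoc, G.mul_inv,
    Matrix.one_mul]

-- Multiplying by the invertible `h` lowers an index: `h · quad (ρ h⁻¹ K)` is `ρ²` times the right
-- side of the Mann–Marolf equation, and `h S = ρ² Ric`.
variable {X P} in
theorem Good.quad_iff {z : ℝ × (Fin 3 → ℝ)} (G : X.Good P z) {K : Mat} (hK : K.IsSymm) :
    (∀ a b, ricci (X.h P z.1) a b z.2 = K a b * tr (X.h P z.1 z.2) K -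
      (K * (X.h P z.1 z.2)⁻¹ * K) a b) ↔
    quad (z.1 • ((X.h P z.1 z.2)⁻¹ * K)) = X.mixedRicci P z := by
  have hz := G.pos.ne'
  set h := X.h P z.1 z.2
  have hi : h⁻¹ * h = 1 := G.inv_mul
  have hm : h * X.mixedRicci P z = z.1 ^ 2 • X.ric P z := G.mul_mixedRicci
  have e1 : h * quad (z.1 • (h⁻¹ * K)) = z.1 ^ 2 • (tr h K • K - K * h⁻¹ * K) := by
    have t1 : h * (h⁻¹ * K) = K := by rw [← Matrix.mul_assoc, G.mul_inv, Matrix.one_mul]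
    have t2 : h * ((h⁻¹ * K) * (h⁻¹ * K)) = K * h⁻¹ * K := by
      rw [← Matrix.mul_assoc, t1, ← Matrix.mul_assoc]
    rw [quad, tr_eq_trace hK, Matrix.trace_smul, Matrix.mul_sub, Matrix.mul_smul, Matrix.mul_smul,
      t1, smul_mul_smul_comm, Matrix.mul_smul, t2, smul_smul, smul_sub, smul_smul, smul_eq_mul]
    congr 2 <;> ring
  have e2 : (∀ a b, ricci (X.h P z.1) a b z.2 = K a b * tr h K - (K * h⁻¹ * K) a b) ↔
      X.ric P z = tr h K • K - K * h⁻¹ * K := by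
    rw [← Matrix.ext_iff]
    refine forall_congr' fun a => forall_congr' fun b => ?_
    simp only [ric, Matrix.of_apply, Matrix.sub_apply, Matrix.smul_apply, smul_eq_mul]
    rw [mul_comm (tr h K)]
  rw [e2]
  constructor
  · intro hric
    have := congrArg (fun M => h⁻¹ * M) (e1.trans (by rw [← hric, ← hm]))
    simpa only [← Matrix.mul_assoc, hi, Matrix.one_mul] using this
  · intro hq
    rw [hq, hm] at e1
    exact smul_right_injective Mat (pow_ne_zero 2 hz) e1

/-- Conjugation by `h` is the same as conjugation by `ρ⁻² h`, which is bounded together with its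
inverse. -/
theorem tendsto_conjugate {M : ℝ × (Fin 3 → ℝ) → Mat} (hM : Tendsto M (farSlab τ₁ τ₂) (𝓝 1)) :
    Tendsto (fun z => (X.h P z.1 z.2)⁻¹ * (M z).transpose * X.h P z.1 z.2) (farSlab τ₁ τ₂)
      (𝓝 1) := by
  have hr := tendsto_radius τ₁ τ₂
  have h1 : Tendsto (fun z => transposeCLM (M z - 1)) (farSlab τ₁ τ₂) (𝓝 0) := by
    have := (transposeCLM.continuous.tendsto 0).comp (by simpa using hM.sub_const 1 :
      Tendsto (fun z => M z - 1) (farSlab τ₁ τ₂) (𝓝 0))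
    rw [map_zero] at this
    exact this
  have h2 := (((X.jet_inv_unitMetric P τ₁ τ₂).isBigO_one hr).mul_isLittleO
    ((isLittleO_one_iff ℝ).2 h1)).mul_isBigO ((X.jet_metric P τ₁ τ₂).isBigO_one hr)
  simp only [mul_one] at h2
  have h3 := ((isLittleO_one_iff ℝ).1 h2).add_const 1
  rw [zero_add] at h3
  refine h3.congr' ?_
  filter_upwards [X.eventually_good P τ₁ τ₂] with z G
  have hz := G.pos.ne'
  rw [G.inv_unitMetric, transposeCLM_apply, Matrix.transpose_sub, Matrix.transpose_one]
  simp only [Matrix.mul_smul, Matrix.smul_mul, smul_smul, mul_sub, sub_mul, mul_one]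
  rw [G.inv_mul, ← mul_pow, inv_mul_cancel₀ hz, one_pow, one_smul, one_smul, sub_add_cancel]

-- `h⁻¹ Mᵀ h` is the adjoint of `M` with respect to `h`. The map `quad` commutes with adjoints, and
-- symmetry of the Ricci tensor says that `mixedRicci` is self-adjoint.
variable {X P} in
theorem Good.quad_conjugate {z : ℝ × (Fin 3 → ℝ)} (G : X.Good P z) {M : Mat}
    (hM : quad M = X.mixedRicci P z) :
    quad ((X.h P z.1 z.2)⁻¹ * M.transpose * X.h P z.1 z.2) = X.mixedRicci P z := by
  have hz := G.pos.ne'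
  set h := X.h P z.1 z.2
  have hs : h.transpose = h := G.symm
  have hi : (h⁻¹).transpose = h⁻¹ := by rw [Matrix.transpose_nonsing_inv, hs]
  have e1 : quad (h⁻¹ * M.transpose * h) = h⁻¹ * (quad M).transpose * h := by
    have : h⁻¹ * M.transpose * h * (h⁻¹ * M.transpose * h) =
        h⁻¹ * (M.transpose * M.transpose) * h := by
      rw [Matrix.mul_assoc (h⁻¹ * M.transpose), ← Matrix.mul_assoc h, ← Matrix.mul_assoc h, G.mul_inv,
        Matrix.one_mul]
      simp only [Matrix.mul_assoc]
    rw [quad, quad, this, Matrix.transpose_sub, Matrix.transpose_smul, Matrix.transpose_mul,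
      Matrix.trace_mul_comm, ← Matrix.mul_assoc, G.mul_inv, Matrix.one_mul, Matrix.trace_transpose,
      Matrix.mul_sub, Matrix.sub_mul, Matrix.mul_smul, Matrix.smul_mul]
  rw [e1, hM, mixedRicci, G.inv_unitMetric, Matrix.smul_mul, Matrix.transpose_smul,
    Matrix.transpose_mul, G.ric_symm.eq, hi, Matrix.mul_smul, Matrix.smul_mul, Matrix.mul_assoc,
    Matrix.mul_assoc, G.inv_mul, Matrix.mul_one]

theorem exists_isMannMarolf : ∃ Khat, X.IsMannMarolf Khat := by
  obtain ⟨g, U, hU, V, hVo, hV, -, hgV, hgU, hg⟩ := exists_quad_localInverse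
  -- The tensor `K̂ = ρ⁻¹ h M` is obtained from `M = ρ h⁻¹ K̂`, where `M` is the local solution of
  -- `quad M = S`.
  refine ⟨fun P ρ u => ρ⁻¹ • (X.h P ρ u * g (X.mixedRicci P (ρ, u))), fun τ₁ τ₂ => ⟨?_, ?_⟩⟩
  · have key : ∀ᶠ z in farSlab τ₁ τ₂, ∀ P,
        (z.1⁻¹ • (X.h P z.1 z.2 * g (X.mixedRicci P z))).IsSymm ∧
        ∀ a b, ricci (X.h P z.1) a b z.2 = (z.1⁻¹ • (X.h P z.1 z.2 * g (X.mixedRicci P z))) a b *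
          tr (X.h P z.1 z.2) (z.1⁻¹ • (X.h P z.1 z.2 * g (X.mixedRicci P z))) -
          ((z.1⁻¹ • (X.h P z.1 z.2 * g (X.mixedRicci P z))) * (X.h P z.1 z.2)⁻¹ *
            (z.1⁻¹ • (X.h P z.1 z.2 * g (X.mixedRicci P z)))) a b := by
      refine eventually_all.2 fun P => ?_
      have hM := hg.comp (X.tendsto_mixedRicci P τ₁ τ₂)
      filter_upwards [X.eventually_good P τ₁ τ₂,
        (X.tendsto_mixedRicci P τ₁ τ₂).eventually (hVo.mem_nhds hV),
        (X.tendsto_conjugate P τ₁ τ₂ hM).eventually hU] with z G hS hM'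
      have hz := G.pos.ne'
      have hq := hgV _ hS
      -- The adjoint of `M` is also near `1` and solves the same equation. Local uniqueness makes
      -- `M` self-adjoint, which means that `h M` is symmetric.
      have hconj := hgU _ hM'
      simp only [Function.comp] at hconj
      rw [G.quad_conjugate hq] at hconj
      set M := g (X.mixedRicci P z)
      have hsymm : (z.1⁻¹ • (X.h P z.1 z.2 * M)).IsSymm := by
        rw [Matrix.IsSymm, Matrix.transpose_smul, Matrix.transpose_mul, G.symm.eq]
        conv_rhs => rw [hconj]
        rw [← Matrix.mul_assoc, ← Matrix.mul_assoc, G.mul_inv, Matrix.one_mul]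
      refine ⟨hsymm, (G.quad_iff hsymm).2 ?_⟩
      rw [Matrix.mul_smul, smul_smul, mul_inv_cancel₀ hz, one_smul, ← Matrix.mul_assoc, G.inv_mul,
        Matrix.one_mul, hq]
    obtain ⟨R, hR, h⟩ := eventually_farSlab.1 key
    exact ⟨R, hR, fun P ρ hρ u hu => h ρ hρ u hu P⟩
  · intro ε hε
    have key : ∀ᶠ z in farSlab τ₁ τ₂, ∀ P a b,
        |(z.1⁻¹ • (X.h P z.1 z.2 * g (X.mixedRicci P z))) a b - z.1 * dS z.2 a b| ≤ ε * z.1 := by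
      refine eventually_all.2 fun P => eventually_all.2 fun a => eventually_all.2 fun b => ?_
      have hr := tendsto_radius τ₁ τ₂
      have hM : Tendsto (fun z => g (X.mixedRicci P z) - 1) (farSlab τ₁ τ₂) (𝓝 0) := by
        simpa using (hg.comp (X.tendsto_mixedRicci P τ₁ τ₂)).sub_const 1
      have h1 := ((X.jet_metric P τ₁ τ₂).isBigO_one hr).mul_isLittleO ((isLittleO_one_iff ℝ).2 hM)
      rw [show (fun _ : ℝ × (Fin 3 → ℝ) => (1 : ℝ) * 1) = fun _ => 1 by simp, isLittleO_one_iff]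
        at h1
      have h2 := ((entryCLM a b).continuous.tendsto 0).comp
        (by
          have := h1.add ((X.jet_metric P τ₁ τ₂).tendsto_sub hr)
          rw [add_zero] at this
          exact this : Tendsto (fun z =>
          (z.1⁻¹ ^ 2) • X.h P z.1 z.2 * (g (X.mixedRicci P z) - 1) +
            ((z.1⁻¹ ^ 2) • X.h P z.1 z.2 - dS z.2)) (farSlab τ₁ τ₂) (𝓝 0))
      rw [map_zero] at h2
      filter_upwards [X.eventually_good P τ₁ τ₂,
        (tendsto_zero_iff_abs_tendsto_zero _ |>.1 h2).eventually (ge_mem_nhds hε)] with z G hz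
      have hz0 := G.pos
      have e : (z.1⁻¹ • (X.h P z.1 z.2 * g (X.mixedRicci P z))) a b - z.1 * dS z.2 a b =
          z.1 * (((z.1⁻¹ ^ 2) • X.h P z.1 z.2 * (g (X.mixedRicci P z) - 1) +
            ((z.1⁻¹ ^ 2) • X.h P z.1 z.2 - dS z.2)) a b) := by
        rw [mul_sub, mul_one, sub_add_sub_cancel, Matrix.smul_mul, Matrix.sub_apply,
          Matrix.smul_apply, Matrix.smul_apply, smul_eq_mul, smul_eq_mul]
        field_simp
      rw [e, abs_mul, abs_of_pos hz0, mul_comm]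
      exact mul_le_mul_of_nonneg_right hz hz0.le
    obtain ⟨R, hR, h⟩ := eventually_farSlab.1 key
    exact ⟨R, hR, fun P ρ hρ u hu => h ρ hρ u hu P⟩

end Configuration

end

end MannMarolf

/-! ### Asymptotics of `K`, `K̂` and their difference. -/

namespace MannMarolf

noncomputable section

open scoped Matrix.Norms.Operator

namespace Configuration

variable (X : Configuration) (P : Fin 2) (τ₁ τ₂ : ℝ)

theorem contDiff_hess (a b : Fin 3) : ContDiff ℝ ∞ (fun u => hess dS (X.σ P) u a b) :=
  contDiff_iff_contDiffAt.2 fun u => by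
    have hσ := fun i => ((X.σ_smooth P).contDiffAt (x := u)).pd (i := i) (k := ∞) (by simp)
    exact ((hσ b).pd (by simp)).sub (ContDiffAt.sum fun c _ =>
      (contDiff_christoffel_dS c a b).contDiffAt.mul (hσ c))

theorem hess_dS_symm (u : Fin 3 → ℝ) : (hess dS (X.σ P) u).IsSymm :=
  hess_symm ((X.σ_smooth P).contDiffAt.of_le ENat.LEInfty.out) fun c a b => by
    rw [show (fun u => dS u a b) = fun u => dS u b a from funext fun v => (dS_symm v).apply b a]

theorem contDiffAt_dS_inv (u : Fin 3 → ℝ) (a b : Fin 3) :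
    ContDiffAt ℝ ∞ (fun v => (dS v)⁻¹ a b) u :=
  contDiffAt_inv_entry (fun a b => (contDiff_dS a b).contDiffAt) (dS_det_ne u) a b

theorem contDiffAt_contract {A B : Tensor2 3} {u : Fin 3 → ℝ}
    (hA : ∀ a b, ContDiffAt ℝ ∞ (fun v => A v a b) u)
    (hB : ∀ a b, ContDiffAt ℝ ∞ (fun v => B v a b) u) :
    ContDiffAt ℝ ∞ (fun v => contract (dS v) (A v) (B v)) u :=
  ContDiffAt.sum fun a _ => ContDiffAt.sum fun b _ => ContDiffAt.sum fun c _ =>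
    ContDiffAt.sum fun d _ => (((contDiffAt_dS_inv u a c).mul (contDiffAt_dS_inv u b d)).mul
      (hA a b)).mul (hB c d)

theorem contDiffAt_density {u : Fin 3 → ℝ} (hu : u ∈ patch) : ContDiffAt ℝ ∞ (X.density P) u :=
  ((contDiffAt_const.mul ((X.σ_smooth P).contDiffAt.pow 2)).add
    (contDiffAt_contract (fun a b => (X.contDiff_hess P a b).contDiffAt) (X.k_smooth P u hu))).sub
    (contDiffAt_contract (fun a b => (X.contDiff_hess P a b).contDiffAt)
      (fun a b => (X.contDiff_hess P a b).contDiffAt))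

/-- The density is `tr A² - tr B²` for the first-order terms of `L` and `M`. The squares of `k`
cancel, and the equation of motion turns the cross term `2 σ D_a D^a σ` of `tr B²` into `-6 σ²`,
which fixes the coefficient of `σ²`. -/
theorem density_eq {u : Fin 3 → ℝ} (hu : u ∈ patch) : X.density P u =
    (((-(1 / 2 : ℝ) • X.kMix P u) * (-(1 / 2 : ℝ) • X.kMix P u)).trace -
      ((X.σ P u • (1 : Mat) + X.σMix P u - (1 / 2 : ℝ) • X.kMix P u) *
        (X.σ P u • (1 : Mat) + X.σMix P u - (1 / 2 : ℝ) • X.kMix P u)).trace) := by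
  rw [density, contract_eq_trace (dS_symm u) (X.k_symm P u hu),
    contract_eq_trace (dS_symm u) (X.hess_dS_symm P u)]
  have h1 := X.kMix_trace P hu
  have h2 := X.σMix_trace P hu
  have h3 : (X.kMix P u * X.σMix P u).trace = (X.σMix P u * X.kMix P u).trace :=
    Matrix.trace_mul_comm _ _
  rw [show (dS u)⁻¹ * hess dS (X.σ P) u = X.σMix P u from rfl,
    show (dS u)⁻¹ * X.k P u = X.kMix P u from rfl]
  simp only [Matrix.smul_mul, Matrix.mul_smul, Matrix.add_mul, Matrix.mul_add,
    Matrix.sub_mul, Matrix.mul_sub, Matrix.one_mul, Matrix.mul_one, Matrix.trace_add,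
    Matrix.trace_sub, Matrix.trace_smul, Matrix.trace_one, Fintype.card_fin, smul_eq_mul, h1, h2, h3]
  push_cast
  ring

/-- `ρ h^{ac} K̂_{cb}`. -/
def mixedHat (Khat : Fin 2 → ℝ → Tensor2 3) (z : ℝ × (Fin 3 → ℝ)) : Mat :=
  z.1 • ((X.h P z.1 z.2)⁻¹ * Khat P z.1 z.2)

variable {X P} in
theorem Good.extrinsic_eq {z : ℝ × (Fin 3 → ℝ)} (G : X.Good P z) : X.extrinsic P z.1 z.2 =
    (1 / 2 * (lapse (X.σ P) (Fin.cons z.1 z.2))⁻¹) • radial (X.h P) (Fin.cons z.1 z.2) := by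
  ext a b
  rw [extrinsic, Matrix.of_apply,
    (X.radial_eq_deriv P ((G.smooth a b).differentiableAt (by simp))).deriv, Matrix.smul_apply,
    smul_eq_mul, lapse]
  simp only [Fin.tail_cons, Fin.cons_zero]
  rw [div_eq_mul_inv, _root_.mul_inv]
  ring

variable {X P} in
theorem Good.meanCurv_eq {z : ℝ × (Fin 3 → ℝ)} (G : X.Good P z) :
    X.meanCurv P z.1 z.2 = (X.mixedExtrinsic P z).trace / z.1 := by
  have hz := G.pos.ne'
  have hs : (X.extrinsic P z.1 z.2).IsSymm := by
    rw [G.extrinsic_eq, Matrix.IsSymm, Matrix.transpose_smul, G.radial_symm.eq]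
  rw [meanCurv, tr_eq_trace hs, G.extrinsic_eq, mixedExtrinsic, Matrix.mul_smul, X.inv_mul_radial P z,
    smul_smul, Matrix.trace_smul, Matrix.trace_smul, smul_eq_mul, smul_eq_mul]
  field_simp

variable {Khat : Fin 2 → ℝ → Tensor2 3}

theorem eventually_hat (hK : X.IsMannMarolf Khat) : ∀ᶠ z in farSlab τ₁ τ₂,
    quad (X.mixedHat P Khat z) = X.mixedRicci P z ∧
      X.hatTrace Khat P z.1 z.2 = (X.mixedHat P Khat z).trace / z.1 := by
  obtain ⟨R, hR, h⟩ := (hK τ₁ τ₂).1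
  filter_upwards [X.eventually_good P τ₁ τ₂, (eventually_farSlab (p := fun z =>
    (Khat P z.1 z.2).IsSymm ∧ ∀ a b, ricci (X.h P z.1) a b z.2 = Khat P z.1 z.2 a b *
      tr (X.h P z.1 z.2) (Khat P z.1 z.2) -
        (Khat P z.1 z.2 * (X.h P z.1 z.2)⁻¹ * Khat P z.1 z.2) a b)).2 ⟨R, hR, h P⟩]
    with z G hz
  refine ⟨(G.quad_iff hz.1).1 hz.2, ?_⟩
  have hz0 := G.pos.ne'
  rw [hatTrace, tr_eq_trace hz.1, mixedHat, Matrix.trace_smul, smul_eq_mul]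
  field_simp

/-- The branch condition `K̂ = ρ h⁽⁰⁾ + o(ρ)` is what places an arbitrary solution near `1`, where
`quad` is injective. -/
theorem tendsto_mixedHat (hK : X.IsMannMarolf Khat) :
    Tendsto (X.mixedHat P Khat) (farSlab τ₁ τ₂) (𝓝 1) := by
  have hr := tendsto_radius τ₁ τ₂
  have e1 : (fun z => z.1⁻¹ • Khat P z.1 z.2 - dS z.2) =o[farSlab τ₁ τ₂] fun _ => (1 : ℝ) := by
    rw [isLittleO_one_iff]
    refine tendsto_of_entries fun a b => ?_
    rw [Matrix.zero_apply, Metric.tendsto_nhds]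
    intro ε hε
    obtain ⟨R, hR, h⟩ := (hK τ₁ τ₂).2 (ε / 2) (by positivity)
    refine eventually_farSlab.2 ⟨R, hR, fun ρ hρ u hu => ?_⟩
    have hp : 0 < ρ := hR.trans hρ
    have := h P ρ hρ u hu a b
    rw [Real.dist_eq, sub_zero, Matrix.sub_apply, Matrix.smul_apply, smul_eq_mul]
    have e : ρ⁻¹ * Khat P ρ u a b - dS u a b = ρ⁻¹ * (Khat P ρ u a b - ρ * dS u a b) := by
      field_simp
    rw [e, abs_mul, abs_of_pos (inv_pos.2 hp)]
    calc ρ⁻¹ * |Khat P ρ u a b - ρ * dS u a b| ≤ ρ⁻¹ * (ε / 2 * ρ) := by gcongr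
      _ = ε / 2 := by field_simp
      _ < ε := by linarith
  have ji := X.jet_inv_unitMetric P τ₁ τ₂
  have e2 := (ji.isBigO_one hr).mul_isLittleO e1
  have e3 := ((isLittleO_one_iff ℝ).2 (ji.tendsto_sub hr)).mul_isBigO
    (dS_isBigO (τ₁ := τ₁) (τ₂ := τ₂))
  have e4 := (e2.add e3)
  simp only [mul_one] at e4
  have e5 := ((isLittleO_one_iff ℝ).1 e4).add_const 1
  rw [zero_add] at e5
  refine e5.congr' ?_
  filter_upwards [X.eventually_good P τ₁ τ₂] with z G
  have hz := G.pos.ne'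
  rw [mul_sub, sub_mul, inv_mul_dS, G.inv_unitMetric, mixedHat, smul_mul_smul_comm]
  rw [show z.1 ^ 2 * z.1⁻¹ = z.1 by field_simp]
  abel

theorem jet_mixedHat (hK : X.IsMannMarolf Khat) : Jet (farSlab τ₁ τ₂) (fun z => z.1)
    (X.mixedHat P Khat) (fun _ => 1)
    (fun z => X.σ P z.2 • (1 : Mat) + X.σMix P z.2 - (1 / 2 : ℝ) • X.kMix P z.2) := by
  refine Jet.of_quad (tendsto_radius _ _) (X.tendsto_mixedHat P τ₁ τ₂ hK)
    (X.jet_mixedRicci P τ₁ τ₂) ?_ ((X.eventually_hat P τ₁ τ₂ hK).mono fun _ h => h.1)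
  filter_upwards [X.eventually_good P τ₁ τ₂] with z G using X.first_trace P G.mem

theorem trace_mixedExtrinsic_isBigO : (fun z => (X.mixedExtrinsic P z).trace - 3)
    =O[farSlab τ₁ τ₂] fun z => z.1⁻¹ ^ 2 := by
  refine (X.jet_mixedExtrinsic P τ₁ τ₂).trace_sub_isBigO ?_
  filter_upwards [X.eventually_good P τ₁ τ₂] with z G
  rw [Matrix.trace_smul, X.kMix_trace P G.mem, smul_zero]

theorem trace_mixedHat_isBigO (hK : X.IsMannMarolf Khat) :
    (fun z => (X.mixedHat P Khat z).trace - 3) =O[farSlab τ₁ τ₂] fun z => z.1⁻¹ ^ 2 := by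
  refine (X.jet_mixedHat P τ₁ τ₂ hK).trace_sub_isBigO ?_
  filter_upwards [X.eventually_good P τ₁ τ₂] with z G using X.first_trace P G.mem

/-- The required equality of `(tr N)² - tr N²` is the radial constraint on one side and the trace of
`quad M = S` on the other. -/
theorem trace_difference_isBigO (hK : X.IsMannMarolf Khat) :
    (fun z => (X.mixedExtrinsic P z).trace - (X.mixedHat P Khat z).trace -
      1 / 4 * z.1⁻¹ ^ 2 * X.density P z.2) =O[farSlab τ₁ τ₂] fun z => z.1⁻¹ ^ 3 := by
  refine (trace_sub_trace_isBigO (tendsto_radius _ _) (X.jet_mixedExtrinsic P τ₁ τ₂)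
    (X.jet_mixedHat P τ₁ τ₂ hK) ?_ ?_ ?_).congr' ?_ .rfl
  · filter_upwards [X.eventually_good P τ₁ τ₂] with z G
    rw [Matrix.trace_smul, X.kMix_trace P G.mem, smul_zero]
  · filter_upwards [X.eventually_good P τ₁ τ₂] with z G using X.first_trace P G.mem
  · filter_upwards [X.eventually_good P τ₁ τ₂, X.eventually_hat P τ₁ τ₂ hK] with z G hz
    rw [← G.mixedRicci_trace, ← hz.1, quad, Matrix.trace_sub, Matrix.trace_smul, smul_eq_mul, pow_two]
  · filter_upwards [X.eventually_good P τ₁ τ₂] with z G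
    rw [X.density_eq P G.mem]

theorem div_radius_isBigO {f : ℝ × (Fin 3 → ℝ) → ℝ} {n : ℕ}
    (h : f =O[farSlab τ₁ τ₂] fun z => z.1⁻¹ ^ n) :
    (fun z => f z / z.1) =O[farSlab τ₁ τ₂] fun z => z.1⁻¹ ^ (n + 1) :=
  (h.mul (isBigO_refl (fun z : ℝ × (Fin 3 → ℝ) => z.1⁻¹) _)).congr_right fun _ => (pow_succ _ _).symm

theorem meanCurv_isBigO : (fun z => X.meanCurv P z.1 z.2 - 3 / z.1) =O[farSlab τ₁ τ₂]
    fun z => z.1⁻¹ ^ 3 := by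
  refine (div_radius_isBigO _ _ (X.trace_mixedExtrinsic_isBigO P τ₁ τ₂)).congr' ?_ .rfl
  filter_upwards [X.eventually_good P τ₁ τ₂] with z G
  rw [G.meanCurv_eq, sub_div]

theorem hatTrace_isBigO (hK : X.IsMannMarolf Khat) :
    (fun z => X.hatTrace Khat P z.1 z.2 - 3 / z.1) =O[farSlab τ₁ τ₂] fun z => z.1⁻¹ ^ 3 := by
  refine (div_radius_isBigO _ _ (X.trace_mixedHat_isBigO P τ₁ τ₂ hK)).congr' ?_ .rfl
  filter_upwards [X.eventually_hat P τ₁ τ₂ hK] with z hz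
  rw [hz.2, sub_div]

theorem difference_isBigO (hK : X.IsMannMarolf Khat) :
    (fun z => X.meanCurv P z.1 z.2 - X.hatTrace Khat P z.1 z.2 -
      1 / (4 * z.1 ^ 3) * X.density P z.2) =O[farSlab τ₁ τ₂] fun z => z.1⁻¹ ^ 4 := by
  refine (div_radius_isBigO _ _ (X.trace_difference_isBigO P τ₁ τ₂ hK)).congr' ?_ .rfl
  filter_upwards [X.eventually_good P τ₁ τ₂, X.eventually_hat P τ₁ τ₂ hK] with z G hz
  have hz0 := G.pos.ne'
  rw [hz.2, G.meanCurv_eq]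
  field_simp

theorem asymptotics (hK : X.IsMannMarolf Khat) : ∃ C, ∃ R > 0, ∀ P, ∀ ρ > R, ∀ u ∈ slab τ₁ τ₂,
    |X.meanCurv P ρ u - 3 / ρ| ≤ C / ρ ^ 3 ∧
    |X.hatTrace Khat P ρ u - 3 / ρ| ≤ C / ρ ^ 3 ∧
    |X.meanCurv P ρ u - X.hatTrace Khat P ρ u - 1 / (4 * ρ ^ 3) * X.density P u| ≤ C / ρ ^ 4 := by
  have h1 := fun P => isBigO_farSlab (X.meanCurv_isBigO P τ₁ τ₂)
  have h2 := fun P => isBigO_farSlab (X.hatTrace_isBigO P τ₁ τ₂ hK)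
  have h3 := fun P => isBigO_farSlab (X.difference_isBigO P τ₁ τ₂ hK)
  choose C₁ R₁ p₁ h1 using h1
  choose C₂ R₂ p₂ h2 using h2
  choose C₃ R₃ p₃ h3 using h3
  have hC : ∀ (f : Fin 2 → ℝ) (Q : Fin 2), f Q ≤ ∑ P, |f P| := fun f Q =>
    (le_abs_self _).trans (Finset.single_le_sum (f := fun P => |f P|)
      (fun P _ => abs_nonneg _) (Finset.mem_univ Q))
  have hn : ∀ f : Fin 2 → ℝ, 0 ≤ ∑ P, |f P| := fun f => Finset.sum_nonneg fun P _ => abs_nonneg _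
  -- Sums of absolute values dominate the constants of each estimate on each patch, giving one bound
  -- and one radius for all.
  refine ⟨(∑ P, |C₁ P|) + (∑ P, |C₂ P|) + ∑ P, |C₃ P|,
    (∑ P, |R₁ P|) + (∑ P, |R₂ P|) + ∑ P, |R₃ P|, ?_, fun P ρ hρ u hu => ?_⟩
  · have := (p₁ 0).trans_le (hC R₁ 0)
    linarith [hn R₂, hn R₃]
  · have q1 : R₁ P < ρ := by linarith [hC R₁ P, hn R₂, hn R₃]
    have q2 : R₂ P < ρ := by linarith [hC R₂ P, hn R₁, hn R₃]
    have q3 : R₃ P < ρ := by linarith [hC R₃ P, hn R₁, hn R₂]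
    have hp : 0 < ρ := (p₁ P).trans q1
    refine ⟨(h1 P ρ q1 u hu).trans ?_, (h2 P ρ q2 u hu).trans ?_, (h3 P ρ q3 u hu).trans ?_⟩
    · gcongr; linarith [hC C₁ P, hn C₂, hn C₃]
    · gcongr; linarith [hC C₂ P, hn C₁, hn C₃]
    · gcongr; linarith [hC C₃ P, hn C₁, hn C₂]

end Configuration

end

end MannMarolf

/-! ### Integrability and the limit of the action. -/

namespace MannMarolf

noncomputable section

open scoped Matrix.Norms.Operator

theorem contDiff_cons {k : WithTop ℕ∞} (ρ : ℝ) :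
    ContDiff ℝ k (fun u : Fin 3 → ℝ => (Fin.cons ρ u : Fin 4 → ℝ)) := by
  rw [contDiff_pi]
  intro i
  refine Fin.cases ?_ (fun a => ?_) i
  · simpa using contDiff_const
  · simpa using contDiff_apply ℝ ℝ a

theorem continuousOn_of_entries {α : Type*} [TopologicalSpace α] {M : α → Mat} {s : Set α}
    (h : ∀ a b, ContinuousOn (fun u => M u a b) s) : ContinuousOn M s := fun u hu =>
  tendsto_of_entries fun a b => h a b u hu

namespace Configuration

variable (X : Configuration) (P : Fin 2) (τ₁ τ₂ : ℝ)

namespace Good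

variable {X P} {z : ℝ × (Fin 3 → ℝ)}

theorem contDiffAt_slice (G : X.Good P z) (a b : Fin 3) :
    ContDiffAt ℝ ∞ (fun u => X.h P z.1 u a b) z.2 :=
  ContDiffAt.comp (g := fun x : Fin 4 → ℝ => X.h P (x 0) (Fin.tail x) a b) z.2 (G.smooth a b)
    (contDiff_cons z.1).contDiffAt

theorem contDiffAt_inv_slice (G : X.Good P z) (a b : Fin 3) :
    ContDiffAt ℝ ∞ (fun u => (X.h P z.1 u)⁻¹ a b) z.2 :=
  contDiffAt_inv_entry G.contDiffAt_slice G.det_ne a b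

theorem contDiffAt_radial_slice (G : X.Good P z) (a b : Fin 3) :
    ContDiffAt ℝ ∞ (fun u => radial (X.h P) (Fin.cons z.1 u) a b) z.2 :=
  ContDiffAt.comp (g := fun x : Fin 4 → ℝ => radial (X.h P) x a b) z.2
    ((G.smooth a b).pd (i := 0) (by simp)) (contDiff_cons z.1).contDiffAt

theorem continuousAt_ricci (G : X.Good P z) (a b : Fin 3) :
    ContinuousAt (ricci (X.h P z.1) a b) z.2 :=
  MannMarolf.continuousAt_ricci (fun a b => (G.contDiffAt_slice a b).of_le ENat.LEInfty.out)
    G.det_ne a b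

/-- This isolates the volume growth `ρ³ √(-h⁽⁰⁾)` exactly. The remaining determinant is that of a
matrix tending to `1`. -/
theorem neg_det_eq (G : X.Good P z) : -(X.h P z.1 z.2).det =
    (z.1 ^ 3 * dSFactor z.2) ^ 2 * (X.unitMetric P z * (dS z.2)⁻¹).det := by
  have hz := G.pos.ne'
  have hf := (dSFactor_pos z.2).ne'
  rw [Matrix.det_mul, unitMetric, Matrix.det_smul, Matrix.det_nonsing_inv, dS_det,
    Ring.inverse_eq_inv', Fintype.card_fin]
  field_simp

end Good

variable {Khat : Fin 2 → ℝ → Tensor2 3}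

theorem eventually_of_farSlab {p : ℝ × (Fin 3 → ℝ) → Prop} (h : ∀ᶠ z in farSlab τ₁ τ₂, p z) :
    ∀ᶠ ρ in atTop, ∀ u ∈ slab τ₁ τ₂, p (ρ, u) := by
  obtain ⟨R, -, h⟩ := eventually_farSlab.1 h
  filter_upwards [eventually_gt_atTop R] with ρ hρ using h ρ hρ

theorem continuousOn_meanCurv {ρ : ℝ} (hG : ∀ u ∈ slab τ₁ τ₂, X.Good P (ρ, u)) :
    ContinuousOn (X.meanCurv P ρ) (slab τ₁ τ₂) := by
  have h1 : ContinuousOn (fun u => X.mixedExtrinsic P (ρ, u)) (slab τ₁ τ₂) := by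
    refine continuousOn_of_entries fun a b u hu => ContinuousAt.continuousWithinAt ?_
    have G := hG u hu
    have hl : ContinuousAt (fun u => lapse (X.σ P) (Fin.cons ρ u)) u := by
      simp only [lapse, Fin.tail_cons, Fin.cons_zero]
      exact continuousAt_const.add ((X.σ_smooth P).continuous.continuousAt.div_const _)
    simp only [mixedExtrinsic, weingarten, Matrix.smul_apply, Matrix.mul_apply, smul_eq_mul,
      Fin.cons_zero, Fin.tail_cons]
    exact ((hl.inv₀ G.reg.lapse_ne).mul continuousAt_const).mul (continuousAt_const.mul
      (tendsto_finsetSum _ fun c _ => (G.contDiffAt_inv_slice a c).continuousAt.mul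
        (G.contDiffAt_radial_slice c b).continuousAt))
  refine ((traceCLM.continuous.comp_continuousOn h1).div_const ρ).congr fun u hu => ?_
  exact (hG u hu).meanCurv_eq

theorem continuousOn_mixedRicci {ρ : ℝ} (hG : ∀ u ∈ slab τ₁ τ₂, X.Good P (ρ, u)) :
    ContinuousOn (fun u => X.mixedRicci P (ρ, u)) (slab τ₁ τ₂) := by
  refine ContinuousOn.congr (f := fun u => (ρ ^ 2 • (X.h P ρ u)⁻¹) * X.ric P (ρ, u)) ?_ fun u hu => ?_
  · refine continuousOn_of_entries fun a b u hu => ContinuousAt.continuousWithinAt ?_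
    have G := hG u hu
    simp only [Matrix.mul_apply, Matrix.smul_apply, ric, Matrix.of_apply, smul_eq_mul]
    exact tendsto_finsetSum _ fun c _ =>
      (continuousAt_const.mul (G.contDiffAt_inv_slice a c).continuousAt).mul
        (G.continuousAt_ricci c b)
  · change X.mixedRicci P (ρ, u) = _
    rw [mixedRicci, (hG u hu).inv_unitMetric]

/-- No continuity of `K̂` is assumed. At large radius local uniqueness identifies `mixedHat` with
the continuous local inverse applied to `mixedRicci`, which is continuous in `u`. -/
theorem eventually_continuousOn_hatTrace (hK : X.IsMannMarolf Khat) :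
    ∀ᶠ ρ in atTop, ContinuousOn (X.hatTrace Khat P ρ) (slab τ₁ τ₂) := by
  obtain ⟨g, U, hU, V, hVo, hV, hgc, -, hgU, -⟩ := exists_quad_localInverse
  filter_upwards [eventually_of_farSlab τ₁ τ₂ (X.eventually_good P τ₁ τ₂),
    eventually_of_farSlab τ₁ τ₂ (X.eventually_hat P τ₁ τ₂ hK),
    eventually_of_farSlab τ₁ τ₂ ((X.tendsto_mixedHat P τ₁ τ₂ hK).eventually hU),
    eventually_of_farSlab τ₁ τ₂ ((X.tendsto_mixedRicci P τ₁ τ₂).eventually (hVo.mem_nhds hV))]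
    with ρ hG hh hu hv
  have h1 := traceCLM.continuous.comp_continuousOn
    (hgc.comp (X.continuousOn_mixedRicci P τ₁ τ₂ hG) hv)
  refine (h1.div_const ρ).congr fun u hu' => ?_
  rw [(hh u hu').2, ← hgU _ (hu u hu'), (hh u hu').1]
  rfl

theorem eventually_continuousOn (hK : X.IsMannMarolf Khat) : ∀ᶠ ρ in atTop,
    ContinuousOn (fun u => Real.sqrt (-(X.h P ρ u).det) *
      (X.meanCurv P ρ u - X.hatTrace Khat P ρ u)) (slab τ₁ τ₂) := by
  filter_upwards [eventually_of_farSlab τ₁ τ₂ (X.eventually_good P τ₁ τ₂),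
    X.eventually_continuousOn_hatTrace P τ₁ τ₂ hK] with ρ hG hh
  refine ContinuousOn.mul (fun u hu => ?_) ((X.continuousOn_meanCurv P τ₁ τ₂ hG).sub hh)
  exact ((contDiffAt_det (hG u hu).contDiffAt_slice).continuousAt.neg.sqrt).continuousWithinAt

theorem eventually_integrableOn (hK : X.IsMannMarolf Khat) : ∀ᶠ ρ in atTop, ∀ P,
    MeasureTheory.IntegrableOn (fun u => Real.sqrt (-(X.h P ρ u).det) *
      (X.meanCurv P ρ u - X.hatTrace Khat P ρ u)) (slab τ₁ τ₂) :=
  eventually_all.2 fun P => (X.eventually_continuousOn P τ₁ τ₂ hK).mono fun _ h =>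
    h.integrableOn_compact (isCompact_slab τ₁ τ₂)

theorem tendsto_det : Tendsto (fun z => Real.sqrt (X.unitMetric P z * (dS z.2)⁻¹).det)
    (farSlab τ₁ τ₂) (𝓝 1) := by
  have hr := tendsto_radius τ₁ τ₂
  have h1 := ((isLittleO_one_iff ℝ).2 ((X.jet_metric P τ₁ τ₂).tendsto_sub hr)).mul_isBigO
    (dS_inv_isBigO (τ₁ := τ₁) (τ₂ := τ₂))
  simp only [mul_one] at h1
  have h2 := ((isLittleO_one_iff ℝ).1 h1).add_const 1
  rw [zero_add] at h2
  have h3 : Tendsto (fun z => X.unitMetric P z * (dS z.2)⁻¹) (farSlab τ₁ τ₂) (𝓝 1) := by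
    refine h2.congr fun z => ?_
    rw [sub_mul, Matrix.mul_nonsing_inv _ (isUnit_iff_ne_zero.2 (dS_det_ne z.2)), sub_add_cancel]
    rfl
  have h4 : ContinuousAt (fun M : Mat => M.det) 1 :=
    (Continuous.matrix_det continuous_id).continuousAt
  have h5 := (h4.tendsto.comp h3).sqrt
  simpa using h5

theorem tendsto_integrand (hK : X.IsMannMarolf Khat) :
    Tendsto (fun z => Real.sqrt (-(X.h P z.1 z.2).det) *
      (X.meanCurv P z.1 z.2 - X.hatTrace Khat P z.1 z.2) -
        1 / 4 * (Real.sqrt (-(dS z.2).det) * X.density P z.2)) (farSlab τ₁ τ₂) (𝓝 0) := by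
  have hr := tendsto_radius τ₁ τ₂
  have hd := X.tendsto_det P τ₁ τ₂
  have hf : (fun z => dSFactor z.2) =O[farSlab τ₁ τ₂] fun _ => (1 : ℝ) :=
    isBigO_one_of_continuousOn (contDiff_dSFactor (k := 0)).continuous.continuousOn
  have hD : (fun z => X.density P z.2) =O[farSlab τ₁ τ₂] fun _ => (1 : ℝ) :=
    isBigO_one_of_patch fun u hu => X.contDiffAt_density P hu
  have h1 : (fun z => z.1 ^ 3 * (X.meanCurv P z.1 z.2 - X.hatTrace Khat P z.1 z.2 -
      1 / (4 * z.1 ^ 3) * X.density P z.2)) =o[farSlab τ₁ τ₂] fun _ => (1 : ℝ) := by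
    have := pow_mul_isBigO τ₁ τ₂ (n := 1) 3 (X.difference_isBigO P τ₁ τ₂ hK) (by norm_num)
    rw [isLittleO_one_iff]
    exact this.trans_tendsto (hr.inv_tendsto_atTop.congr fun z => (pow_one _).symm)
  have h2 := (hd.isBigO_one ℝ).mul_isLittleO h1
  have h3 := ((isLittleO_one_iff ℝ).2 (by simpa using hd.sub_const 1 : Tendsto (fun z =>
    Real.sqrt (X.unitMetric P z * (dS z.2)⁻¹).det - 1) (farSlab τ₁ τ₂) (𝓝 0))).mul_isBigO hD
  simp only [mul_one] at h2 h3
  have h4 := hf.mul_isLittleO (h2.add (h3.const_mul_left (1 / 4)))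
  simp only [mul_one] at h4
  refine ((isLittleO_one_iff ℝ).1 h4).congr' ?_
  filter_upwards [X.eventually_good P τ₁ τ₂] with z G
  have hz := G.pos
  have hp := dSFactor_pos z.2
  rw [G.neg_det_eq, Real.sqrt_mul (sq_nonneg _), Real.sqrt_sq (by positivity), sqrt_dS_det]
  field_simp
  ring

/-- The integrand converges uniformly on the slab, which has finite measure. -/
theorem tendsto_boundaryTerm (hK : X.IsMannMarolf Khat) :
    Tendsto (X.boundaryTerm Khat τ₁ τ₂) atTop (𝓝 (1 / 4 * X.densityIntegral τ₁ τ₂)) := by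
  rw [densityIntegral, Finset.mul_sum]
  refine tendsto_finsetSum _ fun P _ => ?_
  have hv : MeasureTheory.volume (slab τ₁ τ₂) < ⊤ := (isCompact_slab τ₁ τ₂).measure_lt_top
  have hi : MeasureTheory.IntegrableOn (fun u => 1 / 4 * (Real.sqrt (-(dS u).det) * X.density P u))
      (slab τ₁ τ₂) := by
    refine ContinuousOn.integrableOn_compact (isCompact_slab τ₁ τ₂) ?_
    simp only [sqrt_dS_det]
    exact continuousOn_const.mul ((contDiff_dSFactor (k := 0)).continuous.continuousOn.mul
      (continuousOn_of_patch fun u hu => X.contDiffAt_density P hu))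
  rw [← MeasureTheory.integral_const_mul, Metric.tendsto_nhds]
  intro ε hε
  set m := MeasureTheory.volume.real (slab τ₁ τ₂)
  have hm : 0 ≤ m := MeasureTheory.measureReal_nonneg
  -- The denominator is `m + 1` because the slab has measure zero when `τ₁ = τ₂`.
  have hδ : 0 < ε / (m + 1) := by positivity
  filter_upwards [X.eventually_integrableOn τ₁ τ₂ hK, eventually_of_farSlab τ₁ τ₂
    ((Metric.tendsto_nhds.1 (X.tendsto_integrand P τ₁ τ₂ hK)) _ hδ)] with ρ h1 h2
  rw [dist_eq_norm, ← MeasureTheory.integral_sub (h1 P) hi]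
  refine (MeasureTheory.norm_setIntegral_le_of_norm_le_const hv fun u hu => ?_).trans_lt
    (?_ : ε / (m + 1) * m < ε)
  · have := h2 u hu
    rw [dist_zero_right] at this
    exact this.le
  · rw [div_mul_eq_mul_div, div_lt_iff₀ (by linarith)]
    nlinarith

theorem eventually_bulkTerm : ∀ᶠ ρ₀ in atTop, ∀ ρ ≥ ρ₀, X.bulkTerm τ₁ τ₂ ρ₀ ρ = 0 := by
  obtain ⟨R, hR, h⟩ := X.ricci_flat τ₁ τ₂
  filter_upwards [eventually_gt_atTop R] with ρ₀ h₀ ρ hρ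
  refine Finset.sum_eq_zero fun P _ => ?_
  rw [intervalIntegral.integral_congr (g := fun _ => (0 : ℝ)) fun r hr => ?_,
    intervalIntegral.integral_zero]
  rw [Set.uIcc_of_le hρ] at hr
  refine MeasureTheory.setIntegral_eq_zero_of_forall_eq_zero fun u hu => ?_
  simp [ricciScalar, h P r (h₀.trans_le hr.1) u hu]

theorem tendsto_action (hK : X.IsMannMarolf Khat) (G : ℝ) : ∀ᶠ ρ₀ in atTop,
    Tendsto (fun ρ => X.action G Khat τ₁ τ₂ ρ₀ ρ) atTop
      (𝓝 (1 / (8 * Real.pi * G) * (1 / 4 * X.densityIntegral τ₁ τ₂))) := by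
  filter_upwards [X.eventually_bulkTerm τ₁ τ₂] with ρ₀ h
  refine ((X.tendsto_boundaryTerm τ₁ τ₂ hK).const_mul _).congr' ?_
  filter_upwards [eventually_ge_atTop ρ₀] with ρ hρ
  rw [action, h ρ hρ, mul_zero, zero_add]

end Configuration

end

end MannMarolf

/-! ### Explicit geometry of the unit hyperboloid. -/

namespace MannMarolf

noncomputable section

/-- `f` is differentiable at `x` with partial derivative `d` in the direction `i`. -/
structure HasPd {n : ℕ} (i : Fin n) (f : (Fin n → ℝ) → ℝ) (x : Fin n → ℝ) (d : ℝ) : Prop where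
  diff : DifferentiableAt ℝ f x
  eq : pd i f x = d

namespace HasPd

variable {n : ℕ} {i : Fin n} {f g : (Fin n → ℝ) → ℝ} {x : Fin n → ℝ} {d e : ℝ}

theorem of_diff (h : DifferentiableAt ℝ f x) : HasPd i f x (pd i f x) := ⟨h, rfl⟩

theorem coord (j : Fin n) : HasPd i (fun y => y j) x (if i = j then 1 else 0) :=
  ⟨differentiableAt_apply j x, pd_coord⟩

theorem const (c : ℝ) : HasPd i (fun _ => c) x 0 := ⟨differentiableAt_const c, pd_const c⟩

theorem add (hf : HasPd i f x d) (hg : HasPd i g x e) : HasPd i (fun y => f y + g y) x (d + e) :=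
  ⟨hf.diff.fun_add hg.diff, by rw [pd_add hf.diff hg.diff, hf.eq, hg.eq]⟩

theorem sub (hf : HasPd i f x d) (hg : HasPd i g x e) : HasPd i (fun y => f y - g y) x (d - e) :=
  ⟨hf.diff.fun_sub hg.diff, by rw [pd_sub hf.diff hg.diff, hf.eq, hg.eq]⟩

theorem neg (hf : HasPd i f x d) : HasPd i (fun y => -f y) x (-d) :=
  ⟨hf.diff.fun_neg, by rw [pd_neg, hf.eq]⟩

theorem mul (hf : HasPd i f x d) (hg : HasPd i g x e) :
    HasPd i (fun y => f y * g y) x (d * g x + f x * e) :=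
  ⟨hf.diff.fun_mul hg.diff, by rw [pd_mul hf.diff hg.diff, hf.eq, hg.eq]⟩

theorem const_mul (c : ℝ) (hf : HasPd i f x d) : HasPd i (fun y => c * f y) x (c * d) :=
  ⟨hf.diff.const_mul c, by rw [pd_const_mul c hf.diff, hf.eq]⟩

theorem inv (hf : HasPd i f x d) (h0 : f x ≠ 0) :
    HasPd i (fun y => (f y)⁻¹) x (-d / f x ^ 2) :=
  ⟨hf.diff.fun_inv h0, by rw [pd_inv hf.diff h0, hf.eq]⟩

theorem pow (hf : HasPd i f x d) (m : ℕ) :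
    HasPd i (fun y => f y ^ m) x (m * f x ^ (m - 1) * d) :=
  ⟨hf.diff.fun_pow m, by rw [pd_pow hf.diff, hf.eq]⟩

theorem comp_real {φ : ℝ → ℝ} {φ' : ℝ} (hφ : HasDerivAt φ φ' (f x)) (hf : HasPd i f x d) :
    HasPd i (fun y => φ (f y)) x (φ' * d) :=
  ⟨hφ.differentiableAt.comp x hf.diff, by rw [pd_comp_real hφ hf.diff, hf.eq]⟩

theorem congr (hf : HasPd i f x d) (h : d = e) : HasPd i f x e := h ▸ hf

end HasPd

section DeSitter

/-- Half the logarithmic derivatives of `dSFactor`. -/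
def dSLog (u : Fin 3 → ℝ) : Fin 3 → ℝ :=
  ![Real.tanh (u 0), -2 * u 1 * (1 + u 1 ^ 2 + u 2 ^ 2)⁻¹, -2 * u 2 * (1 + u 1 ^ 2 + u 2 ^ 2)⁻¹]

/-- The Christoffel symbols of `dS`. -/
def dSChristoffel (u : Fin 3 → ℝ) : Fin 3 → Matrix (Fin 3) (Fin 3) ℝ :=
  ![!![0, 0, 0; 0, dSLog u 0 * dSFactor u, 0; 0, 0, dSLog u 0 * dSFactor u],
    !![0, dSLog u 0, 0; dSLog u 0, dSLog u 1, dSLog u 2; 0, dSLog u 2, -dSLog u 1],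
    !![0, 0, dSLog u 0; 0, -dSLog u 2, dSLog u 1; dSLog u 0, dSLog u 1, dSLog u 2]]

variable (u : Fin 3 → ℝ)

theorem hasPd_one_add_sq (i : Fin 3) : HasPd i (fun v => 1 + v 1 ^ 2 + v 2 ^ 2) u
    (![0, 2 * u 1, 2 * u 2] i) := by
  refine (((HasPd.const 1).add ((HasPd.coord 1).pow 2)).add ((HasPd.coord 2).pow 2)).congr ?_
  fin_cases i <;> simp

theorem hasPd_inv_one_add_sq (i : Fin 3) : HasPd i (fun v => (1 + v 1 ^ 2 + v 2 ^ 2)⁻¹) u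
    (![0, dSLog u 1, dSLog u 2] i * (1 + u 1 ^ 2 + u 2 ^ 2)⁻¹) := by
  have h0 := (one_add_sq_pos u).ne'
  refine ((hasPd_one_add_sq u i).inv h0).congr ?_
  fin_cases i <;> simp [dSLog] <;> field_simp

theorem hasPd_tanh (i : Fin 3) :
    HasPd i (fun v => dSLog v 0) u (![1 - dSLog u 0 ^ 2, 0, 0] i) := by
  have hc := (Real.cosh_pos (u 0)).ne'
  refine (HasPd.comp_real (φ := Real.tanh) (f := fun v : Fin 3 → ℝ => v 0) (φ' := 1 - dSLog u 0 ^ 2) ?_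
    (HasPd.coord 0)).congr ?_
  · have h1 := (Real.hasDerivAt_sinh (u 0)).div (Real.hasDerivAt_cosh (u 0)) hc
    have h2 : Real.tanh = Real.sinh / Real.cosh := funext fun x => Real.tanh_eq_sinh_div_cosh x
    rw [h2]
    refine h1.congr_deriv ?_
    simp only [dSLog, Matrix.cons_val_zero, Real.tanh_eq_sinh_div_cosh]
    field_simp
  · fin_cases i <;> simp

theorem hasPd_dSLog_one (i : Fin 3) : HasPd i (fun v => dSLog v 1) u
    (![0, dSLog u 1 ^ 2 - 2 * (1 + u 1 ^ 2 + u 2 ^ 2)⁻¹, dSLog u 1 * dSLog u 2] i) := by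
  refine (((HasPd.coord 1).const_mul (-2)).mul (hasPd_inv_one_add_sq u i)).congr ?_
  fin_cases i <;> simp [dSLog] <;> ring

theorem hasPd_dSLog_two (i : Fin 3) : HasPd i (fun v => dSLog v 2) u
    (![0, dSLog u 1 * dSLog u 2, dSLog u 2 ^ 2 - 2 * (1 + u 1 ^ 2 + u 2 ^ 2)⁻¹] i) := by
  refine (((HasPd.coord 2).const_mul (-2)).mul (hasPd_inv_one_add_sq u i)).congr ?_
  fin_cases i <;> simp [dSLog] <;> ring

theorem hasPd_dSFactor (i : Fin 3) : HasPd i dSFactor u (2 * dSLog u i * dSFactor u) := by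
  have hc := (Real.cosh_pos (u 0)).ne'
  have e : dSFactor = fun v => 4 * Real.cosh (v 0) ^ 2 * (1 + v 1 ^ 2 + v 2 ^ 2)⁻¹ ^ 2 := by
    funext v; rw [dSFactor, inv_pow, div_eq_mul_inv]
  have h1 : HasPd i (fun v : Fin 3 → ℝ => Real.cosh (v 0)) u _ :=
    HasPd.comp_real (Real.hasDerivAt_cosh (u 0)) (HasPd.coord 0)
  rw [e]
  refine (((h1.pow 2).const_mul 4).mul ((hasPd_inv_one_add_sq u i).pow 2)).congr ?_
  fin_cases i <;> simp [dSLog, Real.tanh_eq_sinh_div_cosh] <;> field_simp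

theorem hasPd_inv_dSFactor (i : Fin 3) :
    HasPd i (fun v => (dSFactor v)⁻¹) u (-2 * dSLog u i * (dSFactor u)⁻¹) := by
  have h0 := (dSFactor_pos u).ne'
  refine ((hasPd_dSFactor u i).inv h0).congr ?_
  field_simp

/-- Together with `dSLog_sq_add`, this supplies the curvature of the hyperboloid in the Bochner
identity, with `1 - tanh² = cosh⁻²` written through the conformal factor. -/
theorem one_sub_dSLog_sq : 1 - dSLog u 0 ^ 2 =
    4 * (1 + u 1 ^ 2 + u 2 ^ 2)⁻¹ ^ 2 * (dSFactor u)⁻¹ := by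
  have hc := (Real.cosh_pos (u 0)).ne'
  have h0 := (one_add_sq_pos u).ne'
  have := Real.cosh_sq (u 0)
  simp only [dSLog, Matrix.cons_val_zero, Real.tanh_eq_sinh_div_cosh, dSFactor]
  field_simp
  linarith

theorem dSLog_sq_add : dSLog u 1 ^ 2 + dSLog u 2 ^ 2 =
    4 * (1 + u 1 ^ 2 + u 2 ^ 2)⁻¹ - 4 * (1 + u 1 ^ 2 + u 2 ^ 2)⁻¹ ^ 2 := by
  have h0 := (one_add_sq_pos u).ne'
  simp [dSLog]
  field_simp
  ring

theorem pd_dS (i a b : Fin 3) : pd i (fun v => dS v a b) u =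
    Matrix.diagonal ![0, 2 * dSLog u i * dSFactor u, 2 * dSLog u i * dSFactor u] a b := by
  by_cases hab : a = b
  · subst hab
    simp only [dS_eq, Matrix.diagonal_apply_eq]
    have := (hasPd_dSFactor u i).eq
    fin_cases a
    · simp
    · simpa using this
    · simpa using this
  · simp [dS_eq, Matrix.diagonal_apply_ne _ hab]

theorem christoffel_dS (c a b : Fin 3) : christoffel dS c a b u = dSChristoffel u c a b := by
  have h0 := (dSFactor_pos u).ne'
  simp only [christoffel, Fin.sum_univ_three, pd_dS, dS_inv, dSChristoffel]
  fin_cases c <;> fin_cases a <;> fin_cases b <;> simp <;> field_simp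

end DeSitter

end

end MannMarolf

/-! ### Leibniz and Bochner identities on the hyperboloid. -/

namespace MannMarolf

noncomputable section

section Leibniz

variable {A : Tensor2 3} {s : (Fin 3 → ℝ) → ℝ} {u : Fin 3 → ℝ}

theorem raiseGrad_dS_zero (A : Tensor2 3) (s : (Fin 3 → ℝ) → ℝ) (u : Fin 3 → ℝ) :
    raiseGrad dS A s u 0 = A u 0 0 * pd 0 s u -
      (dSFactor u)⁻¹ * (A u 0 1 * pd 1 s u + A u 0 2 * pd 2 s u) := by
  simp [raiseGrad, dS_inv, Fin.sum_univ_three]; ring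

theorem raiseGrad_dS_one (A : Tensor2 3) (s : (Fin 3 → ℝ) → ℝ) (u : Fin 3 → ℝ) :
    raiseGrad dS A s u 1 = (dSFactor u)⁻¹ *
      ((dSFactor u)⁻¹ * (A u 1 1 * pd 1 s u + A u 1 2 * pd 2 s u) - A u 1 0 * pd 0 s u) := by
  simp [raiseGrad, dS_inv, Fin.sum_univ_three]; ring

theorem raiseGrad_dS_two (A : Tensor2 3) (s : (Fin 3 → ℝ) → ℝ) (u : Fin 3 → ℝ) :
    raiseGrad dS A s u 2 = (dSFactor u)⁻¹ *
      ((dSFactor u)⁻¹ * (A u 2 1 * pd 1 s u + A u 2 2 * pd 2 s u) - A u 2 0 * pd 0 s u) := by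
  simp [raiseGrad, dS_inv, Fin.sum_univ_three]; ring

theorem divVector_dS (J : (Fin 3 → ℝ) → Fin 3 → ℝ) (u : Fin 3 → ℝ) : divVector dS J u =
    pd 0 (fun v => J v 0) u + pd 1 (fun v => J v 1) u + pd 2 (fun v => J v 2) u +
      2 * (dSLog u 0 * J u 0 + dSLog u 1 * J u 1 + dSLog u 2 * J u 2) := by
  simp only [divVector, Fin.sum_univ_three, christoffel_dS, dSChristoffel]
  simp; ring

theorem divTensor_dS (hA : (A u).IsSymm) (a : Fin 3) : divTensor dS A a u =
    (dSFactor u)⁻¹ * (pd 1 (fun v => A v a 1) u + pd 2 (fun v => A v a 2) u) -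
      pd 0 (fun v => A v a 0) u - 2 * dSLog u 0 * A u a 0 -
      (dSFactor u)⁻¹ * dSLog u a * (A u 1 1 + A u 2 2) := by
  have h0 := (dSFactor_pos u).ne'
  simp only [divTensor, Fin.sum_univ_three, christoffel_dS, dSChristoffel, dS_inv]
  have h1 := hA.apply 0 1
  have h2 := hA.apply 0 2
  have h3 := hA.apply 1 2
  fin_cases a <;> simp [h1, h2, h3] <;> field_simp <;> ring

theorem hess_dS (s : (Fin 3 → ℝ) → ℝ) (u : Fin 3 → ℝ) : hess dS s u =
    !![pd 0 (pd 0 s) u, pd 0 (pd 1 s) u - dSLog u 0 * pd 1 s u, pd 0 (pd 2 s) u - dSLog u 0 * pd 2 s u;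
      pd 1 (pd 0 s) u - dSLog u 0 * pd 1 s u, pd 1 (pd 1 s) u - dSLog u 0 * dSFactor u * pd 0 s u -
        dSLog u 1 * pd 1 s u + dSLog u 2 * pd 2 s u,
      pd 1 (pd 2 s) u - dSLog u 2 * pd 1 s u - dSLog u 1 * pd 2 s u;
      pd 2 (pd 0 s) u - dSLog u 0 * pd 2 s u, pd 2 (pd 1 s) u - dSLog u 2 * pd 1 s u -
        dSLog u 1 * pd 2 s u, pd 2 (pd 2 s) u - dSLog u 0 * dSFactor u * pd 0 s u +
        dSLog u 1 * pd 1 s u - dSLog u 2 * pd 2 s u] := by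
  ext a b
  simp only [hess, Matrix.of_apply, Fin.sum_univ_three, christoffel_dS, dSChristoffel]
  fin_cases a <;> fin_cases b <;> simp <;> ring

theorem contract_dS {A B : Mat} (hA : A.IsSymm) (hB : B.IsSymm) : contract (dS u) A B =
    A 0 0 * B 0 0 - 2 * (dSFactor u)⁻¹ * (A 0 1 * B 0 1 + A 0 2 * B 0 2) +
      (dSFactor u)⁻¹ ^ 2 * (A 1 1 * B 1 1 + A 2 2 * B 2 2 + 2 * (A 1 2 * B 1 2)) := by
  simp [contract, Fin.sum_univ_three, dS_inv, hA.apply 0 1, hA.apply 0 2, hA.apply 1 2,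
    hB.apply 0 1, hB.apply 0 2, hB.apply 1 2]
  ring

/-- The Leibniz rule `D_a (A^{ab} s_b) = (D_a A^{ab}) s_b + A^{ab} D_a D_b s`, checked in
coordinates. Symmetry of the derivatives of `A` is a separate hypothesis, since `A` may be symmetric
only on the closed patch. -/
theorem divVector_raiseGrad (hd : ∀ a b, DifferentiableAt ℝ (fun v => A v a b) u)
    (hs : ContDiffAt ℝ 2 s u) (hA : (A u).IsSymm)
    (hdA : ∀ c a b, pd c (fun v => A v a b) u = pd c (fun v => A v b a) u) :
    divVector dS (raiseGrad dS A s) u = -(divTensor dS A 0 u * pd 0 s u) + (dSFactor u)⁻¹ *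
      (divTensor dS A 1 u * pd 1 s u + divTensor dS A 2 u * pd 2 s u) +
      contract (dS u) (hess dS s u) (A u) := by
  have hS : ∀ i j, HasPd i (pd j s) u (pd i (pd j s) u) := fun i j =>
    .of_diff ((hs.pd (k := 1) (by norm_num)).differentiableAt (by norm_num))
  have hA' : ∀ i a b, HasPd i (fun v => A v a b) u (pd i (fun v => A v a b) u) := fun i a b =>
    .of_diff (hd a b)
  have hm := hasPd_inv_dSFactor u
  have e0 := (((hA' 0 0 0).mul (hS 0 0)).sub ((hm 0).mul (((hA' 0 0 1).mul (hS 0 1)).add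
    ((hA' 0 0 2).mul (hS 0 2))))).eq
  have e1 := ((hm 1).mul (((hm 1).mul (((hA' 1 1 1).mul (hS 1 1)).add
    ((hA' 1 1 2).mul (hS 1 2)))).sub ((hA' 1 1 0).mul (hS 1 0)))).eq
  have e2 := ((hm 2).mul (((hm 2).mul (((hA' 2 2 1).mul (hS 2 1)).add
    ((hA' 2 2 2).mul (hS 2 2)))).sub ((hA' 2 2 0).mul (hS 2 0)))).eq
  have h0 := (dSFactor_pos u).ne'
  have hH : (hess dS s u).IsSymm := hess_symm hs fun c a b => by
    rw [show (fun u => dS u a b) = fun u => dS u b a from funext fun v => (dS_symm v).apply b a]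
  simp only [divVector_dS, raiseGrad_dS_zero, raiseGrad_dS_one, raiseGrad_dS_two, e0, e1, e2,
    divTensor_dS hA]
  rw [contract_dS hH hA, hess_dS]
  simp only [hA.apply 0 1, hA.apply 0 2, hA.apply 1 2, hdA _ 1 0, hdA _ 2 0, hdA _ 2 1,
    pd_comm (i := 1) (j := 0) hs, pd_comm (i := 2) (j := 0) hs, pd_comm (i := 2) (j := 1) hs]
  simp
  field_simp
  ring

/-- The Bochner identity `D^b (D_a D_b s + s h_{ab}) = D_a (D^b D_b s + 3 s)`. -/
theorem divTensor_hess (hs : ContDiff ℝ ∞ s) (hE : ∀ i, pd i (fun v => -pd 0 (pd 0 s) v +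
      (dSFactor v)⁻¹ * (pd 1 (pd 1 s) v + pd 2 (pd 2 s) v) - 2 * (dSLog v 0 * pd 0 s v) + 3 * s v) u = 0)
    (a : Fin 3) : divTensor dS (fun v => hess dS s v + s v • dS v) a u = 0 := by
  have hs1 : ∀ i, ContDiff ℝ ∞ (pd i s) := fun i =>
    contDiff_iff_contDiffAt.2 fun v => hs.contDiffAt.pd (by simp)
  have hs2 : ∀ i j, ContDiff ℝ ∞ (pd i (pd j s)) := fun i j =>
    contDiff_iff_contDiffAt.2 fun v => (hs1 j).contDiffAt.pd (by simp)
  have d0 : ∀ i, HasPd i s u (pd i s u) := fun i => .of_diff (hs.contDiffAt.differentiableAt (by simp))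
  have d1 : ∀ i j, HasPd i (pd j s) u (pd i (pd j s) u) := fun i j =>
    .of_diff ((hs1 j).contDiffAt.differentiableAt (by simp))
  have d2 : ∀ i j k, HasPd i (pd j (pd k s)) u (pd i (pd j (pd k s)) u) := fun i j k =>
    .of_diff ((hs2 j k).contDiffAt.differentiableAt (by simp))
  have hc : ∀ i j, pd i (pd j s) = pd j (pd i s) := fun i j => funext fun v =>
    pd_comm (hs.contDiffAt.of_le ENat.LEInfty.out)
  have hc1 : ∀ i j k, pd i (pd j (pd k s)) = pd j (pd i (pd k s)) := fun i j k => funext fun v =>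
    pd_comm ((hs1 k).contDiffAt.of_le ENat.LEInfty.out)
  have hm := hasPd_inv_dSFactor u
  have hf := hasPd_dSFactor u
  have t0 := hasPd_tanh u
  have t1 := hasPd_dSLog_one u
  have t2 := hasPd_dSLog_two u
  -- The differentiated field equation, expanded in third derivatives of `s`, to be matched with the
  -- divergence below.
  have e : ∀ i, _ := fun i => ((((d2 i 0 0).neg.add ((hm i).mul ((d2 i 1 1).add (d2 i 2 2)))).sub
    (((t0 i).mul (d1 i 0)).const_mul 2)).add ((d0 i).const_mul 3)).eq.symm.trans (hE i)
  have hH : (hess dS s u + s u • dS u).IsSymm := by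
    refine Matrix.IsSymm.add (hess_symm (hs.contDiffAt.of_le ENat.LEInfty.out) fun c a b => ?_)
      ((dS_symm u).smul _)
    rw [show (fun u => dS u a b) = fun u => dS u b a from funext fun v => (dS_symm v).apply b a]
  have c : ∀ {i a b : Fin 3} {F : (Fin 3 → ℝ) → ℝ} {d : ℝ}, HasPd i F u d →
      (∀ v, hess dS s v a b + s v * dS v a b = F v) →
      pd i (fun v => (hess dS s v + s v • dS v) a b) u = d := fun h hF => by
    rw [← h.eq]
    exact congrArg (fun F => pd _ F u) (funext hF)
  have B00 := c (a := 0) (b := 0) ((d2 0 0 0).sub (d0 0)) fun v => by simp [hess_dS, dS_eq]; ring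
  have B10 := c (a := 1) (b := 0) ((d2 0 1 0).sub ((t0 0).mul (d1 0 1))) fun v => by
    simp [hess_dS, dS_eq]
  have B20 := c (a := 2) (b := 0) ((d2 0 2 0).sub ((t0 0).mul (d1 0 2))) fun v => by
    simp [hess_dS, dS_eq]
  have B01 := c (a := 0) (b := 1) ((d2 1 0 1).sub ((t0 1).mul (d1 1 1))) fun v => by
    simp [hess_dS, dS_eq]
  have B02 := c (a := 0) (b := 2) ((d2 2 0 2).sub ((t0 2).mul (d1 2 2))) fun v => by
    simp [hess_dS, dS_eq]
  have B11 := c (a := 1) (b := 1) (((((d2 1 1 1).sub (((t0 1).mul (hf 1)).mul (d1 1 0))).sub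
    ((t1 1).mul (d1 1 1))).add ((t2 1).mul (d1 1 2))).add ((d0 1).mul (hf 1))) fun v => by
    simp [hess_dS, dS_eq]
  have B22 := c (a := 2) (b := 2) (((((d2 2 2 2).sub (((t0 2).mul (hf 2)).mul (d1 2 0))).add
    ((t1 2).mul (d1 2 1))).sub ((t2 2).mul (d1 2 2))).add ((d0 2).mul (hf 2))) fun v => by
    simp [hess_dS, dS_eq]
  have B12 := c (a := 1) (b := 2) (((d2 2 1 2).sub ((t2 2).mul (d1 2 1))).sub
    ((t1 2).mul (d1 2 2))) fun v => by simp [hess_dS, dS_eq]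
  have B21 := c (a := 2) (b := 1) (((d2 1 2 1).sub ((t2 1).mul (d1 1 1))).sub
    ((t1 1).mul (d1 1 2))) fun v => by simp [hess_dS, dS_eq]
  have h0 := (dSFactor_pos u).ne'
  -- Commuting covariant derivatives produces the Ricci tensor `2 h⁽⁰⁾`. In coordinates this amounts
  -- to these two relations among the logarithmic derivatives, needed only for the spatial
  -- components.
  have r1 := one_sub_dSLog_sq u
  have r2 := dSLog_sq_add u
  rw [divTensor_dS hH]
  have e0 := e 0
  have e1 := e 1
  have e2 := e 2
  clear e c hE t0 t1 t2 hm hf d0 d1 d2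
  generalize (1 + u 1 ^ 2 + u 2 ^ 2)⁻¹ = n at *
  fin_cases a
  · simp only [Fin.zero_eta, B00, B01, B02]
    simp [hess_dS, dS_eq, hc 1 0, hc 2 0, hc 2 1, hc1 1 0, hc1 2 0] at e0 ⊢
    field_simp at e0 ⊢
    linear_combination e0
  · simp only [Fin.mk_one, B10, B11, B12]
    simp [hess_dS, dS_eq, hc 1 0, hc 2 0, hc 2 1, hc1 1 0, hc1 2 1] at e1 ⊢
    field_simp at e1 r1 ⊢
    linear_combination e1 - pd 1 s u * r1 - pd 1 s u * r2
  · simp only [Fin.reduceFinMk, B20, B21, B22]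
    simp [hess_dS, dS_eq, hc 1 0, hc 2 0, hc 2 1, hc1 2 0, hc1 2 1] at e2 ⊢
    field_simp at e2 r1 ⊢
    linear_combination e2 - pd 2 s u * r1 - pd 2 s u * r2

end Leibniz

end

end MannMarolf

/-! ### The density as the divergence of the current. -/

namespace MannMarolf

noncomputable section

theorem contDiffAt_raiseGrad {A : Tensor2 3} {s : (Fin 3 → ℝ) → ℝ} {u : Fin 3 → ℝ}
    (hA : ∀ a b, ContDiffAt ℝ ∞ (fun v => A v a b) u) (hs : ContDiffAt ℝ ∞ s u) (a : Fin 3) :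
    ContDiffAt ℝ ∞ (fun v => raiseGrad dS A s v a) u :=
  ContDiffAt.sum fun b _ => ContDiffAt.sum fun c _ => ContDiffAt.sum fun d _ =>
    (((Configuration.contDiffAt_dS_inv u a c).mul (Configuration.contDiffAt_dS_inv u b d)).mul
      (hA c d)).mul (hs.pd (by simp))

theorem divVector_sub {J L : (Fin 3 → ℝ) → Fin 3 → ℝ} {u : Fin 3 → ℝ}
    (hJ : ∀ a, DifferentiableAt ℝ (fun v => J v a) u)
    (hL : ∀ a, DifferentiableAt ℝ (fun v => L v a) u) :
    divVector dS (fun v a => J v a - L v a) u = divVector dS J u - divVector dS L u := by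
  simp only [divVector_dS, pd_sub (hJ _) (hL _)]
  ring

namespace Configuration

variable (X : Configuration) (P : Fin 2)

/-- `D_a D_b σ + σ h_{ab}`. -/
def hessShift : Tensor2 3 := fun v => hess dS (X.σ P) v + X.σ P v • dS v

theorem contDiff_hessShift (a b : Fin 3) : ContDiff ℝ ∞ (fun v => X.hessShift P v a b) :=
  (X.contDiff_hess P a b).add ((X.σ_smooth P).mul (contDiff_dS a b))

theorem hessShift_symm (u : Fin 3 → ℝ) : (X.hessShift P u).IsSymm :=
  (X.hess_dS_symm P u).add ((dS_symm u).smul _)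

theorem current_eq : X.current P = fun u a =>
    raiseGrad dS (X.k P) (X.σ P) u a - raiseGrad dS (X.hessShift P) (X.σ P) u a := by
  funext u a
  simp only [current, raiseGrad, hessShift, ← Finset.sum_sub_distrib, Matrix.sub_apply,
    Matrix.add_apply]
  refine Finset.sum_congr rfl fun b _ => Finset.sum_congr rfl fun c _ =>
    Finset.sum_congr rfl fun d _ => ?_
  ring

theorem contDiffAt_raiseGrad_k {u : Fin 3 → ℝ} (hu : u ∈ patch) (a : Fin 3) :
    ContDiffAt ℝ ∞ (fun v => raiseGrad dS (X.k P) (X.σ P) v a) u :=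
  contDiffAt_raiseGrad (X.k_smooth P u hu) (X.σ_smooth P).contDiffAt a

theorem contDiff_raiseGrad_hessShift (a : Fin 3) :
    ContDiff ℝ ∞ (fun v => raiseGrad dS (X.hessShift P) (X.σ P) v a) :=
  contDiff_iff_contDiffAt.2 fun _ => contDiffAt_raiseGrad
    (fun a b => (X.contDiff_hessShift P a b).contDiffAt) (X.σ_smooth P).contDiffAt a

theorem contDiffAt_current {u : Fin 3 → ℝ} (hu : u ∈ patch) (a : Fin 3) :
    ContDiffAt ℝ ∞ (fun v => X.current P v a) u := by
  rw [current_eq]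
  exact (X.contDiffAt_raiseGrad_k P hu a).sub (X.contDiff_raiseGrad_hessShift P a).contDiffAt

theorem box_σ {u : Fin 3 → ℝ} (hu : u ∈ patch) : -pd 0 (pd 0 (X.σ P)) u + (dSFactor u)⁻¹ *
    (pd 1 (pd 1 (X.σ P)) u + pd 2 (pd 2 (X.σ P)) u) - 2 * (dSLog u 0 * pd 0 (X.σ P) u) +
      3 * X.σ P u = 0 := by
  have h := X.σMix_trace P hu
  have h0 := (dSFactor_pos u).ne'
  simp only [σMix, Matrix.trace, Matrix.diag_apply, Matrix.mul_apply, Fin.sum_univ_three, dS_inv,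
    hess_dS] at h
  simp at h
  field_simp at h ⊢
  linear_combination h

/-- The equation of motion holds on the closed patch, so its derivatives vanish there up to the
equator, and the Bochner identity applies. -/
theorem divTensor_hessShift {u : Fin 3 → ℝ} (hu : u ∈ patch) (a : Fin 3) :
    divTensor dS (X.hessShift P) a u = 0 := by
  refine divTensor_hess (X.σ_smooth P) (fun i => ?_) a
  have d1 : ∀ i, DifferentiableAt ℝ (pd i (X.σ P)) u := fun i =>
    ((X.σ_smooth P).contDiffAt.pd (k := ∞) (by simp)).differentiableAt (by simp)
  have d2 : ∀ i j, DifferentiableAt ℝ (pd i (pd j (X.σ P))) u := fun i j =>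
    (((X.σ_smooth P).contDiffAt.pd (k := ∞) (by simp)).pd (k := ∞) (by simp)).differentiableAt
      (by simp)
  exact pd_eq_zero_of_eqOn_slab (by linarith) (exists_slab_of_mem_patch hu)
    (((((d2 0 0).fun_neg).fun_add ((hasPd_inv_dSFactor u 0).diff.fun_mul
      ((d2 1 1).fun_add (d2 2 2)))).fun_sub
      (((hasPd_tanh u 0).diff.fun_mul (d1 0)).const_mul 2)).fun_add
        (((X.σ_smooth P).contDiffAt.differentiableAt (by simp)).const_mul 3))
    (fun v hv => X.box_σ P (slab_subset_patch _ _ hv)) i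

theorem pd_k_symm {u : Fin 3 → ℝ} (hu : u ∈ patch) (c a b : Fin 3) :
    pd c (fun v => X.k P v a b) u = pd c (fun v => X.k P v b a) u := by
  have hd : ∀ a b, DifferentiableAt ℝ (fun v => X.k P v a b) u := fun a b =>
    (X.k_smooth P u hu a b).differentiableAt (by simp)
  have := pd_eq_zero_of_eqOn_slab (by linarith) (exists_slab_of_mem_patch hu)
    ((hd a b).fun_sub (hd b a)) (fun v hv => sub_eq_zero.2
      ((X.k_symm P v (slab_subset_patch _ _ hv)).apply b a)) c
  rwa [pd_sub (hd a b) (hd b a), sub_eq_zero] at this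

/-- Both parts of the current come from divergence-free tensors, so only contractions with `DDσ`
survive. The equation of motion turns `-σ D_a D^a σ` into `3 σ²`. -/
theorem density_eq_divVector {u : Fin 3 → ℝ} (hu : u ∈ patch) :
    X.density P u = divVector dS (X.current P) u := by
  have hs : ContDiffAt ℝ 2 (X.σ P) u := (X.σ_smooth P).contDiffAt.of_le ENat.LEInfty.out
  rw [current_eq, divVector_sub
    (fun a => (X.contDiffAt_raiseGrad_k P hu a).differentiableAt (by simp))
    (fun a => (X.contDiff_raiseGrad_hessShift P a).contDiffAt.differentiableAt (by simp)),
    divVector_raiseGrad (fun a b => (X.k_smooth P u hu a b).differentiableAt (by simp)) hs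
      (X.k_symm P u hu) (X.pd_k_symm P hu),
    divVector_raiseGrad (fun a b => (X.contDiff_hessShift P a b).contDiffAt.differentiableAt (by simp))
      hs (X.hessShift_symm P u) fun c a b => congrArg (fun F => pd c F u)
        (funext fun v => (X.hessShift_symm P v).apply b a)]
  simp only [X.k_div P u hu, X.divTensor_hessShift P hu]
  have h := X.box_σ P hu
  have h0 := (dSFactor_pos u).ne'
  have hH := X.hess_dS_symm P u
  rw [density, contract_dS hH (X.k_symm P u hu), contract_dS hH hH,
    contract_dS hH (X.hessShift_symm P u)]
  simp only [hessShift, hess_dS, dS_eq]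
  simp
  field_simp at h ⊢
  linear_combination dSFactor u * X.σ P u * h

end Configuration

end

end MannMarolf

/-! ### Integrals over slabs as iterated integrals over time and the disc. -/

namespace MannMarolf

noncomputable section

open MeasureTheory

section Divergence

/-- The closed unit disc, the range of the coordinates `w` of a patch. -/
def unitDisc : Set (ℝ × ℝ) := {w | w.1 ^ 2 + w.2 ^ 2 ≤ 1}

theorem isCompact_unitDisc : IsCompact unitDisc := by
  refine Metric.isCompact_of_isClosed_isBounded (isClosed_le (by fun_prop) continuous_const) ?_
  refine (Metric.isBounded_Icc ((-1, -1) : ℝ × ℝ) (1, 1)).subset ?_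
  rintro ⟨p, q⟩ (h : p ^ 2 + q ^ 2 ≤ 1)
  refine ⟨⟨?_, ?_⟩, ⟨?_, ?_⟩⟩ <;> simp only <;> nlinarith [sq_nonneg p, sq_nonneg q]

/-- The point of a patch with coordinates `(t, w)`. -/
def mkPoint (x : ℝ × (ℝ × ℝ)) : Fin 3 → ℝ := ![x.1, x.2.1, x.2.2]

theorem continuous_mkPoint : Continuous mkPoint :=
  continuous_pi fun i => by fin_cases i <;> simp [mkPoint] <;> fun_prop

theorem measurePreserving_mkPoint : MeasurePreserving mkPoint ∧ MeasurableEmbedding mkPoint := by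
  have h1 := ((MeasurePreserving.id (volume : Measure ℝ)).prod
    (volume_preserving_finTwoArrow ℝ).symm)
  have h2 := (volume_preserving_piFinSuccAbove (fun _ : Fin 3 => ℝ) 0).symm
  have e : mkPoint = (MeasurableEquiv.piFinSuccAbove (fun _ : Fin 3 => ℝ) 0).symm ∘
      Prod.map id (MeasurableEquiv.finTwoArrow (α := ℝ)).symm := by
    funext x i
    fin_cases i <;> rfl
  constructor
  · rw [e]
    exact h2.comp h1
  · rw [e]
    exact (MeasurableEquiv.measurableEmbedding _).comp
      ((MeasurableEquiv.prodCongr (MeasurableEquiv.refl ℝ)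
        (MeasurableEquiv.finTwoArrow (α := ℝ)).symm).measurableEmbedding)

theorem mkPoint_mem_slab {τ₁ τ₂ : ℝ} : mkPoint ⁻¹' slab τ₁ τ₂ = Set.Icc τ₁ τ₂ ×ˢ unitDisc := by
  ext x
  simp [slab, unitDisc, mkPoint, and_assoc]

theorem setIntegral_slab (τ₁ τ₂ : ℝ) (g : (Fin 3 → ℝ) → ℝ) :
    ∫ u in slab τ₁ τ₂, g u = ∫ x in Set.Icc τ₁ τ₂ ×ˢ unitDisc, g (mkPoint x) := by
  rw [← mkPoint_mem_slab, measurePreserving_mkPoint.1.setIntegral_preimage_emb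
    measurePreserving_mkPoint.2]

theorem mkPoint_mem_patch {x : ℝ × (ℝ × ℝ)} (hx : x.2 ∈ unitDisc) : mkPoint x ∈ patch := hx

theorem integrableOn_mkPoint {g : (Fin 3 → ℝ) → ℝ} (hg : ∀ u ∈ patch, ContinuousAt g u) (τ₁ τ₂ : ℝ) :
    IntegrableOn (fun x => g (mkPoint x)) (Set.Icc τ₁ τ₂ ×ˢ unitDisc) :=
  ContinuousOn.integrableOn_compact (isCompact_Icc.prod isCompact_unitDisc) fun _ hx =>
    ((hg _ (mkPoint_mem_patch hx.2)).comp continuous_mkPoint.continuousAt).continuousWithinAt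

theorem setIntegral_slab_eq_time {g : (Fin 3 → ℝ) → ℝ} (hg : ∀ u ∈ patch, ContinuousAt g u)
    {τ₁ τ₂ : ℝ} (h : τ₁ ≤ τ₂) :
    ∫ u in slab τ₁ τ₂, g u = ∫ t in τ₁..τ₂, ∫ w in unitDisc, g ![t, w.1, w.2] := by
  rw [setIntegral_slab, Measure.volume_eq_prod, setIntegral_prod _ (integrableOn_mkPoint hg τ₁ τ₂),
    integral_Icc_eq_integral_Ioc, intervalIntegral.integral_of_le h]
  rfl

theorem setIntegral_slab_eq_disc {g : (Fin 3 → ℝ) → ℝ} (hg : ∀ u ∈ patch, ContinuousAt g u)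
    {τ₁ τ₂ : ℝ} (h : τ₁ ≤ τ₂) :
    ∫ u in slab τ₁ τ₂, g u = ∫ w in unitDisc, ∫ t in τ₁..τ₂, g ![t, w.1, w.2] := by
  have hi := integrableOn_mkPoint hg τ₁ τ₂
  rw [setIntegral_slab, Measure.volume_eq_prod, ← setIntegral_prod_swap,
    setIntegral_prod _ (by rw [Measure.volume_eq_prod] at hi; exact hi.swap)]
  simp only [intervalIntegral.integral_of_le h, integral_Icc_eq_integral_Ioc]
  rfl

theorem fderiv_apply_eq_sum {n : ℕ} (F : (Fin n → ℝ) → ℝ) (u v : Fin n → ℝ) :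
    fderiv ℝ F u v = ∑ i, v i * pd i F u := by
  conv_lhs => rw [pi_eq_sum_univ' v]
  simp [pd, map_sum]

end Divergence

end

end MannMarolf

/-! ### Polar coordinates and the divergence theorem on the disc. -/

namespace MannMarolf

noncomputable section

open MeasureTheory

section Polar

/-- The point of a patch at time `t` with polar coordinates `y` in the disc. -/
def polarPoint (t : ℝ) (y : ℝ × ℝ) : Fin 3 → ℝ :=
  ![t, y.1 * Real.cos y.2, y.1 * Real.sin y.2]

theorem continuous_polarPoint (t : ℝ) : Continuous (polarPoint t) :=
  continuous_pi fun i => by fin_cases i <;> simp [polarPoint] <;> fun_prop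

theorem polarPoint_mem_patch {t : ℝ} {y : ℝ × ℝ} (h0 : 0 ≤ y.1) (h1 : y.1 ≤ 1) :
    polarPoint t y ∈ patch := by
  have h2 : polarPoint t y 1 ^ 2 + polarPoint t y 2 ^ 2 = y.1 ^ 2 := by
    simp only [polarPoint, Matrix.cons_val_one, Matrix.cons_val_zero, Matrix.cons_val]
    linear_combination y.1 ^ 2 * Real.sin_sq_add_cos_sq y.2
  rw [patch, Set.mem_ofPred_eq, h2]
  nlinarith

theorem continuousOn_polarPoint {g : (Fin 3 → ℝ) → ℝ} (hg : ∀ u ∈ patch, ContinuousAt g u)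
    (t a b : ℝ) : ContinuousOn (fun y => g (polarPoint t y)) (Set.Icc 0 1 ×ˢ Set.Icc a b) :=
  fun _ hy => ((hg _ (polarPoint_mem_patch hy.1.1 hy.1.2)).comp
    (continuous_polarPoint t).continuousAt).continuousWithinAt

theorem setIntegral_unitDisc {g : (Fin 3 → ℝ) → ℝ} (hg : ∀ u ∈ patch, ContinuousAt g u) (t : ℝ) :
    ∫ w in unitDisc, g ![t, w.1, w.2] =
      ∫ r in (0 : ℝ)..1, ∫ s in -Real.pi..Real.pi, r * g (polarPoint t (r, s)) := by
  have hpi : -Real.pi ≤ Real.pi := by linarith [Real.pi_pos]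
  have hS : Set.Ioc (0 : ℝ) 1 ×ˢ Set.Ioo (-Real.pi) Real.pi ⊆
      Set.Icc 0 1 ×ˢ Set.Icc (-Real.pi) Real.pi :=
    Set.prod_mono Set.Ioc_subset_Icc_self Set.Ioo_subset_Icc_self
  have hi : IntegrableOn (fun y : ℝ × ℝ => y.1 * g (polarPoint t y))
      (Set.Ioc (0 : ℝ) 1 ×ˢ Set.Ioo (-Real.pi) Real.pi) :=
    (ContinuousOn.integrableOn_compact (isCompact_Icc.prod isCompact_Icc)
      (continuous_fst.continuousOn.mul (continuousOn_polarPoint hg t _ _))).mono_set hS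
  have e : ∀ p ∈ polarCoord.target, p.1 • Set.indicator unitDisc
      (fun w : ℝ × ℝ => g ![t, w.1, w.2]) (polarCoord.symm p) =
      Set.indicator (Set.Ioc (0 : ℝ) 1 ×ˢ Set.Ioo (-Real.pi) Real.pi)
        (fun y : ℝ × ℝ => y.1 * g (polarPoint t y)) p := by
    rintro ⟨r, s⟩ ⟨hr, hs⟩
    have hr' : (0 : ℝ) < r := hr
    have hm : polarCoord.symm (r, s) ∈ unitDisc ↔ (r, s) ∈ Set.Ioc (0 : ℝ) 1 ×ˢ
        Set.Ioo (-Real.pi) Real.pi := by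
      have h2 : (r * Real.cos s) ^ 2 + (r * Real.sin s) ^ 2 = r ^ 2 := by
        linear_combination r ^ 2 * Real.sin_sq_add_cos_sq s
      change (r * Real.cos s) ^ 2 + (r * Real.sin s) ^ 2 ≤ 1 ↔ _
      rw [h2]
      exact ⟨fun h => ⟨⟨hr', by nlinarith⟩, hs⟩, fun h => by
        have : r ≤ 1 := h.1.2
        nlinarith⟩
    by_cases h : (r, s) ∈ Set.Ioc (0 : ℝ) 1 ×ˢ Set.Ioo (-Real.pi) Real.pi
    · rw [Set.indicator_of_mem h, Set.indicator_of_mem (hm.2 h)]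
      rfl
    · rw [Set.indicator_of_notMem h, Set.indicator_of_notMem (fun h' => h (hm.1 h')), smul_zero]
  have hsub : Set.Ioc (0 : ℝ) 1 ×ˢ Set.Ioo (-Real.pi) Real.pi ⊆ polarCoord.target :=
    Set.prod_mono Set.Ioc_subset_Ioi_self subset_rfl
  rw [← integral_indicator isCompact_unitDisc.measurableSet, ← integral_comp_polarCoord_symm,
    setIntegral_congr_fun polarCoord.open_target.measurableSet e,
    setIntegral_indicator (measurableSet_Ioc.prod measurableSet_Ioo),
    Set.inter_eq_self_of_subset_right hsub, Measure.volume_eq_prod,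
    setIntegral_prod _ (by rwa [Measure.volume_eq_prod] at hi),
    intervalIntegral.integral_of_le zero_le_one]
  simp only [intervalIntegral.integral_of_le hpi, integral_Ioc_eq_integral_Ioo]

theorem hasFDerivAt_polarPoint {F : (Fin 3 → ℝ) → ℝ} {t : ℝ} {y : ℝ × ℝ}
    (hF : DifferentiableAt ℝ F (polarPoint t y)) :
    HasFDerivAt (fun y => F (polarPoint t y))
      (pd 1 F (polarPoint t y) • (Real.cos y.2 • ContinuousLinearMap.fst ℝ ℝ ℝ -
          (y.1 * Real.sin y.2) • ContinuousLinearMap.snd ℝ ℝ ℝ) +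
        pd 2 F (polarPoint t y) • (Real.sin y.2 • ContinuousLinearMap.fst ℝ ℝ ℝ +
          (y.1 * Real.cos y.2) • ContinuousLinearMap.snd ℝ ℝ ℝ)) y := by
  have h1 : HasFDerivAt (polarPoint t) (ContinuousLinearMap.pi
      ![0, Real.cos y.2 • ContinuousLinearMap.fst ℝ ℝ ℝ -
          (y.1 * Real.sin y.2) • ContinuousLinearMap.snd ℝ ℝ ℝ,
        Real.sin y.2 • ContinuousLinearMap.fst ℝ ℝ ℝ +
          (y.1 * Real.cos y.2) • ContinuousLinearMap.snd ℝ ℝ ℝ]) y := by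
    rw [hasFDerivAt_pi']
    intro i
    have f1 : HasFDerivAt (fun y : ℝ × ℝ => y.1) (ContinuousLinearMap.fst ℝ ℝ ℝ) y := hasFDerivAt_fst
    have f2 : HasFDerivAt (fun y : ℝ × ℝ => y.2) (ContinuousLinearMap.snd ℝ ℝ ℝ) y := hasFDerivAt_snd
    fin_cases i
    · exact hasFDerivAt_const t y
    · refine (f1.mul f2.cos).congr_fderiv ?_
      ext <;> simp
    · refine (f1.mul f2.sin).congr_fderiv ?_
      ext <;> simp
  refine (hF.hasFDerivAt.comp y h1).congr_fderiv ?_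
  ext <;> simp [fderiv_apply_eq_sum, Fin.sum_univ_three] <;> ring

theorem integral_divergence_rectangle {f g D : ℝ × ℝ → ℝ} {f' g' : ℝ × ℝ → ℝ × ℝ →L[ℝ] ℝ} {a b : ℝ}
    (hab : a ≤ b) (hf : ContinuousOn f (Set.Icc 0 1 ×ˢ Set.Icc a b))
    (hg : ContinuousOn g (Set.Icc 0 1 ×ˢ Set.Icc a b))
    (hf' : ∀ y : ℝ × ℝ, 0 < y.1 → y.1 < 1 → HasFDerivAt f (f' y) y)
    (hg' : ∀ y : ℝ × ℝ, 0 < y.1 → y.1 < 1 → HasFDerivAt g (g' y) y)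
    (hD : ContinuousOn D (Set.Icc 0 1 ×ˢ Set.Icc a b))
    (e : ∀ y, f' y (1, 0) + g' y (0, 1) = D y) :
    ∫ r in (0 : ℝ)..1, ∫ s in a..b, D (r, s) =
      (∫ r in (0 : ℝ)..1, g (r, b)) - (∫ r in (0 : ℝ)..1, g (r, a)) + (∫ s in a..b, f (1, s)) -
        ∫ s in a..b, f (0, s) := by
  have := integral2_divergence_prod_of_hasFDerivAt f g f' g' 0 a 1 b
  rw [Set.uIcc_of_le zero_le_one, Set.uIcc_of_le hab, min_eq_left zero_le_one,
    max_eq_right zero_le_one] at this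
  simp only [e] at this
  exact this hf hg (fun y hy => hf' y hy.1.1 hy.1.2) (fun y hy => hg' y hy.1.1 hy.1.2)
    (hD.integrableOn_compact (isCompact_Icc.prod isCompact_Icc))

/-- The divergence theorem on the unit disc. -/
theorem integral_divergence_unitDisc {F G : (Fin 3 → ℝ) → ℝ}
    (hF : ∀ u ∈ patch, ContDiffAt ℝ 1 F u) (hG : ∀ u ∈ patch, ContDiffAt ℝ 1 G u) (t : ℝ) :
    ∫ w in unitDisc, (pd 1 F ![t, w.1, w.2] + pd 2 G ![t, w.1, w.2]) =
      ∫ s in (0 : ℝ)..2 * Real.pi, (Real.cos s * F ![t, Real.cos s, Real.sin s] +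
        Real.sin s * G ![t, Real.cos s, Real.sin s]) := by
  have hpi : -Real.pi ≤ Real.pi := by linarith [Real.pi_pos]
  have hd : ∀ {F : (Fin 3 → ℝ) → ℝ}, (∀ u ∈ patch, ContDiffAt ℝ 1 F u) → ∀ i, ∀ u ∈ patch,
      ContinuousAt (pd i F) u := fun h i u hu => ((h u hu).pd (k := 0) (by norm_num)).continuousAt
  have hdiv : ∀ u ∈ patch, ContinuousAt (fun u => pd 1 F u + pd 2 G u) u := fun u hu =>
    (hd hF 1 u hu).add (hd hG 2 u hu)
  have cF := continuousOn_polarPoint (fun u hu => (hF u hu).continuousAt) t (-Real.pi) Real.pi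
  have cG := continuousOn_polarPoint (fun u hu => (hG u hu).continuousAt) t (-Real.pi) Real.pi
  have c1 : ∀ S : Set (ℝ × ℝ), ContinuousOn (fun y : ℝ × ℝ => Real.cos y.2) S := fun S => by fun_prop
  have c2 : ∀ S : Set (ℝ × ℝ), ContinuousOn (fun y : ℝ × ℝ => Real.sin y.2) S := fun S => by fun_prop
  have f1 : ∀ y : ℝ × ℝ, HasFDerivAt (fun y : ℝ × ℝ => y.1) (ContinuousLinearMap.fst ℝ ℝ ℝ) y :=
    fun _ => hasFDerivAt_fst
  have f2 : ∀ y : ℝ × ℝ, HasFDerivAt (fun y : ℝ × ℝ => y.2) (ContinuousLinearMap.snd ℝ ℝ ℝ) y :=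
    fun _ => hasFDerivAt_snd
  have dF : ∀ y : ℝ × ℝ, 0 < y.1 → y.1 < 1 → _ := fun y h0 h1 => hasFDerivAt_polarPoint (t := t)
    (y := y) ((hF _ (polarPoint_mem_patch h0.le h1.le)).differentiableAt (by norm_num))
  have dG : ∀ y : ℝ × ℝ, 0 < y.1 → y.1 < 1 → _ := fun y h0 h1 => hasFDerivAt_polarPoint (t := t)
    (y := y) ((hG _ (polarPoint_mem_patch h0.le h1.le)).differentiableAt (by norm_num))
  -- In polar coordinates the Cartesian divergence times `r` is `∂_r (r V_r) + ∂_s V_s`. On the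
  -- rectangle the edge `r = 0` contributes nothing because of the factor `r`, and the edges `s =
  -- ±π` cancel.
  rw [setIntegral_unitDisc hdiv t, integral_divergence_rectangle
    (f := fun y => y.1 * (Real.cos y.2 * F (polarPoint t y) + Real.sin y.2 * G (polarPoint t y)))
    (g := fun y => Real.cos y.2 * G (polarPoint t y) - Real.sin y.2 * F (polarPoint t y))
    (D := fun y => y.1 * (pd 1 F (polarPoint t y) + pd 2 G (polarPoint t y))) hpi
    (continuous_fst.continuousOn.mul (((c1 _).mul cF).add ((c2 _).mul cG)))
    (((c1 _).mul cG).sub ((c2 _).mul cF))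
    (fun y h0 h1 => (f1 y).mul (((f2 y).cos.mul (dF y h0 h1)).add ((f2 y).sin.mul (dG y h0 h1))))
    (fun y h0 h1 => ((f2 y).cos.mul (dG y h0 h1)).sub ((f2 y).sin.mul (dF y h0 h1)))
    (continuous_fst.continuousOn.mul (continuousOn_polarPoint hdiv t _ _)) fun y => ?_]
  -- Periodicity moves the angular range from `[-π, π]` to `[0, 2π]`.
  · have hper : Function.Periodic (fun s => Real.cos s * F ![t, Real.cos s, Real.sin s] +
        Real.sin s * G ![t, Real.cos s, Real.sin s]) (2 * Real.pi) := fun s => by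
      simp only [Real.cos_add_two_pi, Real.sin_add_two_pi]
    have h2 := hper.intervalIntegral_add_eq (-Real.pi) 0
    rw [show -Real.pi + 2 * Real.pi = Real.pi by ring, zero_add] at h2
    rw [← h2]
    simp [polarPoint]
  · simp
    linear_combination y.1 * (pd 1 F (polarPoint t y) + pd 2 G (polarPoint t y)) *
      Real.sin_sq_add_cos_sq y.2

end Polar

end

end MannMarolf

/-! ### The divergence theorem on a slab. -/

namespace MannMarolf

noncomputable section

open MeasureTheory

theorem mem_patch_equator (t s : ℝ) : ![t, Real.cos s, Real.sin s] ∈ patch := by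
  have := polarPoint_mem_patch (t := t) (y := (1, s)) zero_le_one le_rfl
  simpa [polarPoint] using this

theorem continuous_equator {g : (Fin 3 → ℝ) → ℝ} (hg : ∀ u ∈ patch, ContinuousAt g u) :
    Continuous fun y : ℝ × ℝ => g ![y.1, Real.cos y.2, Real.sin y.2] := by
  have hc : Continuous fun y : ℝ × ℝ => ![y.1, Real.cos y.2, Real.sin y.2] :=
    continuous_pi fun i => by fin_cases i <;> simp <;> fun_prop
  exact continuous_iff_continuousAt.2 fun y =>
    ContinuousAt.comp (g := g) (hg _ (mem_patch_equator y.1 y.2)) hc.continuousAt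

theorem hasDerivAt_time {F : (Fin 3 → ℝ) → ℝ} {t p q : ℝ} (hF : DifferentiableAt ℝ F ![t, p, q]) :
    HasDerivAt (fun t => F ![t, p, q]) (pd 0 F ![t, p, q]) t := by
  have h1 : HasDerivAt (fun t : ℝ => ![t, p, q]) (Pi.single 0 1) t := by
    rw [hasDerivAt_pi]
    intro i
    fin_cases i
    · exact hasDerivAt_id t
    · exact hasDerivAt_const t p
    · exact hasDerivAt_const t q
  exact hF.hasFDerivAt.comp_hasDerivAt t h1

/-- The divergence theorem on a slab. -/
theorem integral_divergence_slab {F : Fin 3 → (Fin 3 → ℝ) → ℝ}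
    (hF : ∀ a, ∀ u ∈ patch, ContDiffAt ℝ 1 (F a) u) {τ₁ τ₂ : ℝ} (h : τ₁ ≤ τ₂) :
    ∫ u in slab τ₁ τ₂, ∑ a, pd a (F a) u =
      (∫ w in unitDisc, F 0 ![τ₂, w.1, w.2]) - (∫ w in unitDisc, F 0 ![τ₁, w.1, w.2]) +
        ∫ t in τ₁..τ₂, ∫ s in (0 : ℝ)..2 * Real.pi,
          (Real.cos s * F 1 ![t, Real.cos s, Real.sin s] +
            Real.sin s * F 2 ![t, Real.cos s, Real.sin s]) := by
  have hd : ∀ a i, ∀ u ∈ patch, ContinuousAt (pd i (F a)) u := fun a i u hu =>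
    ((hF a u hu).pd (k := 0) (by norm_num)).continuousAt
  have hdiv : ∀ u ∈ patch, ContinuousAt (fun u => pd 1 (F 1) u + pd 2 (F 2) u) u := fun u hu =>
    (hd 1 1 u hu).add (hd 2 2 u hu)
  have hi : ∀ {g : (Fin 3 → ℝ) → ℝ}, (∀ u ∈ patch, ContinuousAt g u) →
      IntegrableOn g (slab τ₁ τ₂) := fun hg =>
    ContinuousOn.integrableOn_compact (isCompact_slab τ₁ τ₂) fun u hu =>
      (hg u (slab_subset_patch _ _ hu)).continuousWithinAt
  have hm : ∀ {w : ℝ × ℝ} (t : ℝ), w ∈ unitDisc → ![t, w.1, w.2] ∈ patch := fun t hw =>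
    mkPoint_mem_patch (x := (t, _)) hw
  have ht : ∀ {w : ℝ × ℝ}, w ∈ unitDisc → Continuous fun t : ℝ => pd 0 (F 0) ![t, w.1, w.2] :=
    fun {w} hw => continuous_iff_continuousAt.2 fun t =>
      ContinuousAt.comp (g := pd 0 (F 0)) (hd 0 0 _ (hm t hw))
        (continuous_mkPoint.comp (continuous_id.prodMk continuous_const)).continuousAt
  have hs : ∀ t, IntegrableOn (fun w : ℝ × ℝ => F 0 ![t, w.1, w.2]) unitDisc := fun t =>
    ContinuousOn.integrableOn_compact isCompact_unitDisc fun w hw =>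
      (ContinuousAt.comp (g := F 0) (f := fun w : ℝ × ℝ => ![t, w.1, w.2])
        (hF 0 _ (hm t hw)).continuousAt (continuous_mkPoint.comp (continuous_const.prodMk continuous_id)).continuousAt).continuousWithinAt
  simp only [Fin.sum_univ_three, add_assoc]
  -- Fubini is used in opposite orders: the time derivative is integrated in time first, the spatial
  -- divergence over the disc first.
  rw [integral_add (hi (hd 0 0)) (hi hdiv), setIntegral_slab_eq_disc (hd 0 0) h,
    setIntegral_slab_eq_time hdiv h, ← integral_sub (hs τ₂) (hs τ₁)]
  congr 1
  · refine setIntegral_congr_fun isCompact_unitDisc.measurableSet fun w hw => ?_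
    exact intervalIntegral.integral_eq_sub_of_hasDerivAt
      (fun t _ => hasDerivAt_time ((hF 0 _ (hm t hw)).differentiableAt (by norm_num)))
      ((ht hw).intervalIntegrable _ _)
  · exact intervalIntegral.integral_congr fun t _ =>
      integral_divergence_unitDisc (hF 1) (hF 2) t

/-- As `√(-h⁽⁰⁾)` is `dSFactor`, whose logarithmic derivatives are the contracted Christoffel
symbols, the covariant divergence times the density is a coordinate divergence. -/
theorem dSFactor_mul_divVector {J : (Fin 3 → ℝ) → Fin 3 → ℝ} {u : Fin 3 → ℝ}
    (hJ : ∀ a, DifferentiableAt ℝ (fun v => J v a) u) :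
    dSFactor u * divVector dS J u = ∑ a, pd a (fun v => dSFactor v * J v a) u := by
  have h : ∀ a, pd a (fun v => dSFactor v * J v a) u = _ := fun a =>
    ((hasPd_dSFactor u a).mul (.of_diff (i := a) (hJ a))).eq
  simp only [divVector_dS, Fin.sum_univ_three, h]
  ring

namespace Configuration

variable (X : Configuration) (P : Fin 2)

theorem densityIntegral_eq {τ₁ τ₂ : ℝ} (h : τ₁ ≤ τ₂) : X.densityIntegral τ₁ τ₂ =
    X.cutFlux τ₂ - X.cutFlux τ₁ + ∑ P, ∫ t in τ₁..τ₂, ∫ s in (0 : ℝ)..2 * Real.pi,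
      (Real.cos s * (dSFactor ![t, Real.cos s, Real.sin s] *
          X.current P ![t, Real.cos s, Real.sin s] 1) +
        Real.sin s * (dSFactor ![t, Real.cos s, Real.sin s] *
          X.current P ![t, Real.cos s, Real.sin s] 2)) := by
  rw [densityIntegral, cutFlux, cutFlux, ← Finset.sum_sub_distrib, ← Finset.sum_add_distrib]
  refine Finset.sum_congr rfl fun P _ => ?_
  have e : Set.EqOn (fun u => Real.sqrt (-(dS u).det) * X.density P u)
      (fun u => ∑ a, pd a (fun v => dSFactor v * X.current P v a) u) (slab τ₁ τ₂) := fun u hu => by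
    have hu' := slab_subset_patch _ _ hu
    simp only
    rw [sqrt_dS_det, X.density_eq_divVector P hu', dSFactor_mul_divVector fun a =>
      (X.contDiffAt_current P hu' a).differentiableAt (by simp)]
  rw [setIntegral_congr_fun (isCompact_slab τ₁ τ₂).measurableSet e,
    integral_divergence_slab (F := fun a v => dSFactor v * X.current P v a) (fun a u hu =>
      (contDiff_dSFactor.contDiffAt.mul ((X.contDiffAt_current P hu a).of_le (by simp)))) h]
  simp only [sqrt_dS_det]
  rfl

end Configuration

end

end MannMarolf

/-! ### The transition between the patches and cancellation at the equator. -/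

namespace MannMarolf

noncomputable section

/-- The transition between the two patches. -/
def inversion (u : Fin 3 → ℝ) : Fin 3 → ℝ :=
  ![u 0, u 1 * (u 1 ^ 2 + u 2 ^ 2)⁻¹, u 2 * (u 1 ^ 2 + u 2 ^ 2)⁻¹]

theorem pd_comp {n : ℕ} {F : (Fin n → ℝ) → ℝ} {φ : (Fin n → ℝ) → Fin n → ℝ} {x : Fin n → ℝ}
    (hF : DifferentiableAt ℝ F (φ x)) (i : Fin n) {d : Fin n → ℝ}
    (hφ : ∀ j, HasPd i (fun y => φ y j) x (d j)) :
    pd i (fun y => F (φ y)) x = ∑ j, d j * pd j F (φ x) := by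
  have h1 : HasFDerivAt φ (ContinuousLinearMap.pi fun j => fderiv ℝ (fun y => φ y j) x) x :=
    hasFDerivAt_pi.2 fun j => (hφ j).diff.hasFDerivAt
  rw [pd, show (fun y => F (φ y)) = F ∘ φ from rfl, (hF.hasFDerivAt.comp x h1).fderiv,
    ContinuousLinearMap.comp_apply, fderiv_apply_eq_sum]
  refine Finset.sum_congr rfl fun j _ => ?_
  rw [← (hφ j).eq]
  rfl

theorem hasPd_inv_sq {u : Fin 3 → ℝ} (hu : u 1 ^ 2 + u 2 ^ 2 ≠ 0) (i : Fin 3) :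
    HasPd i (fun v => (v 1 ^ 2 + v 2 ^ 2)⁻¹) u
      (![0, -2 * u 1, -2 * u 2] i * (u 1 ^ 2 + u 2 ^ 2)⁻¹ ^ 2) := by
  refine ((((HasPd.coord 1).pow 2).add ((HasPd.coord 2).pow 2)).inv hu).congr ?_
  fin_cases i <;> simp <;> field_simp

namespace Configuration

variable (X : Configuration)

theorem σ_eq_inversion {u : Fin 3 → ℝ} (hu : u 1 ^ 2 + u 2 ^ 2 ≠ 0) :
    X.σ 1 u = X.σ 0 (inversion u) := by
  have h := X.σ_glue (u 0) (u 1) (u 2) hu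
  have e : u = ![u 0, u 1, u 2] := by funext i; fin_cases i <;> rfl
  rw [← e] at h
  rw [h, inversion, div_eq_mul_inv, div_eq_mul_inv]

theorem pd_σ_inversion {u : Fin 3 → ℝ} (hu : u 1 ^ 2 + u 2 ^ 2 ≠ 0) (i : Fin 3) :
    pd i (X.σ 1) u = ![pd 0 (X.σ 0) (inversion u),
      ((u 1 ^ 2 + u 2 ^ 2)⁻¹ - 2 * u 1 ^ 2 * (u 1 ^ 2 + u 2 ^ 2)⁻¹ ^ 2) *
        pd 1 (X.σ 0) (inversion u) -
        2 * u 1 * u 2 * (u 1 ^ 2 + u 2 ^ 2)⁻¹ ^ 2 * pd 2 (X.σ 0) (inversion u),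
      ((u 1 ^ 2 + u 2 ^ 2)⁻¹ - 2 * u 2 ^ 2 * (u 1 ^ 2 + u 2 ^ 2)⁻¹ ^ 2) *
        pd 2 (X.σ 0) (inversion u) -
        2 * u 1 * u 2 * (u 1 ^ 2 + u 2 ^ 2)⁻¹ ^ 2 * pd 1 (X.σ 0) (inversion u)] i := by
  have hev : ∀ᶠ v : Fin 3 → ℝ in 𝓝 u, v 1 ^ 2 + v 2 ^ 2 ≠ 0 :=
    (show Continuous fun v : Fin 3 → ℝ => v 1 ^ 2 + v 2 ^ 2 by fun_prop).continuousAt.eventually_ne hu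
  rw [pd_congr (g := fun v => X.σ 0 (inversion v)) (hev.mono fun v hv => X.σ_eq_inversion hv)]
  have hι : ∀ j, HasPd i (fun v => inversion v j) u (![if i = 0 then 1 else 0,
      (if i = 1 then 1 else 0) * (u 1 ^ 2 + u 2 ^ 2)⁻¹ +
        u 1 * (![0, -2 * u 1, -2 * u 2] i * (u 1 ^ 2 + u 2 ^ 2)⁻¹ ^ 2),
      (if i = 2 then 1 else 0) * (u 1 ^ 2 + u 2 ^ 2)⁻¹ +
        u 2 * (![0, -2 * u 1, -2 * u 2] i * (u 1 ^ 2 + u 2 ^ 2)⁻¹ ^ 2)] j) := fun j => by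
    fin_cases j
    · exact .coord 0
    · exact (HasPd.coord 1).mul (hasPd_inv_sq hu i)
    · exact (HasPd.coord 2).mul (hasPd_inv_sq hu i)
  rw [pd_comp ((X.σ_smooth 0).contDiffAt.differentiableAt (by simp)) i hι, Fin.sum_univ_three]
  fin_cases i <;> simp <;> ring

/-- `σ_a σ^a + σ²`. -/
def gradSq (P : Fin 2) (u : Fin 3 → ℝ) : ℝ :=
  -pd 0 (X.σ P) u ^ 2 + (dSFactor u)⁻¹ * (pd 1 (X.σ P) u ^ 2 + pd 2 (X.σ P) u ^ 2) + X.σ P u ^ 2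

/-- The inversion is an isometry between the two charts and `gradSq` is a scalar built from the
glued function `σ`. -/
theorem gradSq_inversion {u : Fin 3 → ℝ} (hu : u 1 ^ 2 + u 2 ^ 2 ≠ 0) :
    X.gradSq 1 u = X.gradSq 0 (inversion u) := by
  have hf : (dSFactor (inversion u))⁻¹ = (dSFactor u)⁻¹ * (u 1 ^ 2 + u 2 ^ 2)⁻¹ ^ 2 := by
    have hc := (Real.cosh_pos (u 0)).ne'
    have h1 := (one_add_sq_pos u).ne'
    have e : 1 + (u 1 * (u 1 ^ 2 + u 2 ^ 2)⁻¹) ^ 2 + (u 2 * (u 1 ^ 2 + u 2 ^ 2)⁻¹) ^ 2 =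
        (1 + u 1 ^ 2 + u 2 ^ 2) * (u 1 ^ 2 + u 2 ^ 2)⁻¹ := by
      field_simp
      ring
    simp only [dSFactor, inversion, Matrix.cons_val_zero, Matrix.cons_val_one, Matrix.cons_val]
    rw [e]
    field_simp
  rw [gradSq, gradSq, hf, X.σ_eq_inversion hu]
  simp only [X.pd_σ_inversion hu, Matrix.cons_val_zero, Matrix.cons_val_one, Matrix.cons_val]
  field_simp
  ring

theorem hasPd_gradSq (P : Fin 2) (u : Fin 3 → ℝ) (i : Fin 3) : HasPd i (X.gradSq P) u
    (2 * (-(pd 0 (X.σ P) u * pd i (pd 0 (X.σ P)) u) + (dSFactor u)⁻¹ *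
      (pd 1 (X.σ P) u * pd i (pd 1 (X.σ P)) u + pd 2 (X.σ P) u * pd i (pd 2 (X.σ P)) u -
        dSLog u i * (pd 1 (X.σ P) u ^ 2 + pd 2 (X.σ P) u ^ 2)) + X.σ P u * pd i (X.σ P) u)) := by
  have d0 : HasPd i (X.σ P) u _ := .of_diff ((X.σ_smooth P).contDiffAt.differentiableAt (by simp))
  have d1 : ∀ j, HasPd i (pd j (X.σ P)) u _ := fun j => .of_diff
    (((X.σ_smooth P).contDiffAt.pd (k := ∞) (by simp)).differentiableAt (by simp))
  refine ((((d1 0).pow 2).neg.add ((hasPd_inv_dSFactor u i).mul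
    (((d1 1).pow 2).add ((d1 2).pow 2)))).add (d0.pow 2)).congr ?_
  push_cast
  ring

/-- `(σ^{ab} + σ h^{ab}) σ_b = ½ D^a (σ_b σ^b + σ²)`. For spatial components the inverse metric
cancels the volume factor, leaving a plain partial derivative. -/
theorem dSFactor_mul_raiseGrad_one (P : Fin 2) (u : Fin 3 → ℝ) :
    dSFactor u * raiseGrad dS (X.hessShift P) (X.σ P) u 1 = 1 / 2 * pd 1 (X.gradSq P) u := by
  have h0 := (dSFactor_pos u).ne'
  have hc : pd 1 (pd 2 (X.σ P)) u = pd 2 (pd 1 (X.σ P)) u :=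
    pd_comm ((X.σ_smooth P).contDiffAt.of_le ENat.LEInfty.out)
  rw [(X.hasPd_gradSq P u 1).eq, raiseGrad_dS_one]
  simp [hessShift, hess_dS, dS_eq]
  field_simp
  ring

theorem dSFactor_mul_raiseGrad_two (P : Fin 2) (u : Fin 3 → ℝ) :
    dSFactor u * raiseGrad dS (X.hessShift P) (X.σ P) u 2 = 1 / 2 * pd 2 (X.gradSq P) u := by
  have h0 := (dSFactor_pos u).ne'
  rw [(X.hasPd_gradSq P u 2).eq, raiseGrad_dS_two]
  simp [hessShift, hess_dS, dS_eq]
  field_simp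
  ring

theorem hasDerivAt_gradSq_radial (P : Fin 2) (t s : ℝ) {φ : ℝ → ℝ} {φ' : ℝ}
    (hφ : HasDerivAt φ φ' 1) (h1 : φ 1 = 1) :
    HasDerivAt (fun r => X.gradSq P ![t, φ r * Real.cos s, φ r * Real.sin s])
      (φ' * (Real.cos s * pd 1 (X.gradSq P) ![t, Real.cos s, Real.sin s] +
        Real.sin s * pd 2 (X.gradSq P) ![t, Real.cos s, Real.sin s])) 1 := by
  have hc : HasDerivAt (fun r => ![t, φ r * Real.cos s, φ r * Real.sin s])
      ![0, φ' * Real.cos s, φ' * Real.sin s] 1 := by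
    rw [hasDerivAt_pi]
    intro i
    fin_cases i
    · exact hasDerivAt_const 1 t
    · exact hφ.mul_const _
    · exact hφ.mul_const _
  have e : ![t, φ 1 * Real.cos s, φ 1 * Real.sin s] = ![t, Real.cos s, Real.sin s] := by
    rw [h1, one_mul, one_mul]
  have hd := (X.hasPd_gradSq P ![t, Real.cos s, Real.sin s] 0).diff.hasFDerivAt
  rw [← e] at hd
  refine (hd.comp_hasDerivAt 1 hc).congr_deriv ?_
  rw [e, fderiv_apply_eq_sum, Fin.sum_univ_three]
  simp
  ring

/-- On a ray through the equator the transition is `r ↦ 1/r`, with derivative `-1` at `r = 1`. The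
outward directions of the patches are thus opposite and the outward derivatives of a global function
cancel. -/
theorem radial_gradSq_add (t s : ℝ) :
    (Real.cos s * pd 1 (X.gradSq 0) ![t, Real.cos s, Real.sin s] +
      Real.sin s * pd 2 (X.gradSq 0) ![t, Real.cos s, Real.sin s]) +
    (Real.cos s * pd 1 (X.gradSq 1) ![t, Real.cos s, Real.sin s] +
      Real.sin s * pd 2 (X.gradSq 1) ![t, Real.cos s, Real.sin s]) = 0 := by
  have h0 := X.hasDerivAt_gradSq_radial 0 t s (hasDerivAt_inv one_ne_zero) inv_one
  have h1 := X.hasDerivAt_gradSq_radial 1 t s (hasDerivAt_id 1) rfl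
  have e : (fun r => X.gradSq 1 ![t, id r * Real.cos s, id r * Real.sin s]) =ᶠ[𝓝 1]
      fun r => X.gradSq 0 ![t, r⁻¹ * Real.cos s, r⁻¹ * Real.sin s] := by
    filter_upwards [continuousAt_id.eventually_ne (one_ne_zero (α := ℝ))] with r hr
    have hr' : r ≠ 0 := hr
    have hn : (r * Real.cos s) ^ 2 + (r * Real.sin s) ^ 2 = r ^ 2 := by
      linear_combination r ^ 2 * Real.sin_sq_add_cos_sq s
    rw [X.gradSq_inversion (u := ![t, id r * Real.cos s, id r * Real.sin s]) (by
      simp only [Matrix.cons_val_one, Matrix.cons_val_zero, Matrix.cons_val, id, hn]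
      exact pow_ne_zero 2 hr')]
    simp only [inversion, Matrix.cons_val_one, Matrix.cons_val_zero, Matrix.cons_val, id, hn]
    congr 1
    rw [show r * Real.cos s * (r ^ 2)⁻¹ = r⁻¹ * Real.cos s by field_simp,
      show r * Real.sin s * (r ^ 2)⁻¹ = r⁻¹ * Real.sin s by field_simp]
  have := (h0.congr_of_eventuallyEq e).unique h1
  linarith

end Configuration

end

end MannMarolf

/-! ### The boundary contributions and the main theorem. -/

namespace MannMarolf

noncomputable section

open MeasureTheory

theorem integral_integral_add {g h : ℝ × ℝ → ℝ} (hg : Continuous g) (hh : Continuous h)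
    (a b c d : ℝ) : ∫ t in a..b, ∫ s in c..d, (g (t, s) + h (t, s)) =
      (∫ t in a..b, ∫ s in c..d, g (t, s)) + ∫ t in a..b, ∫ s in c..d, h (t, s) := by
  have hi : ∀ {g : ℝ × ℝ → ℝ}, Continuous g → Continuous fun t => ∫ s in c..d, g (t, s) := fun hg =>
    intervalIntegral.continuous_parametric_intervalIntegral_of_continuous' (by exact hg) c d
  have hs : ∀ {g : ℝ × ℝ → ℝ}, Continuous g → ∀ t, IntervalIntegrable (fun s => g (t, s)) volume c d :=
    fun hg t => (hg.comp (continuous_const.prodMk continuous_id)).intervalIntegrable _ _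
  rw [← intervalIntegral.integral_add ((hi hg).intervalIntegrable _ _)
    ((hi hh).intervalIntegrable _ _)]
  exact intervalIntegral.integral_congr fun t _ =>
    intervalIntegral.integral_add (hs hg t) (hs hh t)

namespace Configuration

variable (X : Configuration)

/-- The equatorial flux of the current splits into the flux of `k^{ab} σ_b` and minus half the
outward derivative of `gradSq`. The latter cancels between the patches, whereas `k` may jump. -/
theorem densityIntegral_eq_boundaryContribution {τ₁ τ₂ : ℝ} (h : τ₁ ≤ τ₂) :
    X.densityIntegral τ₁ τ₂ = X.boundaryContribution τ₁ τ₂ := by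
  rw [X.densityIntegral_eq h, boundaryContribution, equatorFlux]
  congr 1
  simp only [sqrt_dS_det]
  set e : ℝ × ℝ → Fin 3 → ℝ := fun y => ![y.1, Real.cos y.2, Real.sin y.2]
  set K : Fin 2 → ℝ × ℝ → ℝ := fun P y => dSFactor (e y) *
    (Real.cos y.2 * raiseGrad dS (X.k P) (X.σ P) (e y) 1 +
      Real.sin y.2 * raiseGrad dS (X.k P) (X.σ P) (e y) 2)
  set V : Fin 2 → ℝ × ℝ → ℝ := fun P y => 1 / 2 * (Real.cos y.2 * pd 1 (X.gradSq P) (e y) +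
    Real.sin y.2 * pd 2 (X.gradSq P) (e y))
  have hV : ∀ y, -V 1 y = V 0 y := fun y => by
    simp only [V]
    linarith [X.radial_gradSq_add y.1 y.2]
  have hJ : ∀ P y, Real.cos y.2 * (dSFactor (e y) * X.current P (e y) 1) +
      Real.sin y.2 * (dSFactor (e y) * X.current P (e y) 2) = K P y + -V P y := fun P y => by
    have h1 := X.dSFactor_mul_raiseGrad_one P (e y)
    have h2 := X.dSFactor_mul_raiseGrad_two P (e y)
    simp only [X.current_eq, K, V]
    linear_combination -Real.cos y.2 * h1 - Real.sin y.2 * h2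
  have hf : Continuous fun y => dSFactor (e y) :=
    continuous_equator fun u _ => (contDiff_dSFactor (k := 0)).continuous.continuousAt
  have hcos : Continuous fun y : ℝ × ℝ => Real.cos y.2 := by fun_prop
  have hsin : Continuous fun y : ℝ × ℝ => Real.sin y.2 := by fun_prop
  have hc : ∀ (F : Fin 2 → Fin 3 → (Fin 3 → ℝ) → ℝ) P, (∀ i, ∀ u ∈ patch, ContinuousAt (F P i) u) →
      Continuous fun y : ℝ × ℝ => Real.cos y.2 * F P 1 (e y) + Real.sin y.2 * F P 2 (e y) :=
    fun F P hF => (hcos.mul (continuous_equator (hF 1))).add (hsin.mul (continuous_equator (hF 2)))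
  have hK : ∀ P, Continuous (K P) := fun P =>
    hf.mul (hc (fun P i u => raiseGrad dS (X.k P) (X.σ P) u i) P fun i u hu =>
      (X.contDiffAt_raiseGrad_k P hu i).continuousAt)
  have hVJ : ∀ P, V P = fun y => dSFactor (e y) * (Real.cos y.2 *
      raiseGrad dS (X.hessShift P) (X.σ P) (e y) 1 +
        Real.sin y.2 * raiseGrad dS (X.hessShift P) (X.σ P) (e y) 2) := fun P => funext fun y => by
    have h1 := X.dSFactor_mul_raiseGrad_one P (e y)
    have h2 := X.dSFactor_mul_raiseGrad_two P (e y)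
    simp only [V]
    linear_combination -Real.cos y.2 * h1 - Real.sin y.2 * h2
  have hVc : ∀ P, Continuous (V P) := fun P => by
    rw [hVJ]
    exact hf.mul (hc (fun P i u => raiseGrad dS (X.hessShift P) (X.σ P) u i) P fun i u _ =>
      (X.contDiff_raiseGrad_hessShift P i).continuous.continuousAt)
  have h0 : ∀ P, ∫ t in τ₁..τ₂, ∫ s in (0 : ℝ)..2 * Real.pi,
      (Real.cos s * (dSFactor ![t, Real.cos s, Real.sin s] *
          X.current P ![t, Real.cos s, Real.sin s] 1) +
        Real.sin s * (dSFactor ![t, Real.cos s, Real.sin s] *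
          X.current P ![t, Real.cos s, Real.sin s] 2)) =
      (∫ t in τ₁..τ₂, ∫ s in (0 : ℝ)..2 * Real.pi, K P (t, s)) +
        ∫ t in τ₁..τ₂, ∫ s in (0 : ℝ)..2 * Real.pi, -V P (t, s) := fun P => by
    rw [← integral_integral_add (hK P) (h := fun y => -V P y) (hVc P).neg]
    exact intervalIntegral.integral_congr fun t _ => intervalIntegral.integral_congr fun s _ =>
      hJ P (t, s)
  rw [Finset.sum_congr rfl fun P _ => h0 P, Fin.sum_univ_two, Fin.sum_univ_two]
  simp only [hV, intervalIntegral.integral_neg]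
  ring

end Configuration

end

end MannMarolf

theorem mainTheorem2 (X : MannMarolf.Configuration) :
    (∃ Khat, X.IsMannMarolf Khat) ∧
    (∀ P, ∀ u ∈ MannMarolf.patch,
      X.density P u = MannMarolf.divVector MannMarolf.dS (X.current P) u) ∧
    ∀ Khat, X.IsMannMarolf Khat → ∀ τ₁ τ₂ : ℝ, τ₁ ≤ τ₂ →
      (∃ C, ∃ R > 0, ∀ P, ∀ ρ > R, ∀ u ∈ MannMarolf.slab τ₁ τ₂,
        |X.meanCurv P ρ u - 3 / ρ| ≤ C / ρ ^ 3 ∧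
        |X.hatTrace Khat P ρ u - 3 / ρ| ≤ C / ρ ^ 3 ∧
        |X.meanCurv P ρ u - X.hatTrace Khat P ρ u - 1 / (4 * ρ ^ 3) * X.density P u| ≤
          C / ρ ^ 4) ∧
      (∀ᶠ ρ in Filter.atTop, ∀ P, MeasureTheory.IntegrableOn
        (fun u => Real.sqrt (-(X.h P ρ u).det) *
          (X.meanCurv P ρ u - X.hatTrace Khat P ρ u)) (MannMarolf.slab τ₁ τ₂)) ∧
      (∀ G : ℝ, 0 < G → ∀ᶠ ρ₀ in Filter.atTop,
        Filter.Tendsto (fun ρ => 16 * Real.pi * G * X.action G Khat τ₁ τ₂ ρ₀ ρ) Filter.atTop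
          (nhds (1 / 2 * X.densityIntegral τ₁ τ₂))) ∧
      X.densityIntegral τ₁ τ₂ = X.boundaryContribution τ₁ τ₂ ∧
      (X.boundaryContribution τ₁ τ₂ = 0 → ∀ G : ℝ, 0 < G → ∀ᶠ ρ₀ in Filter.atTop,
        Filter.Tendsto (fun ρ => X.action G Khat τ₁ τ₂ ρ₀ ρ) Filter.atTop (nhds 0)) := by
  refine ⟨X.exists_isMannMarolf, fun P u hu => X.density_eq_divVector P hu,
    fun Khat hK τ₁ τ₂ h => ⟨X.asymptotics τ₁ τ₂ hK, X.eventually_integrableOn τ₁ τ₂ hK,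
      fun G hG => ?_, X.densityIntegral_eq_boundaryContribution h, fun h0 G hG => ?_⟩⟩
  · filter_upwards [X.tendsto_action τ₁ τ₂ hK G] with ρ₀ hρ
    have e : 16 * Real.pi * G * (1 / (8 * Real.pi * G) * (1 / 4 * X.densityIntegral τ₁ τ₂)) =
        1 / 2 * X.densityIntegral τ₁ τ₂ := by
      have := Real.pi_pos.ne'
      field_simp
      ring
    rw [← e]
    exact hρ.const_mul _
  · filter_upwards [X.tendsto_action τ₁ τ₂ hK G] with ρ₀ hρ
    rwa [X.densityIntegral_eq_boundaryContribution h, h0, mul_zero, mul_zero] at hρ
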